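/- **Setting.** Let $\eta=\mathrm{diag}(1,-1,-1,-1)$ and $O(1,3)=\{\lambda\in\mathbb R^{4\times4}:\lambda^T\eta\lambda=\eta\}$. Let $i\gamma^\mu$ ($\mu=0,1,2,3$) be Majorana matrices, that is, unitary complex $4\times 4$ matrices with $(i\gamma^\mu)(i\gamma^\nu)+(i\gamma^\nu)(i\gamma^\mu)=-2\eta^{\mu\nu}$, and let $\Theta$ be an antilinear involution of $\mathbb C^4$ that commutes with them. Put $\gamma^\mu=-i(i\gamma^\mu)$, $i\gamma^5=-\gamma^0\gamma^1\gamma^2\gamma^3$, $\gamma^5=-i(i\gamma^5)$. The Majorana spinors are the real vector space $\mathrm{Pinor}=\{u\in\mathbb C^4:\Theta u=u\}$. Let $\mathrm{Pin}(3,1)$ be the set of the invertible $S\in\mathrm{End}_{\mathbb R}(\mathrm{Pinor})$ with $|\det S|=1$ and $S^{-1}(i\gamma^\mu)S\in\mathrm{span}_{\mathbb R}\{i\gamma^\nu\}$ for all $\mu$, and define $\Lambda(S)$ by $S^{-1}(i\gamma^\mu)S=\Lambda(S)^\mu{}_\nu\, i\gamma^\nu$. Let $\Sigma:\mathbb C^2\to\mathrm{Pinor}$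 be a real-linear isomorphism with $\Sigma(ip)=i\gamma^5\Sigma(p)$ and $\Sigma(\sigma^3p)=\gamma^0\gamma^3\Sigma(p)$, where $\sigma^3=\mathrm{diag}(1,-1)$ (such $\Sigma$ exist). The group $SL(2,\mathbb C)$ acts on $\mathrm{Pinor}$ by $T\mapsto \Sigma T\Sigma^{-1}$, on $\mathbb C^4$ by the complex-linear extension of this action, and on tensors over these spaces by applying the same operator to each index. An operator $A$ acting on the $k$-th index is written $A_k$. For $2m\in\mathbb N=\{0,1,2,\dots\}$ let $W_m$ be the space of the symmetric tensors $w$ with $2m$ Majorana spinor indexes such that $(i\gamma^5)_1(i\gamma^5)_k w=-w$ for every $k$, and let $(W_m)^2\subset W_m\otimes W_m$ be the span of the $u\otimes v+v\otimes u$ with $u,v\in W_m$. For $2m,2n\in\mathbb N$ put $$W_{(m,n)}=\Big\{\tfrac{1+(i\gamma^5)_1\otimes(i\gamma^5)_1}{2}\,w: w\in W_m\otimes W_n\Big\}\ (m\neq n),\qquad W_{(m,m)}=\Big\{\tfrac{1+(i\gamma^5)_1\otimes(i\gamma^5)_1}{2}\,w: w\in (W_m)^2\Big\},$$ where the projection is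 omitted if $m=0$ or $n=0$ (so $W_{(m,0)}\cong W_m$ for $m>0$). Let $V_m^{\pm}$ be the space of the symmetric tensors $v$ with $2m$ Dirac spinor indexes (in $\mathbb C^4$) such that $\gamma^5_kv=\pm v$ for every $k$, and let $V_{(m,n)}=V_m^+\otimes V_n^-$. **Statement.** 1. For $2m,2n\in\mathbb N$ with $m\ge n$, $W_{(m,n)}$ is a finite-dimensional real continuous irreducible representation of $SL(2,\mathbb C)$. These representations are pairwise inequivalent, and every finite-dimensional real continuous irreducible (in particular nonzero) representation of $SL(2,\mathbb C)$ is equivalent to one of them. $W_{(0,0)}$ is equivalent to $\mathbb R$ with the trivial action. 2. The map $\Lambda$ sends $\mathrm{Pin}(3,1)$ onto $O(1,3)$; $\mathrm{Pin}(3,1)$ contains the image $\Sigma\,SL(2,\mathbb C)\,\Sigma^{-1}$, the parity $i\gamma^0$, with $\Lambda(i\gamma^0)=\eta$, and the time reversal $\gamma^0\gamma^5$, with $\Lambda(\gamma^0\gamma^5)=-\eta$. For $m\ge n$ every $S\in\mathrm{Pin}(3,1)$, applied to each index, maps $W_{(m,n)}$ onto itself, and this defines a projective representation of the full Lorentz group: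 there is a map $P:O(1,3)\to GL(W_{(m,n)})$ with $P(\lambda\lambda')=\pm P(\lambda)P(\lambda')$ for all $\lambda,\lambda'$, such that $P(\Lambda(S))$ is, up to sign, the action of $S$ for every $S\in\mathrm{Pin}(3,1)$. In particular parity and time reversal preserve $W_{(m,n)}$. 3. In contrast, for all $2m,2n\in\mathbb N$ the parity $i\gamma^0$, applied to each index, maps $V_m^+\otimes V_n^-$ onto $V_m^-\otimes V_n^+$, and, for $m\neq n$, parity does not preserve the complex representation $V_{(m,n)}$: the space $V_m^-\otimes V_n^+$ differs from $V_m^+\otimes V_n^-$, and there is no invertible complex-linear operator $Q$ on $V_{(m,n)}$ such that, for all $T,T'\in SL(2,\mathbb C)$ with $\Sigma T'\Sigma^{-1}=(i\gamma^0)\,\Sigma T\Sigma^{-1}\,(i\gamma^0)^{-1}$, the operator $Q\,T\,Q^{-1}$ on $V_{(m,n)}$ is a scalar multiple of the action of $T'$. -/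

import Mathlib

open scoped TensorProduct MatrixGroups Matrix

noncomputable section

namespace MajoranaRep

/-! ### Tensors with spinor indexes -/

section Tensors

variable (𝕜 : Type*) [Field 𝕜] (E : Type*) [AddCommGroup E] [Module 𝕜 E]

/-- Tensors over `E` with `k` indexes. -/
abbrev Ten (k : ℕ) : Type _ := PiTensorProduct 𝕜 (fun _ : Fin k => E)

/-- Tensors with a first group of `a` indexes and a second group of `b` indexes. -/
abbrev Ten₂ (a b : ℕ) : Type _ := Ten 𝕜 E a ⊗[𝕜] Ten 𝕜 E b

variable {𝕜 E}

/-- The operator `A` acting on the `i`-th index. -/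
def onIndex {k : ℕ} (A : Module.End 𝕜 E) (i : Fin k) : Module.End 𝕜 (Ten 𝕜 E k) :=
  PiTensorProduct.map (Function.update (fun _ => LinearMap.id) i A)

/-- The same operator `S` applied to each of the `k` indexes. -/
def onAll (k : ℕ) : Module.End 𝕜 E →* Module.End 𝕜 (Ten 𝕜 E k) where
  toFun S := PiTensorProduct.map (fun _ => S)
  map_one' := PiTensorProduct.map_one
  map_mul' S T := PiTensorProduct.map_mul (fun _ => S) (fun _ => T)

/-- The same operator `S` applied to each of the `a + b` indexes. -/
def act (a b : ℕ) : Module.End 𝕜 E →* Module.End 𝕜 (Ten₂ 𝕜 E a b) where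
  toFun S := TensorProduct.map (onAll a S) (onAll b S)
  map_one' := by
    rw [map_one, map_one]; exact TensorProduct.map_id
  map_mul' S T := by
    rw [map_mul, map_mul]; exact TensorProduct.map_mul _ _ _ _

/-- Invariance under all the permutations of the indexes. -/
def IsSymmetric {k : ℕ} (w : Ten 𝕜 E k) : Prop :=
  ∀ σ : Equiv.Perm (Fin k), PiTensorProduct.reindex 𝕜 (fun _ => E) σ w = w

theorem onAll_onIndex {k : ℕ} {A S : Module.End 𝕜 E} (h : S * A = A * S) (i : Fin k)
    (w : Ten 𝕜 E k) : onAll k S (onIndex A i w) = onIndex A i (onAll k S w) := by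
  have key : onAll k S * onIndex A i = onIndex A i * onAll k S := by
    simp only [onAll, onIndex, MonoidHom.coe_mk, OneHom.coe_mk, ← PiTensorProduct.map_mul]
    congr 1
    funext j
    by_cases hj : j = i
    · subst hj; simpa using h
    · simp only [Function.update_of_ne hj]; rfl
  exact LinearMap.congr_fun key w

theorem IsSymmetric.onAll {k : ℕ} {w : Ten 𝕜 E k} (hw : IsSymmetric w) (S : Module.End 𝕜 E) :
    IsSymmetric (onAll k S w) := by
  intro σ
  have := PiTensorProduct.map_reindex (R := 𝕜) (fun _ : Fin k => S) σ w
  exact this.symm.trans (congrArg _ (hw σ))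

end Tensors

/-- The restriction of a representation to an invariant subspace. -/
def restrictRep {𝕜 G X : Type*} [Field 𝕜] [Monoid G] [AddCommGroup X] [Module 𝕜 X]
    (ρ : G →* Module.End 𝕜 X) (p : Submodule 𝕜 X) (h : ∀ T, ∀ x ∈ p, ρ T x ∈ p) :
    Representation 𝕜 G p where
  toFun T := (ρ T).restrict (h T)
  map_one' := LinearMap.ext fun x => Subtype.ext (by simp)
  map_mul' T U := LinearMap.ext fun x => Subtype.ext (by simp)

/-! ### The real spaces `W` -/

section RealSpaces

variable {E : Type*} [AddCommGroup E] [Module ℝ E]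

/-- With `J = iγ⁵` and `k = 2m`, this is `W_m`: the symmetric tensors `w` with `2m` Majorana spinor
indexes such that `J₁ Jᵢ w = -w` for every index `i` (for `k = 0` the second condition is void). -/
def symW (J : Module.End ℝ E) (k : ℕ) : Submodule ℝ (Ten ℝ E k) where
  carrier := {w | IsSymmetric w ∧
    ∀ (h : 0 < k) (i : Fin k), onIndex J ⟨0, h⟩ (onIndex J i w) = -w}
  zero_mem' := ⟨fun σ => map_zero _, fun h i => by simp⟩
  add_mem' := by
    rintro u v ⟨hu, hu'⟩ ⟨hv, hv'⟩
    refine ⟨fun σ => by rw [map_add, hu σ, hv σ], fun h i => ?_⟩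
    rw [map_add, map_add, hu' h i, hv' h i, neg_add]
  smul_mem' := by
    rintro c u ⟨hu, hu'⟩
    refine ⟨fun σ => by rw [map_smul, hu σ], fun h i => ?_⟩
    rw [map_smul, map_smul, hu' h i, smul_neg]

/-- The operator `(1 + J₁ ⊗ J₁) / 2`. If one of the two groups of indexes is empty, there is no
operator `J₁` on that factor and no projection is made. -/
def projJ (J : Module.End ℝ E) (a b : ℕ) : Module.End ℝ (Ten₂ ℝ E a b) :=
  if h : 0 < a ∧ 0 < b then
    (1 / 2 : ℝ) • (1 + TensorProduct.map (onIndex J ⟨0, h.1⟩) (onIndex J ⟨0, h.2⟩))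
  else 1

/-- `W_m ⊗ W_n`, with `a = 2m` and `b = 2n`. -/
def tensW (J : Module.End ℝ E) (a b : ℕ) : Submodule ℝ (Ten₂ ℝ E a b) :=
  Submodule.span ℝ {x | ∃ u ∈ symW J a, ∃ v ∈ symW J b, x = u ⊗ₜ[ℝ] v}

/-- `(W_m)²`, with `a = 2m`: the linear combinations of the `u ⊗ v + v ⊗ u`, for `u, v ∈ W_m`. -/
def symSq (J : Module.End ℝ E) (a : ℕ) : Submodule ℝ (Ten₂ ℝ E a a) :=
  Submodule.span ℝ {x | ∃ u ∈ symW J a, ∃ v ∈ symW J a, x = u ⊗ₜ[ℝ] v + v ⊗ₜ[ℝ] u}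

/-- `W_(m,n)`, with `a = 2m` and `b = 2n`. -/
def spaceW (J : Module.End ℝ E) (a b : ℕ) : Submodule ℝ (Ten₂ ℝ E a b) :=
  if h : a = b then h ▸ (symSq J a).map (projJ J a a)
  else (tensW J a b).map (projJ J a b)

variable {J S : Module.End ℝ E}

theorem symW_onAll (h : S * J = J * S) {k : ℕ} {w : Ten ℝ E k} (hw : w ∈ symW J k) :
    onAll k S w ∈ symW J k := by
  refine ⟨hw.1.onAll S, fun hk i => ?_⟩
  rw [← onAll_onIndex h, ← onAll_onIndex h, hw.2 hk i, map_neg]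

theorem projJ_act (h : S * J = J * S) (a b : ℕ) (x : Ten₂ ℝ E a b) :
    act a b S (projJ J a b x) = projJ J a b (act a b S x) := by
  unfold projJ
  split_ifs with hab
  · induction x using TensorProduct.induction_on with
    | zero => simp
    | add x y hx hy => simp only [map_add, hx, hy]
    | tmul u v => simp [act, onAll_onIndex h]
  · rfl

theorem spaceW_act (h : S * J = J * S) (a b : ℕ) {x : Ten₂ ℝ E a b} (hx : x ∈ spaceW J a b) :
    act a b S x ∈ spaceW J a b := by
  unfold spaceW at hx ⊢
  split_ifs at hx ⊢ with hab
  · subst hab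
    obtain ⟨y, hy, rfl⟩ := hx
    refine ⟨act a a S y, ?_, (projJ_act h a a y).symm⟩
    refine (Submodule.span_le (p := (symSq J a).comap (act a a S))).2 ?_ hy
    rintro _ ⟨u, hu, v, hv, rfl⟩
    exact Submodule.subset_span
      ⟨_, symW_onAll h hu, _, symW_onAll h hv, by simp [act]⟩
  · obtain ⟨y, hy, rfl⟩ := hx
    refine ⟨act a b S y, ?_, (projJ_act h a b y).symm⟩
    refine (Submodule.span_le (p := (tensW J a b).comap (act a b S))).2 ?_ hy
    rintro _ ⟨u, hu, v, hv, rfl⟩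
    exact Submodule.subset_span
      ⟨_, symW_onAll h hu, _, symW_onAll h hv, by simp [act]⟩

/-- The vector space underlying `spaceW`. -/
def WSpace (J : Module.End ℝ E) (a b : ℕ) : Type _ := spaceW J a b

instance (J : Module.End ℝ E) (a b : ℕ) : AddCommGroup (WSpace J a b) :=
  inferInstanceAs (AddCommGroup (spaceW J a b))

instance (J : Module.End ℝ E) (a b : ℕ) : Module ℝ (WSpace J a b) :=
  inferInstanceAs (Module ℝ (spaceW J a b))

/-- The inclusion of `spaceW` in the space of all tensors. -/
def WSpace.incl (J : Module.End ℝ E) (a b : ℕ) : WSpace J a b →ₗ[ℝ] Ten₂ ℝ E a b :=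
  (spaceW J a b).subtype

/-- The representation on `spaceW` by which each group element acts on every index. -/
def WSpace.rep {Γ : Type*} [Monoid Γ] (J : Module.End ℝ E) (a b : ℕ) (ρ : Γ →* Module.End ℝ E)
    (h : ∀ T, ρ T * J = J * ρ T) : Representation ℝ Γ (WSpace J a b) :=
  restrictRep ((act a b).comp ρ) (spaceW J a b) fun T _ hx => spaceW_act (h T) a b hx

end RealSpaces

/-! ### The complex spaces `V` -/

section ComplexSpaces

variable {E : Type*} [AddCommGroup E] [Module ℂ E]

/-- With `G = γ⁵`, `ε = ±1` and `k = 2m`, this is `V_m^±`: the symmetric tensors `v` with `2m`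
Dirac spinor indexes such that `G` acts as `ε` on every index of `v`. -/
def chiral (G : Module.End ℂ E) (ε : ℂ) (k : ℕ) : Submodule ℂ (Ten ℂ E k) where
  carrier := {v | IsSymmetric v ∧ ∀ i : Fin k, onIndex G i v = ε • v}
  zero_mem' := ⟨fun σ => map_zero _, fun i => by simp⟩
  add_mem' := by
    rintro u v ⟨hu, hu'⟩ ⟨hv, hv'⟩
    exact ⟨fun σ => by rw [map_add, hu σ, hv σ],
      fun i => by rw [map_add, hu' i, hv' i, smul_add]⟩
  smul_mem' := by
    rintro c u ⟨hu, hu'⟩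
    exact ⟨fun σ => by rw [map_smul, hu σ],
      fun i => by rw [map_smul, hu' i, smul_comm]⟩

/-- `V_m^ε ⊗ V_n^δ`, with `a = 2m` and `b = 2n`. -/
def spaceV (G : Module.End ℂ E) (ε δ : ℂ) (a b : ℕ) : Submodule ℂ (Ten₂ ℂ E a b) :=
  Submodule.span ℂ {x | ∃ u ∈ chiral G ε a, ∃ v ∈ chiral G δ b, x = u ⊗ₜ[ℂ] v}

theorem chiral_onAll {G S : Module.End ℂ E} (h : S * G = G * S) {ε : ℂ} {k : ℕ} {v : Ten ℂ E k}
    (hv : v ∈ chiral G ε k) : onAll k S v ∈ chiral G ε k := by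
  refine ⟨hv.1.onAll S, fun i => ?_⟩
  rw [← onAll_onIndex h, hv.2 i, map_smul]

theorem spaceV_act {G S : Module.End ℂ E} (h : S * G = G * S) {ε δ : ℂ} (a b : ℕ)
    {x : Ten₂ ℂ E a b} (hx : x ∈ spaceV G ε δ a b) : act a b S x ∈ spaceV G ε δ a b := by
  refine (Submodule.span_le (p := (spaceV G ε δ a b).comap (act a b S))).2 ?_ hx
  rintro _ ⟨u, hu, v, hv, rfl⟩
  exact Submodule.subset_span ⟨_, chiral_onAll h hu, _, chiral_onAll h hv, by simp [act]⟩

/-- The vector space underlying `spaceV`. -/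
def VSpace (G : Module.End ℂ E) (ε δ : ℂ) (a b : ℕ) : Type _ := spaceV G ε δ a b

instance (G : Module.End ℂ E) (ε δ : ℂ) (a b : ℕ) : AddCommGroup (VSpace G ε δ a b) :=
  inferInstanceAs (AddCommGroup (spaceV G ε δ a b))

instance (G : Module.End ℂ E) (ε δ : ℂ) (a b : ℕ) : Module ℂ (VSpace G ε δ a b) :=
  inferInstanceAs (Module ℂ (spaceV G ε δ a b))

/-- The inclusion of `spaceV` in the space of all tensors. -/
def VSpace.incl (G : Module.End ℂ E) (ε δ : ℂ) (a b : ℕ) : VSpace G ε δ a b →ₗ[ℂ] Ten₂ ℂ E a b :=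
  (spaceV G ε δ a b).subtype

/-- The representation on `spaceV` by which each group element acts on every index. -/
def VSpace.rep {Γ : Type*} [Monoid Γ] (G : Module.End ℂ E) (ε δ : ℂ) (a b : ℕ) (ρ : Γ →* Module.End ℂ E)
    (h : ∀ T, ρ T * G = G * ρ T) : Representation ℂ Γ (VSpace G ε δ a b) :=
  restrictRep ((act a b).comp ρ) (spaceV G ε δ a b) fun T _ hx => spaceV_act (h T) a b hx

end ComplexSpaces

/-! ### Majorana matrices, Majorana spinors and the Lorentz group -/

/-- The Minkowski metric. -/
def eta : Matrix (Fin 4) (Fin 4) ℝ := Matrix.diagonal ![1, -1, -1, -1]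

/-- The full Lorentz group `O(1,3)`. -/
def lorentzGroup : Subgroup (GL (Fin 4) ℝ) where
  carrier := {A | (A : Matrix (Fin 4) (Fin 4) ℝ)ᵀ * eta * (A : Matrix (Fin 4) (Fin 4) ℝ) = eta}
  one_mem' := by simp
  mul_mem' := by
    intro A B hA hB
    simp only [Set.mem_ofPred_eq, Units.val_mul, Matrix.transpose_mul] at hA hB ⊢
    calc _ = (B : Matrix (Fin 4) (Fin 4) ℝ)ᵀ *
          ((A : Matrix (Fin 4) (Fin 4) ℝ)ᵀ * eta * (A : Matrix (Fin 4) (Fin 4) ℝ)) *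
          (B : Matrix (Fin 4) (Fin 4) ℝ) := by simp only [Matrix.mul_assoc]
      _ = eta := by rw [hA, hB]
  inv_mem' := by
    intro A hA
    simp only [Set.mem_ofPred_eq] at hA ⊢
    have h1 : (A : Matrix (Fin 4) (Fin 4) ℝ) * ((A⁻¹ : GL (Fin 4) ℝ) : Matrix _ _ ℝ) = 1 := by
      rw [← Units.val_mul, mul_inv_cancel, Units.val_one]
    have h2 : ((A⁻¹ : GL (Fin 4) ℝ) : Matrix (Fin 4) (Fin 4) ℝ)ᵀ *
        (A : Matrix (Fin 4) (Fin 4) ℝ)ᵀ = 1 := by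
      rw [← Matrix.transpose_mul, h1, Matrix.transpose_one]
    conv_lhs => rw [← hA]
    calc _ = (((A⁻¹ : GL (Fin 4) ℝ) : Matrix (Fin 4) (Fin 4) ℝ)ᵀ *
          (A : Matrix (Fin 4) (Fin 4) ℝ)ᵀ) * eta *
          ((A : Matrix (Fin 4) (Fin 4) ℝ) * ((A⁻¹ : GL (Fin 4) ℝ) : Matrix _ _ ℝ)) := by
            simp only [Matrix.mul_assoc]
      _ = eta := by rw [h1, h2, Matrix.one_mul, Matrix.mul_one]

/-- Dirac spinors. -/
abbrev Dirac : Type := Fin 4 → ℂ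

/-- Pauli spinors. -/
abbrev Pauli : Type := Fin 2 → ℂ

/-- A choice of Majorana matrices `iγ^μ` (here `g μ`) and of a charge conjugation operator `Θ`. -/
structure MajoranaSystem where
  g : Fin 4 → Matrix (Fin 4) (Fin 4) ℂ
  unitary : ∀ μ, g μ ∈ Matrix.unitaryGroup (Fin 4) ℂ
  clifford : ∀ μ ν, g μ * g ν + g ν * g μ =
    (-2 * (eta μ ν : ℂ)) • (1 : Matrix (Fin 4) (Fin 4) ℂ)
  Θ : Dirac →ₛₗ[starRingEnd ℂ] Dirac
  invol : ∀ u, Θ (Θ u) = u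
  comm : ∀ μ u, Θ (g μ *ᵥ u) = g μ *ᵥ Θ u

namespace MajoranaSystem

variable (D : MajoranaSystem)

theorem Θ_smul_real (c : ℝ) (u : Dirac) : D.Θ (c • u) = c • D.Θ u := by
  have := D.Θ.map_smulₛₗ (c : ℂ) u
  simpa using this

/-- The Majorana spinors, as a real subspace of the Dirac spinors. -/
def pinor : Submodule ℝ Dirac where
  carrier := {u | D.Θ u = u}
  zero_mem' := map_zero _
  add_mem' := by
    intro u v hu hv
    simp only [Set.mem_ofPred_eq] at hu hv ⊢
    rw [map_add, hu, hv]
  smul_mem' := by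
    intro c u hu
    simp only [Set.mem_ofPred_eq] at hu ⊢
    rw [D.Θ_smul_real, hu]

/-- The real vector space of Majorana spinors. -/
def Pinor : Type := D.pinor

instance : AddCommGroup D.Pinor := inferInstanceAs (AddCommGroup D.pinor)

instance : Module ℝ D.Pinor := inferInstanceAs (Module ℝ D.pinor)

/-- The inclusion of the Majorana spinors in the Dirac spinors. -/
def incl : D.Pinor →ₗ[ℝ] Dirac := D.pinor.subtype

theorem incl_injective : Function.Injective D.incl := Subtype.val_injective

theorem Θ_incl (x : D.Pinor) : D.Θ (D.incl x) = D.incl x := x.2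

/-- The Majorana matrix `iγ^μ` as an endomorphism of Majorana spinors. -/
def maj (μ : Fin 4) : Module.End ℝ D.Pinor :=
  ((Matrix.toLin' (D.g μ)).restrictScalars ℝ).restrict (p := D.pinor) (q := D.pinor) (by
    intro u hu
    change D.Θ (D.g μ *ᵥ u) = D.g μ *ᵥ u
    rw [D.comm, show D.Θ u = u from hu])

theorem incl_maj (μ : Fin 4) (x : D.Pinor) : D.incl (D.maj μ x) = D.g μ *ᵥ D.incl x := rfl

/-- `iγ⁵ = -γ⁰γ¹γ²γ³ = -(iγ⁰)(iγ¹)(iγ²)(iγ³)` as an endomorphism of Majorana spinors. -/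
def maj5 : Module.End ℝ D.Pinor := -(D.maj 0 * D.maj 1 * D.maj 2 * D.maj 3)

/-- The Dirac matrix `γ⁵ = -i (iγ⁵)` as an endomorphism of Dirac spinors. -/
def gamma5 : Module.End ℂ Dirac :=
  (-Complex.I) • Matrix.toLin' (-(D.g 0 * D.g 1 * D.g 2 * D.g 3))

/-- The space `Maj` of the real linear combinations of the Majorana matrices. -/
def majSpan : Submodule ℝ (Module.End ℝ D.Pinor) := Submodule.span ℝ (Set.range D.maj)

/-- `Pin(3,1)`. -/
def pin : Set (Module.End ℝ D.Pinor)ˣ :=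
  {S | |LinearMap.det (S : Module.End ℝ D.Pinor)| = 1 ∧
    ∀ μ, (↑S⁻¹ : Module.End ℝ D.Pinor) * D.maj μ * (S : Module.End ℝ D.Pinor) ∈ D.majSpan}

/-- `Λ(S) = A`, that is, `S⁻¹ (iγ^μ) S = A^μ_ν iγ^ν`. -/
def IsLorentzImage (S : (Module.End ℝ D.Pinor)ˣ) (A : Matrix (Fin 4) (Fin 4) ℝ) : Prop :=
  ∀ μ, (↑S⁻¹ : Module.End ℝ D.Pinor) * D.maj μ * (S : Module.End ℝ D.Pinor) =
    ∑ ν, A μ ν • D.maj ν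

/-- The projection `u ↦ (u + Θ u) / 2` of the Dirac spinors onto the Majorana spinors. -/
def rePart : Dirac →ₗ[ℝ] D.Pinor where
  toFun u := (⟨(1 / 2 : ℝ) • (u + D.Θ u), by
    change D.Θ _ = _
    rw [D.Θ_smul_real, map_add, D.invol, add_comm]⟩ : D.pinor)
  map_add' u v := by
    apply D.incl_injective
    change (1 / 2 : ℝ) • (u + v + D.Θ (u + v)) =
      (1 / 2 : ℝ) • (u + D.Θ u) + (1 / 2 : ℝ) • (v + D.Θ v)
    rw [map_add, ← smul_add]
    congr 1; abel
  map_smul' c u := by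
    apply D.incl_injective
    change (1 / 2 : ℝ) • (c • u + D.Θ (c • u)) = c • ((1 / 2 : ℝ) • (u + D.Θ u))
    rw [D.Θ_smul_real, ← smul_add, smul_comm]

theorem incl_rePart (u : Dirac) : D.incl (D.rePart u) = (1 / 2 : ℝ) • (u + D.Θ u) := rfl

theorem rePart_incl (x : D.Pinor) : D.rePart (D.incl x) = x := by
  apply D.incl_injective
  rw [incl_rePart, Θ_incl, ← two_smul ℝ, smul_smul]
  norm_num

theorem rePart_I_incl (x : D.Pinor) : D.rePart (Complex.I • D.incl x) = 0 := by
  apply D.incl_injective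
  rw [incl_rePart, D.Θ.map_smulₛₗ, Θ_incl, map_zero]
  simp

theorem rePart_decomp (u : Dirac) :
    D.incl (D.rePart u) + Complex.I • D.incl (D.rePart (-(Complex.I • u))) = u := by
  rw [incl_rePart, incl_rePart, map_neg, D.Θ.map_smulₛₗ]
  funext i
  simp only [Pi.add_apply, Pi.smul_apply, Pi.neg_apply, smul_eq_mul, Complex.real_smul,
    Complex.conj_I]
  push_cast
  linear_combination (-(1 / 2 : ℂ) * u i + (1 / 2 : ℂ) * D.Θ u i) * Complex.I_sq

/-- The complex linear extension to the Dirac spinors of an endomorphism of Majorana spinors: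
`x + i y ↦ S x + i S y` for Majorana spinors `x`, `y`. -/
def ext (S : Module.End ℝ D.Pinor) : Module.End ℂ Dirac where
  toFun u := D.incl (S (D.rePart u)) + Complex.I • D.incl (S (D.rePart (-(Complex.I • u))))
  map_add' u v := by
    simp only [map_add, smul_add, neg_add]
    abel
  map_smul' c u := by
    have h1 : c • u = c.re • u + c.im • (Complex.I • u) := by
      funext i
      simp only [Pi.add_apply, Pi.smul_apply, smul_eq_mul, Complex.real_smul]
      conv_lhs => rw [← Complex.re_add_im c]
      ring
    have h2 : -(Complex.I • (c • u)) = c.im • u + c.re • (-(Complex.I • u)) := by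
      funext i
      simp only [Pi.add_apply, Pi.smul_apply, Pi.neg_apply, smul_eq_mul, Complex.real_smul]
      conv_lhs => rw [← Complex.re_add_im c]
      linear_combination (-(c.im : ℂ) * u i) * Complex.I_sq
    rw [h2, h1]
    simp only [map_add, map_smul, map_neg, RingHom.id_apply]
    funext i
    simp only [Pi.add_apply, Pi.smul_apply, Pi.neg_apply, smul_eq_mul, Complex.real_smul]
    conv_rhs => rw [← Complex.re_add_im c]
    linear_combination
      ((c.im : ℂ) * D.incl (S (D.rePart (Complex.I • u))) i) * Complex.I_sq

theorem ext_apply (S : Module.End ℝ D.Pinor) (u : Dirac) : D.ext S u =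
    D.incl (S (D.rePart u)) + Complex.I • D.incl (S (D.rePart (-(Complex.I • u)))) := rfl

theorem ext_incl (S : Module.End ℝ D.Pinor) (x : D.Pinor) :
    D.ext S (D.incl x) = D.incl (S x) := by
  rw [ext_apply, map_neg, rePart_I_incl, rePart_incl]
  simp

theorem ext_eq {A : Module.End ℂ Dirac} (S : Module.End ℝ D.Pinor)
    (h : ∀ x : D.Pinor, A (D.incl x) = D.incl (S x)) : D.ext S = A := by
  refine LinearMap.ext fun u => ?_
  conv_rhs => rw [← D.rePart_decomp u, map_add, map_smul, h, h]
  rfl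

/-- `D.ext` as a homomorphism of monoids. -/
def extHom : Module.End ℝ D.Pinor →* Module.End ℂ Dirac where
  toFun := D.ext
  map_one' := D.ext_eq _ fun _ => rfl
  map_mul' S T := D.ext_eq _ fun x => by
    rw [Module.End.mul_apply, ext_incl, ext_incl]; rfl

theorem gamma5_eq : D.gamma5 = (-Complex.I) • D.ext D.maj5 := by
  rw [gamma5]
  congr 1
  refine (D.ext_eq _ fun x => ?_).symm
  simp [maj5, incl_maj]

/-- An isomorphism `Σ` from the Pauli spinors to the Majorana spinors such that
`Σ (i p) = iγ⁵ Σ p` and `Σ (σ³ p) = γ⁰γ³ Σ p`, where `γ⁰γ³ = -(iγ⁰)(iγ³)`. With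
`M₊ = Σ (1, 0)` and `M₋ = Σ (0, 1)`, this amounts to a basis `{M₊, M₋, iγ⁵M₊, iγ⁵M₋}` of the
Majorana spinors with `γ⁰γ³ M₊ = M₊` and `γ⁰γ³ M₋ = -M₋`. -/
structure PauliIso where
  toEquiv : Pauli ≃ₗ[ℝ] D.Pinor
  map_I : ∀ p, toEquiv (Complex.I • p) = D.maj5 (toEquiv p)
  map_sigma3 : ∀ p, toEquiv (!![1, 0; 0, -1] *ᵥ p) = -(D.maj 0 (D.maj 3 (toEquiv p)))

namespace PauliIso

variable {D} (s : D.PauliIso)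

/-- `T ↦ Σ ∘ T ∘ Σ⁻¹`, from `SL(2,ℂ)` onto `Spin⁺(3,1)`. -/
def spin : SL(2, ℂ) →* Module.End ℝ D.Pinor where
  toFun T := s.toEquiv.toLinearMap ∘ₗ
    (Matrix.toLin' (T : Matrix (Fin 2) (Fin 2) ℂ)).restrictScalars ℝ ∘ₗ
      s.toEquiv.symm.toLinearMap
  map_one' := by ext1 x; simp
  map_mul' T U := by ext1 x; simp

theorem spin_comm (T : SL(2, ℂ)) : s.spin T * D.maj5 = D.maj5 * s.spin T := by
  ext1 x
  obtain ⟨p, rfl⟩ := s.toEquiv.surjective x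
  have key : ∀ q, s.spin T (s.toEquiv q) =
      s.toEquiv ((T : Matrix (Fin 2) (Fin 2) ℂ) *ᵥ q) := fun q => by
    simp [spin]
  rw [Module.End.mul_apply, Module.End.mul_apply, ← s.map_I, key, key, ← s.map_I,
    Matrix.mulVec_smul]

theorem extSpin_comm (T : SL(2, ℂ)) :
    D.extHom (s.spin T) * D.gamma5 = D.gamma5 * D.extHom (s.spin T) := by
  have h : D.extHom (s.spin T) * D.extHom D.maj5 = D.extHom D.maj5 * D.extHom (s.spin T) := by
    rw [← map_mul, spin_comm, map_mul]
  rw [gamma5_eq, mul_smul_comm, smul_mul_assoc]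
  exact congrArg _ h

/-- The real representation of `SL(2,ℂ)` on `W_(m,n)`, with `a = 2m` and `b = 2n`: the matrix of
`Spin⁺(3,1)` is applied to each index. -/
def repW (a b : ℕ) : Representation ℝ SL(2, ℂ) (WSpace D.maj5 a b) :=
  WSpace.rep D.maj5 a b s.spin s.spin_comm

/-- The complex representation of `SL(2,ℂ)` on `V_(m,n) = V_m⁺ ⊗ V_n⁻`, with `a = 2m` and
`b = 2n`: the matrix of `Spin⁺(3,1)` is applied to each index. -/
def repV (a b : ℕ) : Representation ℂ SL(2, ℂ) (VSpace D.gamma5 1 (-1) a b) :=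
  VSpace.rep D.gamma5 1 (-1) a b (D.extHom.comp s.spin) s.extSpin_comm

end PauliIso

end MajoranaSystem

/-- Continuity of a finite-dimensional real representation of `SL(2,ℂ)`: all its matrix
coefficients are continuous. -/
def IsContinuousRep {V : Type*} [AddCommGroup V] [Module ℝ V]
    (ρ : Representation ℝ SL(2, ℂ) V) : Prop :=
  ∀ (v : V) (φ : Module.Dual ℝ V), Continuous fun T : SL(2, ℂ) => φ (ρ T v)

end MajoranaRep

end

noncomputable section

namespace MajoranaRep

open Filter Topology Polynomial ComplexConjugate

/-! ### Elements of `SL(2,ℂ)` -/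

/-! The classification is a highest weight theory carried out on the group itself, with functionals
in place of vectors. In a continuous representation an upper unipotent matrix is conjugate to
matrices arbitrarily close to the identity, hence acts unipotently, and its matrix coefficients are
polynomials in `z` and `conj z`. Diagonal matrices are products of unipotent ones, so their
coefficients are Laurent polynomials in `w` and `conj w`, and Dedekind's independence of characters
leaves only characters `w ^ a * conj w ^ b`. This yields a complex functional `ξ`, invariant under
lower unipotent matrices, on which the torus acts by such a character
(`IsContinuousRep.exists_isHighest`). By the lower-diagonal-upper decomposition, `g ↦ ξ (ρ g v)` is
then a bihomogeneous polynomial of bidegree `(a, b)` in the first row of `g` and its conjugate.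

If `ξ` separates vectors (`IsModel`), the representation is identified with the space of these
polynomials, or of their real parts when `a = b`. A nonzero subrepresentation already fills this
space, which gives irreducibility and uniqueness for given `(a, b)`. Conjugating `ξ` exchanges `a`
and `b`, hence the condition `b ≤ a`; the numbers `Re (t ^ a * conj t ^ b)` then tell the pairs
apart. On `W_(m,n)` the functional is the product of the first Pauli coordinates over the first
group of indexes and of their conjugates over the second (`isModel_repW`). It separates because the
conditions on `iγ⁵` leave only coordinates that are linear on one group and antilinear on the other,
and because the two kinds are conjugate to each other.

For the Lorentz group, the Majorana spinors are irreducible under the `iγ^μ`, with commutant `ℝ`.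
Two Clifford families therefore have an invertible intertwiner, unique up to a real factor: `Λ` is
onto and its fibres are pairs `±S`. Conjugation by an element of `Pin(3,1)` sends `iγ⁵` to `±iγ⁵`,
and since `iγ⁵` enters `W_(m,n)` only in pairs, the sign is invisible there.

In `V_(m,n)` the sign of `γ⁵` itself is prescribed, and parity, which anticommutes with `γ⁵`,
reverses it. An operator implementing parity inside `V_(m,n)` would exchange the two components of
the torus weights, up to signs and a common shift. The extreme weights `±(a, b)` do not allow this
when `a ≠ b`. -/

/-- Upper triangular unipotent matrices. -/
def upper (z : ℂ) : SL(2, ℂ) := ⟨!![1, z; 0, 1], by simp⟩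

/-- Lower triangular unipotent matrices. -/
def lower (z : ℂ) : SL(2, ℂ) := ⟨!![1, 0; z, 1], by simp⟩

/-- Diagonal matrices. -/
def torus (w : ℂˣ) : SL(2, ℂ) := ⟨!![(w : ℂ), 0; 0, ((w⁻¹ : ℂˣ) : ℂ)], by simp⟩

/-- The Weyl element. -/
def weyl : SL(2, ℂ) := ⟨!![0, 1; -1, 0], by simp⟩

theorem upper_val (z : ℂ) : (upper z).1 = !![1, z; 0, 1] := rfl

theorem lower_val (z : ℂ) : (lower z).1 = !![1, 0; z, 1] := rfl

theorem torus_val (w : ℂˣ) : (torus w).1 = !![(w : ℂ), 0; 0, (w : ℂ)⁻¹] := by simp [torus]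

theorem weyl_val : weyl.1 = !![0, 1; -1, 0] := rfl

theorem upper_add (z z' : ℂ) : upper (z + z') = upper z * upper z' := by
  apply Subtype.ext
  simp [upper_val, add_comm]

theorem upper_zero : upper 0 = 1 := by
  apply Subtype.ext
  simp [Matrix.one_fin_two, upper_val]

theorem lower_zero : lower 0 = 1 := by
  apply Subtype.ext
  simp [Matrix.one_fin_two, lower_val]

theorem torus_mul (w w' : ℂˣ) : torus (w * w') = torus w * torus w' := by
  apply Subtype.ext
  simp [torus_val, mul_comm]

theorem torus_one : torus 1 = 1 := by
  apply Subtype.ext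
  simp [Matrix.one_fin_two, torus_val]

theorem torus_mul_upper (w : ℂˣ) (z : ℂ) :
    torus w * upper z = upper (w ^ 2 * z) * torus w := by
  apply Subtype.ext
  simp [torus_val, upper_val]
  field_simp

theorem torus_mul_lower (w : ℂˣ) (z : ℂ) :
    torus w * lower (w ^ 2 * z) = lower z * torus w := by
  apply Subtype.ext
  simp [torus_val, lower_val]
  field_simp

theorem weyl_mul_upper (z : ℂ) : weyl * upper (-z) = lower z * weyl := by
  apply Subtype.ext
  simp [weyl_val, upper_val, lower_val]

/-- This change of chart replaces `w` by `w⁻¹`. Comparing polynomials in the two charts is what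
bounds their degrees by the weight. -/
theorem weyl_mul_lower (w : ℂˣ) :
    weyl * lower w = lower (-(w⁻¹ : ℂˣ)) * torus w * upper ((w⁻¹ : ℂˣ) : ℂ) := by
  apply Subtype.ext
  simp [weyl_val, upper_val, lower_val, torus_val]

/-- The first three factors multiply to the antidiagonal matrix with entries `w`, `-w⁻¹`, and the
last bracket is the inverse Weyl element. Knowledge about unipotent elements thereby transfers to
the torus. -/
theorem torus_eq (w : ℂˣ) :
    torus w = upper w * (lower (-(w⁻¹ : ℂˣ)) * (upper w * (upper (-1) * lower 1 * upper (-1)))) := by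
  apply Subtype.ext
  simp [upper_val, lower_val, torus_val]

/-- Elements with nonzero upper left entry have a lower-diagonal-upper decomposition. -/
theorem eq_lower_torus_upper (g : SL(2, ℂ)) (w : ℂˣ) (h : g.1 0 0 = w) :
    g = lower (g.1 1 0 * (w⁻¹ : ℂˣ)) * torus w * upper (g.1 0 1 * (w⁻¹ : ℂˣ)) := by
  have hd := g.2
  rw [Matrix.det_fin_two, h] at hd
  have hw : (w : ℂ) * (w : ℂ)⁻¹ = 1 := mul_inv_cancel₀ w.ne_zero
  apply Subtype.ext
  ext i j
  fin_cases i <;> fin_cases j <;> simp [upper_val, lower_val, torus_val, h]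
  · linear_combination -g.1 0 1 * hw
  · linear_combination (w : ℂ)⁻¹ * hd - g.1 1 1 * hw

theorem continuous_SL_of_entries {X : Type*} [TopologicalSpace X] {f : X → SL(2, ℂ)}
    (h : ∀ i j, Continuous fun x => (f x).1 i j) : Continuous f :=
  continuous_induced_rng.2 (continuous_matrix h)

theorem continuous_upper : Continuous upper := by
  refine continuous_SL_of_entries fun i j => ?_
  fin_cases i <;> fin_cases j <;> simp [upper] <;> fun_prop

theorem continuous_lower : Continuous lower := by
  refine continuous_SL_of_entries fun i j => ?_
  fin_cases i <;> fin_cases j <;> simp [lower] <;> fun_prop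

/-! ### Polynomial functions of `z` and `conj z` -/

/-- The functions on `ℂ` that are polynomials in `z` and `conj z`. -/
def IsPoly (f : ℂ → ℂ) : Prop :=
  ∃ p : MvPolynomial (Fin 2) ℂ, ∀ z, f z = MvPolynomial.eval ![z, conj z] p

namespace IsPoly

theorem const (c : ℂ) : IsPoly fun _ => c := ⟨MvPolynomial.C c, by simp⟩

theorem add {f g : ℂ → ℂ} : IsPoly f → IsPoly g → IsPoly fun z => f z + g z := by
  rintro ⟨p, hp⟩ ⟨q, hq⟩
  exact ⟨p + q, by simp [hp, hq]⟩

theorem mul {f g : ℂ → ℂ} : IsPoly f → IsPoly g → IsPoly fun z => f z * g z := by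
  rintro ⟨p, hp⟩ ⟨q, hq⟩
  exact ⟨p * q, by simp [hp, hq]⟩

theorem pow {f : ℂ → ℂ} (hf : IsPoly f) (n : ℕ) : IsPoly fun z => f z ^ n := by
  obtain ⟨p, hp⟩ := hf
  exact ⟨p ^ n, by simp [hp]⟩

theorem sum {ι : Type*} (s : Finset ι) {f : ι → ℂ → ℂ} (h : ∀ i ∈ s, IsPoly (f i)) :
    IsPoly fun z => ∑ i ∈ s, f i z := by
  classical
  induction s using Finset.induction_on with
  | empty => simpa using const 0
  | insert i s hi ih =>
    simp only [Finset.sum_insert hi]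
    exact (h i (Finset.mem_insert_self _ _)).add
      (ih fun j hj => h j (Finset.mem_insert_of_mem hj))

theorem re : IsPoly fun z => (z.re : ℂ) :=
  ⟨MvPolynomial.C (1 / 2) * (MvPolynomial.X 0 + MvPolynomial.X 1), fun z => by
    apply Complex.ext <;> simp; ring⟩

theorem im : IsPoly fun z => (z.im : ℂ) :=
  ⟨MvPolynomial.C (-Complex.I / 2) * (MvPolynomial.X 0 - MvPolynomial.X 1), fun z => by
    apply Complex.ext <;> simp; ring⟩

theorem eval {f : ℂ → ℂ} (hf : IsPoly f) (p : ℂ[X]) : IsPoly fun z => p.eval (f z) := by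
  simp only [Polynomial.eval_eq_sum_range]
  exact sum _ fun i _ => (const _).mul (hf.pow i)

theorem comp_neg {f : ℂ → ℂ} (hf : IsPoly f) : IsPoly fun z => f (-z) := by
  obtain ⟨p, hp⟩ := hf
  refine ⟨MvPolynomial.bind₁ (fun i => -MvPolynomial.X i) p, fun z => ?_⟩
  simp only [hp]
  rw [MvPolynomial.eval, MvPolynomial.eval, MvPolynomial.eval₂Hom_bind₁]
  congr 2
  funext i
  fin_cases i <;> simp

theorem exists_finsupp {f : ℂ → ℂ} (hf : IsPoly f) :
    ∃ c : ℕ × ℕ →₀ ℂ, ∀ z, f z = c.sum fun p x => x * (z ^ p.1 * conj z ^ p.2) := by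
  obtain ⟨p, hp⟩ := hf
  have : ∀ p : MvPolynomial (Fin 2) ℂ, ∃ c : ℕ × ℕ →₀ ℂ, ∀ z,
      MvPolynomial.eval ![z, conj z] p = c.sum fun p x => x * (z ^ p.1 * conj z ^ p.2) := by
    intro p
    induction p using MvPolynomial.induction_on' with
    | monomial m a =>
      refine ⟨Finsupp.single (m 0, m 1) a, fun z => ?_⟩
      rw [Finsupp.sum_single_index (by simp), MvPolynomial.eval_monomial,
        Finsupp.prod_fintype _ _ (by simp)]
      simp
    | add p q hp hq =>
      obtain ⟨c, hc⟩ := hp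
      obtain ⟨d, hd⟩ := hq
      refine ⟨c + d, fun z => ?_⟩
      rw [map_add, hc, hd, Finsupp.sum_add_index' (by simp) (by intros; ring)]
  obtain ⟨c, hc⟩ := this p
  exact ⟨c, fun z => (hp z).trans (hc z)⟩

end IsPoly

/-! ### Characters of `ℂˣ` -/

/-- The character `w ↦ w ^ i * conj w ^ j`. -/
def zmon (p : ℤ × ℤ) : ℂˣ →* ℂ where
  toFun w := (w : ℂ) ^ p.1 * conj (w : ℂ) ^ p.2
  map_one' := by simp
  map_mul' v w := by simp [mul_zpow]; ring

theorem zmon_apply (p : ℤ × ℤ) (w : ℂˣ) : zmon p w = (w : ℂ) ^ p.1 * conj (w : ℂ) ^ p.2 := rfl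

theorem zmon_natCast (a b : ℕ) (w : ℂˣ) :
    zmon ((a : ℤ), (b : ℤ)) w = (w : ℂ) ^ a * conj (w : ℂ) ^ b := by
  simp [zmon_apply]

/-- A point of `ℂˣ` at which different characters take different values. -/
def generic : ℂˣ := Units.mk0 (2 * Complex.exp Complex.I) (by simp [Complex.exp_ne_zero])

/-- The modulus of the value at `2 * exp I` is a power of `2` that gives the sum of the exponents.
The phase gives their difference modulo `2π`, hence exactly, since `π` is irrational. -/
theorem zmon_generic_injective : Function.Injective fun p : ℤ × ℤ => zmon p generic := by
  have hz : ∀ p : ℤ × ℤ, zmon p generic =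
      (2 : ℂ) ^ (p.1 + p.2) * Complex.exp (((p.1 - p.2 : ℤ) : ℂ) * Complex.I) := by
    intro p
    have h1 : conj (2 * Complex.exp Complex.I) = 2 * (Complex.exp Complex.I)⁻¹ := by
      rw [map_mul, ← Complex.exp_conj, Complex.conj_I, Complex.exp_neg, Complex.conj_ofNat]
    rw [zmon_apply, generic, Units.val_mk0, h1, mul_zpow, mul_zpow, inv_zpow,
      zpow_add₀ two_ne_zero, Int.cast_sub, sub_mul, Complex.exp_sub, Complex.exp_int_mul,
      Complex.exp_int_mul]
    ring
  intro p q hpq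
  simp only [hz] at hpq
  have h1 : (2 : ℝ) ^ (p.1 + p.2) = 2 ^ (q.1 + q.2) := by
    have := congrArg norm hpq
    simpa [Complex.norm_exp] using this
  have h2 : p.1 + p.2 = q.1 + q.2 := zpow_right_injective₀ (by norm_num) (by norm_num) h1
  rw [h2] at hpq
  have h3 := mul_left_cancel₀ (zpow_ne_zero _ two_ne_zero) hpq
  obtain ⟨n, hn⟩ := Complex.exp_eq_exp_iff_exists_int.1 h3
  have h4 : ((p.1 - p.2 : ℤ) : ℝ) - ((q.1 - q.2 : ℤ) : ℝ) = n * (2 * Real.pi) := by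
    have := congrArg Complex.im hn
    simp at this
    push_cast
    linarith
  have h5 : n = 0 := by
    by_contra hn0
    refine (irrational_pi.intCast_mul (m := 2 * n) (by simpa using hn0)).ne_int
      ((p.1 - p.2) - (q.1 - q.2)) ?_
    push_cast at h4 ⊢
    linarith
  rw [h5] at h4
  have h6 : p.1 - p.2 = q.1 - q.2 := by
    have : ((p.1 - p.2 : ℤ) : ℝ) = ((q.1 - q.2 : ℤ) : ℝ) := by simpa [sub_eq_zero] using h4
    exact_mod_cast this
  ext <;> omega

/-- Dedekind's independence of characters applies, because the values at `generic` show these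
characters to be distinct. -/
theorem linearIndependent_zmon :
    LinearIndependent ℂ (fun p : ℤ × ℤ => (zmon p : ℂˣ → ℂ)) :=
  (linearIndependent_monoidHom ℂˣ ℂ).comp zmon fun _ _ h =>
    zmon_generic_injective (congrArg (fun f : ℂˣ →* ℂ => f generic) h)

/-- Polynomials in `z` and `conj z` have unique coefficients. -/
theorem finsupp_eq_zero_of_sum_eq_zero {c : ℕ × ℕ →₀ ℂ}
    (h : ∀ w : ℂˣ, (c.sum fun p x => x * ((w : ℂ) ^ p.1 * conj (w : ℂ) ^ p.2)) = 0) : c = 0 := by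
  have hinj : Function.Injective fun p : ℕ × ℕ => ((p.1 : ℤ), (p.2 : ℤ)) := by
    rintro ⟨_, _⟩ ⟨_, _⟩ h; simpa using h
  have hli := linearIndependent_zmon.comp _ hinj
  refine linearIndependent_iff.1 hli c (funext fun w => ?_)
  rw [Finsupp.linearCombination_apply, Finsupp.sum, Finset.sum_apply]
  simpa [Finsupp.sum, zmon_natCast] using h w

/-! ### Unipotent elements in a continuous representation -/

section Unipotent

variable {V : Type*} [AddCommGroup V] [Module ℝ V] {ρ : Representation ℝ SL(2, ℂ) V}

/-- The powers of a unipotent operator have polynomial matrix coefficients. -/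
theorem exists_polynomial_unipotent_pow {N : Module.End ℝ V} (hN : IsNilpotent N) (v : V)
    (φ : Module.Dual ℝ V) : ∃ p : ℝ[X], ∀ n : ℕ, φ (((N + 1) ^ n) v) = p.eval (n : ℝ) := by
  obtain ⟨d, hd⟩ := hN
  refine ⟨∑ j ∈ Finset.range d, C (φ ((N ^ j) v) / (j.factorial : ℝ)) * descPochhammer ℝ j,
    fun n => ?_⟩
  have key : (N + 1) ^ n = ∑ j ∈ Finset.range d, (n.choose j : ℝ) • N ^ j := by
    rw [(Commute.one_right N).add_pow]
    have h1 : ∀ j, N ^ j * 1 ^ (n - j) * (n.choose j : Module.End ℝ V) =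
        (n.choose j : ℝ) • N ^ j := fun j => by
      rw [one_pow, mul_one, Algebra.smul_def, map_natCast, Nat.cast_comm]
    simp only [h1]
    -- The sums up to `n` and up to `d - 1` agree after extending both to a common range: the extra
    -- terms vanish by the binomial coefficient in one case and by nilpotency in the other.
    have h2 : ∑ j ∈ Finset.range (n + 1), (n.choose j : ℝ) • N ^ j =
        ∑ j ∈ Finset.range (max (n + 1) d), (n.choose j : ℝ) • N ^ j := by
      refine Finset.sum_subset (Finset.range_mono (le_max_left _ _)) fun j _ hj => ?_
      rw [Nat.choose_eq_zero_of_lt (by simpa using hj)]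
      simp
    have h3 : ∑ j ∈ Finset.range d, (n.choose j : ℝ) • N ^ j =
        ∑ j ∈ Finset.range (max (n + 1) d), (n.choose j : ℝ) • N ^ j := by
      refine Finset.sum_subset (Finset.range_mono (le_max_right _ _)) fun j _ hj => ?_
      rw [pow_eq_zero_of_le (by simpa using hj) hd, smul_zero]
    rw [h2, h3]
  rw [key, eval_finsetSum, LinearMap.sum_apply, map_sum]
  refine Finset.sum_congr rfl fun j _ => ?_
  rw [eval_mul, eval_C, descPochhammer_eval_eq_descFactorial, Nat.descFactorial_eq_factorial_mul_choose,
    LinearMap.smul_apply, map_smul, smul_eq_mul]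
  push_cast
  field_simp

theorem eq_re_add_im (ξ : V →ₗ[ℝ] ℂ) (v : V) :
    ξ v = ((Complex.reLm ∘ₗ ξ) v : ℂ) + ((Complex.imLm ∘ₗ ξ) v : ℂ) * Complex.I :=
  (Complex.re_add_im _).symm

theorem IsContinuousRep.continuous_complex (hρ : IsContinuousRep ρ) (v : V) (ξ : V →ₗ[ℝ] ℂ) :
    Continuous fun g => ξ (ρ g v) := by
  simp only [eq_re_add_im ξ]
  exact (Complex.continuous_ofReal.comp (hρ v _)).add
    ((Complex.continuous_ofReal.comp (hρ v _)).mul continuous_const)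

theorem exists_pow_apply_ne_zero {N : Module.End ℝ V} (hN : IsNilpotent N) {v : V} (hv : v ≠ 0) :
    ∃ k, (N ^ k) v ≠ 0 ∧ N ((N ^ k) v) = 0 := by
  classical
  obtain ⟨d, hd⟩ := hN
  have hex : ∃ k, (N ^ k) v = 0 := ⟨d, by rw [hd]; rfl⟩
  have hpos : Nat.find hex ≠ 0 := fun h => hv (by simpa [h] using Nat.find_spec hex)
  obtain ⟨k, hk⟩ := Nat.exists_eq_succ_of_ne_zero hpos
  refine ⟨k, Nat.find_min hex (by omega), ?_⟩
  have := Nat.find_spec hex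
  rwa [hk, Nat.succ_eq_add_one, pow_succ', Module.End.mul_apply] at this

variable [FiniteDimensional ℝ V]

theorem IsContinuousRep.continuous_eval_charpoly (hρ : IsContinuousRep ρ) (x : ℝ) :
    Continuous fun g => (ρ g).charpoly.eval x := by
  have h : (fun g => (ρ g).charpoly.eval x) = fun g =>
      (Matrix.scalar _ x - LinearMap.toMatrix (Module.finBasis ℝ V) (Module.finBasis ℝ V)
        (ρ g)).det := by
    funext g
    rw [← LinearMap.charpoly_toMatrix (ρ g) (Module.finBasis ℝ V), Matrix.eval_charpoly]
  rw [h]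
  refine Continuous.matrix_det (continuous_const.sub (continuous_matrix fun i j => ?_))
  simp only [LinearMap.toMatrix_apply]
  exact hρ _ ((Module.finBasis ℝ V).coord i)

theorem charpoly_conj (g h : SL(2, ℂ)) : (ρ (g * h * g⁻¹)).charpoly = (ρ h).charpoly := by
  let b := Module.finBasis ℝ V
  rw [← LinearMap.charpoly_toMatrix _ b, ← LinearMap.charpoly_toMatrix (ρ h) b, mul_assoc, map_mul,
    LinearMap.toMatrix_mul, Matrix.charpoly_mul_comm, ← LinearMap.toMatrix_mul, ← map_mul]
  simp

/-- Conjugation by `diag(t, t⁻¹)` turns `upper z` into `upper (t² z)`, so the characteristic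
polynomial is the same for all real `t ≠ 0`. By continuity it equals its value at `t = 0`, that of
the identity. -/
theorem IsContinuousRep.charpoly_upper (hρ : IsContinuousRep ρ) (z : ℂ) :
    (ρ (upper z)).charpoly = (X - 1) ^ Module.finrank ℝ V := by
  refine Polynomial.funext fun x => ?_
  have h1 : Continuous fun t : ℝ => (ρ (upper ((t : ℂ) ^ 2 * z))).charpoly.eval x :=
    (hρ.continuous_eval_charpoly x).comp (continuous_upper.comp (by fun_prop))
  have h2 := h1.ext_on (dense_compl_singleton (0 : ℝ))
    (continuous_const (y := (ρ (upper z)).charpoly.eval x)) fun t ht => by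
      have ht' : (t : ℂ) ≠ 0 := by simpa using ht
      have := torus_mul_upper (Units.mk0 _ ht') z
      rw [Units.val_mk0] at this
      change (ρ (upper ((t : ℂ) ^ 2 * z))).charpoly.eval x = _
      rw [← charpoly_conj (torus (Units.mk0 _ ht')) (upper z), this, mul_inv_cancel_right]
  have h3 := congrFun h2 0
  simp only [Complex.ofReal_zero, ne_eq, OfNat.ofNat_ne_zero, not_false_eq_true, zero_pow,
    zero_mul, upper_zero, map_one] at h3
  rw [← h3, LinearMap.charpoly_one]

theorem IsContinuousRep.isNilpotent_upper (hρ : IsContinuousRep ρ) (z : ℂ) :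
    IsNilpotent (ρ (upper z) - 1) := by
  refine ⟨Module.finrank ℝ V, ?_⟩
  have := LinearMap.aeval_self_charpoly (ρ (upper z))
  rwa [hρ.charpoly_upper, map_pow, map_sub, aeval_X, map_one] at this

theorem upper_nsmul (n : ℕ) (z : ℂ) : upper (n * z) = upper z ^ n := by
  induction n with
  | zero => simp [upper_zero]
  | succ n ih => rw [pow_succ, ← ih, ← upper_add]; congr 1; push_cast; ring

theorem polynomial_eq_of_eval_natCast {p q : ℝ[X]} (h : ∀ n : ℕ, p.eval (n : ℝ) = q.eval (n : ℝ)) :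
    p = q := by
  refine Polynomial.eq_of_infinite_eval_eq p q
    ((Set.infinite_range_of_injective (Nat.cast_injective (R := ℝ))).mono ?_)
  rintro _ ⟨n, rfl⟩
  exact h n

theorem IsContinuousRep.exists_polynomial_natCast (hρ : IsContinuousRep ρ) (z : ℂ) (v : V)
    (φ : Module.Dual ℝ V) :
    ∃ p : ℝ[X], ∀ n : ℕ, φ (ρ (upper (n * z)) v) = p.eval (n : ℝ) := by
  obtain ⟨p, hp⟩ := exists_polynomial_unipotent_pow (hρ.isNilpotent_upper z) v φ
  refine ⟨p, fun n => ?_⟩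
  rw [← hp, sub_add_cancel, upper_nsmul, map_pow]

/-- Matrix coefficients of a one-parameter unipotent group are polynomials. -/
theorem IsContinuousRep.exists_polynomial (hρ : IsContinuousRep ρ) (z : ℂ) (v : V)
    (φ : Module.Dual ℝ V) :
    ∃ p : ℝ[X], ∀ t : ℝ, φ (ρ (upper (t * z)) v) = p.eval t := by
  obtain ⟨p, hp⟩ := hρ.exists_polynomial_natCast z v φ
  have hrat : ∀ q : ℚ, φ (ρ (upper (((q : ℝ) : ℂ) * z)) v) = p.eval (q : ℝ) := by
    intro q
    have hm : (q.den : ℝ) ≠ 0 := by exact_mod_cast q.den_ne_zero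
    have hm' : (q.den : ℂ) ≠ 0 := by exact_mod_cast q.den_ne_zero
    have hq : (q : ℝ) * q.den = q.num := by exact_mod_cast Rat.mul_den_eq_num q
    -- A finer step `z / q.den`, started from the vector moved back by `|q.num| z`, meets every
    -- natural multiple of `z` and also `q z` at natural times. The polynomial `r` thus determines
    -- `p` and gives the value at `q`.
    obtain ⟨r, hr⟩ := hρ.exists_polynomial_natCast (z / q.den)
      (ρ (upper (-(q.num.natAbs * z))) v) φ
    have hr' : ∀ (t : ℝ) (n : ℕ), (n : ℝ) = q.den * (t + q.num.natAbs) →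
        φ (ρ (upper ((t : ℂ) * z)) v) = r.eval (q.den * (t + q.num.natAbs)) := by
      intro t n hn
      have hn' : (n : ℂ) = q.den * (t + q.num.natAbs) := by exact_mod_cast hn
      rw [← hn, ← hr, ← Module.End.mul_apply, ← map_mul, ← upper_add, hn']
      congr 4
      field_simp
      ring
    have hpr : p = r.comp (C (q.den : ℝ) * (X + C (q.num.natAbs : ℝ))) := by
      refine polynomial_eq_of_eval_natCast fun n => ?_
      rw [← hp]
      have := hr' n (q.den * (n + q.num.natAbs)) (by push_cast; ring)
      simpa using this
    have hle : 0 ≤ q.num + q.den * q.num.natAbs := by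
      have h1 : (1 : ℤ) ≤ q.den := by exact_mod_cast q.den_pos
      have h2 : -q.num ≤ |q.num| := neg_le_abs _
      rw [Int.natCast_natAbs]
      nlinarith [abs_nonneg q.num]
    obtain ⟨n, hn⟩ := Int.eq_ofNat_of_zero_le hle
    rw [hr' q n, hpr]
    · simp
    · have : ((q.num + q.den * q.num.natAbs : ℤ) : ℝ) = n := by rw [hn]; simp
      push_cast at this ⊢
      rw [mul_add, mul_comm _ (q : ℝ), hq, ← this, Nat.cast_natAbs, Int.cast_abs]
  refine ⟨p, fun t => ?_⟩
  have h1 : Continuous fun t : ℝ => φ (ρ (upper (t * z)) v) :=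
    (hρ v φ).comp (continuous_upper.comp (by fun_prop))
  refine congrFun (h1.ext_on (Rat.denseRange_cast (𝕜 := ℝ)) p.continuous ?_) t
  rintro _ ⟨q, rfl⟩
  exact hrat q

theorem ofReal_eval (p : ℝ[X]) (x : ℝ) :
    ((p.eval x : ℝ) : ℂ) = (p.map (algebraMap ℝ ℂ)).eval (x : ℂ) := by
  rw [Polynomial.eval_map_algebraMap]
  exact (Polynomial.aeval_algebraMap_apply_eq_algebraMap_eval (A := ℂ) x p).symm

/-- The real and imaginary directions are two one-parameter groups. Inserting a basis between their
factors gives a finite sum of products of a polynomial in `z.re` and one in `z.im`. -/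
theorem IsContinuousRep.isPoly_upper_dual (hρ : IsContinuousRep ρ) (v : V)
    (φ : Module.Dual ℝ V) : IsPoly fun z => (φ (ρ (upper z) v) : ℂ) := by
  let b := Module.finBasis ℝ V
  have h : ∀ z : ℂ, (φ (ρ (upper z) v) : ℂ) = ∑ k,
      (φ (ρ (upper (z.re * 1)) (b k)) : ℂ) *
        (b.coord k (ρ (upper (z.im * Complex.I)) v) : ℂ) := by
    intro z
    conv_lhs => rw [← Complex.re_add_im z, upper_add, map_mul, Module.End.mul_apply,
      ← b.sum_repr (ρ (upper (z.im * Complex.I)) v)]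
    rw [map_sum, map_sum]
    push_cast
    refine Finset.sum_congr rfl fun k _ => ?_
    rw [map_smul, map_smul, smul_eq_mul, mul_one, mul_comm]
    push_cast
    rfl
  simp only [h]
  refine IsPoly.sum _ fun k _ => IsPoly.mul ?_ ?_
  · obtain ⟨p, hp⟩ := hρ.exists_polynomial 1 (b k) φ
    simp only [hp, ofReal_eval]
    exact IsPoly.re.eval _
  · obtain ⟨p, hp⟩ := hρ.exists_polynomial Complex.I v (b.coord k)
    simp only [hp, ofReal_eval]
    exact IsPoly.im.eval _

theorem IsContinuousRep.isPoly_upper (hρ : IsContinuousRep ρ) (v : V) (ξ : V →ₗ[ℝ] ℂ) :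
    IsPoly fun z => ξ (ρ (upper z) v) := by
  simp only [eq_re_add_im ξ]
  exact (hρ.isPoly_upper_dual v _).add ((hρ.isPoly_upper_dual v _).mul (IsPoly.const _))

theorem lower_eq (z : ℂ) : lower z = weyl * upper (-z) * weyl⁻¹ := by
  rw [weyl_mul_upper, mul_inv_cancel_right]

theorem IsContinuousRep.isPoly_lower (hρ : IsContinuousRep ρ) (v : V) (ξ : V →ₗ[ℝ] ℂ) :
    IsPoly fun z => ξ (ρ (lower z) v) := by
  have := (hρ.isPoly_upper (ρ weyl⁻¹ v) (ξ ∘ₗ ρ weyl)).comp_neg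
  simpa [lower_eq] using this

/-- A fixed vector is fixed by all natural powers, so each coefficient polynomial in `t` is constant
on `ℕ`, hence constant. -/
theorem IsContinuousRep.upper_real_mul_fixed (hρ : IsContinuousRep ρ) {z : ℂ} {v : V}
    (h : ρ (upper z) v = v) (t : ℝ) : ρ (upper (t * z)) v = v := by
  have h1 : ∀ n : ℕ, ρ (upper (n * z)) v = v := by
    intro n
    rw [upper_nsmul, map_pow]
    induction n with
    | zero => simp
    | succ n ih => rw [pow_succ, Module.End.mul_apply, h, ih]
  rw [← sub_eq_zero, ← Module.forall_dual_apply_eq_zero_iff ℝ]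
  intro φ
  obtain ⟨p, hp⟩ := hρ.exists_polynomial z v φ
  have h2 : p = C (φ v) := polynomial_eq_of_eval_natCast fun n => by
    rw [← hp, Complex.ofReal_natCast, h1, eval_C]
  rw [map_sub, hp, h2, eval_C, sub_self]

/-- A nonzero continuous representation has a nonzero vector fixed by the upper unipotent group. -/
theorem IsContinuousRep.exists_upper_fixed (hρ : IsContinuousRep ρ) [Nontrivial V] :
    ∃ v : V, v ≠ 0 ∧ ∀ z, ρ (upper z) v = v := by
  obtain ⟨v₀, hv₀⟩ := exists_ne (0 : V)
  -- The last nonzero iterate is taken under the nilpotent of `1`, then under that of `I`. They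
  -- commute, so the final vector is killed by both, and `1`, `I` span `ℂ` over `ℝ`.
  obtain ⟨k, hk, hk'⟩ := exists_pow_apply_ne_zero (hρ.isNilpotent_upper 1) hv₀
  obtain ⟨l, hl, hl'⟩ := exists_pow_apply_ne_zero (hρ.isNilpotent_upper Complex.I) hk
  set v₁ := ((ρ (upper 1) - 1) ^ k) v₀
  set v₂ := ((ρ (upper Complex.I) - 1) ^ l) v₁
  have hcomm : Commute (ρ (upper 1) - 1) ((ρ (upper Complex.I) - 1) ^ l) := by
    refine Commute.pow_right (Commute.sub_left (Commute.sub_right ?_ (Commute.one_right _))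
      (Commute.one_left _)) l
    change _ * _ = _ * _
    rw [← map_mul, ← map_mul, ← upper_add, ← upper_add, add_comm]
  have h1 : ρ (upper 1) v₂ = v₂ := by
    rw [← sub_eq_zero]
    change (ρ (upper 1) - 1) (((ρ (upper Complex.I) - 1) ^ l) v₁) = 0
    rw [← Module.End.mul_apply, hcomm.eq, Module.End.mul_apply, hk', map_zero]
  have hI : ρ (upper Complex.I) v₂ = v₂ := by
    rw [← sub_eq_zero]; exact hl'
  refine ⟨v₂, hl, fun z => ?_⟩
  have h1' := hρ.upper_real_mul_fixed h1 z.re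
  have hI' := hρ.upper_real_mul_fixed hI z.im
  rw [← Complex.re_add_im z, upper_add, map_mul, Module.End.mul_apply, hI']
  simpa using h1'

end Unipotent

/-! ### Highest weight functionals -/

/-- A commuting family of operators on a nonzero finite-dimensional space over an algebraically
closed field has a common eigenvector. -/
theorem exists_common_eigenvector {K ι : Type*} [Field K] [IsAlgClosed K] (n : ℕ) :
    ∀ {Y : Type*} [AddCommGroup Y] [Module K Y] [FiniteDimensional K Y] [Nontrivial Y]
      (f : ι → Module.End K Y), (∀ i j, Commute (f i) (f j)) → Module.finrank K Y ≤ n →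
      ∃ y : Y, y ≠ 0 ∧ ∀ i, ∃ μ : K, f i y = μ • y := by
  induction n with
  | zero =>
    intro Y _ _ _ _ f _ hn
    exact absurd hn (by simpa using (Module.finrank_pos (R := K) (M := Y)).ne')
  | succ n ih =>
    intro Y _ _ _ _ f hf hn
    -- If all operators are scalars, any vector will do. Otherwise a nonscalar one has a proper
    -- nonzero eigenspace, which the commuting family preserves.
    by_cases h : ∀ i, ∃ μ : K, ∀ y, f i y = μ • y
    · obtain ⟨y, hy⟩ := exists_ne (0 : Y)
      exact ⟨y, hy, fun i => (h i).imp fun μ hμ => hμ y⟩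
    · push Not at h
      obtain ⟨i, hi⟩ := h
      obtain ⟨μ, hμ⟩ := Module.End.exists_eigenvalue (f i)
      have hst : ∀ j, ∀ y ∈ Module.End.eigenspace (f i) μ,
          f j y ∈ Module.End.eigenspace (f i) μ := by
        intro j y hy
        rw [Module.End.mem_eigenspace_iff] at hy ⊢
        rw [← Module.End.mul_apply, (hf i j).eq, Module.End.mul_apply, hy, map_smul]
      have hlt : Module.finrank K (Module.End.eigenspace (f i) μ) < Module.finrank K Y := by
        refine Submodule.finrank_lt fun htop => ?_
        obtain ⟨y, hy⟩ := hi μ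
        exact hy (Module.End.mem_eigenspace_iff.1 (htop ▸ Submodule.mem_top))
      have : Nontrivial (Module.End.eigenspace (f i) μ) :=
        Submodule.nontrivial_iff_ne_bot.2 hμ
      obtain ⟨y, hy, hy'⟩ := ih (fun j => (f j).restrict (hst j))
        (fun j k => LinearMap.ext fun y => Subtype.ext (by
          simpa using LinearMap.congr_fun (hf j k).eq (y : Y))) (by omega)
      exact ⟨y, by simpa using hy, fun j => (hy' j).imp fun ν hν => congrArg Subtype.val hν⟩

section HighestWeight

variable {V : Type*} [AddCommGroup V] [Module ℝ V] {ρ : Representation ℝ SL(2, ℂ) V}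

variable (ρ) in
/-- A complex valued functional that is invariant under lower unipotent matrices and on which
`diag(w, w⁻¹)` acts by the character `w ^ p.1 * conj w ^ p.2`. -/
structure IsHighest (ξ : V →ₗ[ℝ] ℂ) (p : ℤ × ℤ) : Prop where
  lower_apply : ∀ z v, ξ (ρ (lower z) v) = ξ v
  torus_apply : ∀ w v, ξ (ρ (torus w) v) = zmon p w * ξ v

namespace IsHighest

variable {ξ : V →ₗ[ℝ] ℂ} {p : ℤ × ℤ}

theorem apply_eq (h : IsHighest ρ ξ p) (g : SL(2, ℂ)) (w : ℂˣ) (hw : g.1 0 0 = w) (v : V) :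
    ξ (ρ g v) = zmon p w * ξ (ρ (upper (g.1 0 1 * (w⁻¹ : ℂˣ))) v) := by
  conv_lhs => rw [eq_lower_torus_upper g w hw, map_mul, map_mul, Module.End.mul_apply,
    Module.End.mul_apply, h.lower_apply, h.torus_apply]

/-- Let `c` and `e` be the polynomials of `ξ` along `upper` and along `weyl * lower`. By
`weyl_mul_lower`, `e(w)` is the character `p` times `c(w⁻¹)`. An exponent `q` of `c` thus reappears
as the exponent `p - q` of the polynomial `e`, so `p - q` is nonnegative. -/
theorem exists_finsupp [FiniteDimensional ℝ V] (hρ : IsContinuousRep ρ) (h : IsHighest ρ ξ p)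
    (v : V) : ∃ c : ℕ × ℕ →₀ ℂ,
      (∀ z, ξ (ρ (upper z) v) = c.sum fun q x => x * (z ^ q.1 * conj z ^ q.2)) ∧
      ∀ q ∈ c.support, (q.1 : ℤ) ≤ p.1 ∧ (q.2 : ℤ) ≤ p.2 := by
  obtain ⟨c, hc⟩ := (hρ.isPoly_upper v ξ).exists_finsupp
  obtain ⟨e, he⟩ := (hρ.isPoly_lower v (ξ ∘ₗ ρ weyl)).exists_finsupp
  refine ⟨c, hc, fun q hq => ?_⟩
  let τ : ℕ × ℕ → ℤ × ℤ := fun q => (p.1 - q.1, p.2 - q.2)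
  let ι : ℕ × ℕ → ℤ × ℤ := fun q => (q.1, q.2)
  have hτ : Function.Injective τ := by
    rintro ⟨_, _⟩ ⟨_, _⟩ h
    simpa [τ] using h
  have key : c.mapDomain τ = e.mapDomain ι := by
    refine linearIndependent_zmon (funext fun w => ?_)
    have h1 := he w
    rw [LinearMap.comp_apply, ← Module.End.mul_apply, ← map_mul, weyl_mul_lower, map_mul, map_mul,
      Module.End.mul_apply, Module.End.mul_apply, h.lower_apply, h.torus_apply, hc] at h1
    rw [Finsupp.linearCombination_mapDomain, Finsupp.linearCombination_mapDomain,
      Finsupp.linearCombination_apply, Finsupp.linearCombination_apply, Finsupp.sum, Finsupp.sum,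
      Finset.sum_apply, Finset.sum_apply]
    rw [Finsupp.sum, Finsupp.sum, Finset.mul_sum] at h1
    have hw : (w : ℂ) ≠ 0 := w.ne_zero
    have hw' : conj (w : ℂ) ≠ 0 := by simp
    convert h1 using 2 with q _ q _
    · simp only [Function.comp_apply, Pi.smul_apply, smul_eq_mul, zmon_apply, τ,
        zpow_sub₀ hw, zpow_sub₀ hw', zpow_natCast, Units.val_inv_eq_inv_val, map_inv₀, inv_pow]
      ring
    · simp [zmon_apply, ι]
  have h2 : e.mapDomain ι (τ q) ≠ 0 := by
    rw [← key, Finsupp.mapDomain_apply hτ]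
    exact Finsupp.mem_support_iff.1 hq
  have h3 : τ q ∈ Set.range ι := by
    by_contra hn
    exact h2 (Finsupp.mapDomain_of_notMem_range _ _ hn)
  obtain ⟨r, hr⟩ := h3
  simp only [ι, τ, Prod.mk.injEq] at hr
  omega

end IsHighest

/-- The bihomogeneous monomials in the first row of a matrix. -/
def rowMono (a b : ℕ) (q : ℕ × ℕ) (g : SL(2, ℂ)) : ℂ :=
  g.1 0 0 ^ (a - q.1) * g.1 0 1 ^ q.1 * (conj (g.1 0 0) ^ (b - q.2) * conj (g.1 0 1) ^ q.2)

theorem continuous_rowMono (a b : ℕ) (q : ℕ × ℕ) : Continuous (rowMono a b q) := by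
  have h : ∀ i j, Continuous fun g : SL(2, ℂ) => g.1 i j := fun i j =>
    (continuous_apply_apply i j).comp continuous_subtype_val
  have h00 := h 0 0
  have h01 := h 0 1
  unfold rowMono
  fun_prop

/-- The matrix coefficients of a highest weight functional are bihomogeneous polynomials in the
first row. -/
theorem IsHighest.exists_finsupp_row [FiniteDimensional ℝ V] (hρ : IsContinuousRep ρ)
    {ξ : V →ₗ[ℝ] ℂ} {a b : ℕ} (h : IsHighest ρ ξ (a, b)) (v : V) : ∃ c : ℕ × ℕ →₀ ℂ,
      (∀ g, ξ (ρ g v) = c.sum fun q x => x * rowMono a b q g) ∧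
      ∀ q ∈ c.support, q.1 ≤ a ∧ q.2 ≤ b := by
  obtain ⟨c, hc, hsupp⟩ := h.exists_finsupp hρ v
  have hsupp' : ∀ q ∈ c.support, q.1 ≤ a ∧ q.2 ≤ b := fun q hq => by
    simpa using hsupp q hq
  have key : ∀ g : SL(2, ℂ), g.1 0 0 ≠ 0 →
      ξ (ρ g v) = c.sum fun q x => x * rowMono a b q g := by
    intro g hg
    rw [h.apply_eq g (Units.mk0 _ hg) rfl, hc, Finsupp.sum, Finsupp.sum, Finset.mul_sum]
    refine Finset.sum_congr rfl fun q hq => ?_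
    have hg' : conj (g.1 0 0) ≠ 0 := by simpa using hg
    rw [zmon_natCast, rowMono, Units.val_inv_eq_inv_val, Units.val_mk0,
      pow_sub₀ _ hg (hsupp' q hq).1, pow_sub₀ _ hg' (hsupp' q hq).2, map_mul, map_inv₀, mul_pow,
      mul_pow, inv_pow, inv_pow]
    ring
  refine ⟨c, fun g => ?_, hsupp'⟩
  by_cases hg : g.1 0 0 = 0
  · have hg1 : g.1 0 1 ≠ 0 := by
      intro h1
      have := g.2
      rw [Matrix.det_fin_two, hg, h1] at this
      simp at this
    -- A matrix outside the open cell is a limit of `g * lower z` as `z → 0`; the upper left entry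
    -- there is `z` times the nonzero entry `g 0 1`.
    have hcont : Continuous fun z => g * lower z := continuous_const.mul continuous_lower
    have h1 : Continuous fun z => ξ (ρ (g * lower z) v) :=
      (hρ.continuous_complex v ξ).comp hcont
    have h2 : Continuous fun z => c.sum fun q x => x * rowMono a b q (g * lower z) :=
      continuous_finsetSum _ fun q _ =>
        continuous_const.mul ((continuous_rowMono a b q).comp hcont)
    have := congrFun (h1.ext_on (dense_compl_singleton (0 : ℂ)) h2 fun z hz => key _ ?_) 0
    · simpa [lower_zero] using this
    · have hz' : z ≠ 0 := hz
      simp [lower_val, Matrix.mul_apply, hg, hg1, hz']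
  · exact key g hg

theorem IsContinuousRep.dual [FiniteDimensional ℝ V] (hρ : IsContinuousRep ρ) :
    IsContinuousRep ρ.dual := by
  intro φ Φ
  obtain ⟨v, rfl⟩ := (Module.evalEquiv ℝ V).surjective Φ
  exact (hρ v φ).comp continuous_inv

/-- A fixed vector of the dual representation is an invariant functional, and the Weyl element
carries upper invariance to lower invariance. -/
theorem IsContinuousRep.exists_lower_invariant [FiniteDimensional ℝ V] [Nontrivial V]
    (hρ : IsContinuousRep ρ) :
    ∃ φ : Module.Dual ℝ V, φ ≠ 0 ∧ ∀ z v, φ (ρ (lower z) v) = φ v := by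
  obtain ⟨ψ, hψ, hfix⟩ := hρ.dual.exists_upper_fixed
  have hψ' : ∀ z v, ψ (ρ (upper z) v) = ψ v := by
    intro z v
    have h1 := LinearMap.congr_fun (hfix z) (ρ (upper z) v)
    rw [Representation.dual_apply, Module.Dual.transpose_apply, LinearMap.comp_apply,
      Representation.inv_self_apply] at h1
    exact h1.symm
  refine ⟨ψ ∘ₗ ρ weyl⁻¹, fun h0 => hψ (LinearMap.ext fun v => ?_), fun z v => ?_⟩
  · simpa using LinearMap.congr_fun h0 (ρ weyl v)
  · rw [LinearMap.comp_apply, LinearMap.comp_apply, lower_eq, map_mul, map_mul,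
      Module.End.mul_apply, Module.End.mul_apply, Representation.inv_self_apply, hψ']

/-- Precomposition of complex valued functionals with an operator. -/
def precomp (A : Module.End ℝ V) : Module.End ℂ (V →ₗ[ℝ] ℂ) where
  toFun ξ := ξ ∘ₗ A
  map_add' _ _ := rfl
  map_smul' _ _ := rfl

variable (ρ) in
/-- The functionals that are invariant under lower unipotent matrices. -/
def lowerInvariants : Submodule ℂ (V →ₗ[ℝ] ℂ) where
  carrier := {ξ | ∀ z v, ξ (ρ (lower z) v) = ξ v}
  zero_mem' _ _ := rfl
  add_mem' := by
    intro ξ ψ hξ hψ z v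
    rw [LinearMap.add_apply, LinearMap.add_apply, hξ, hψ]
  smul_mem' := by
    intro c ξ hξ z v
    rw [LinearMap.smul_apply, LinearMap.smul_apply, hξ]

theorem precomp_torus_mem (w : ℂˣ) (ξ : V →ₗ[ℝ] ℂ) (hξ : ξ ∈ lowerInvariants ρ) :
    precomp (ρ (torus w)) ξ ∈ lowerInvariants ρ := by
  intro z v
  have h := torus_mul_lower w ((w : ℂ)⁻¹ ^ 2 * z)
  rw [← mul_assoc, ← mul_pow, mul_inv_cancel₀ w.ne_zero, one_pow, one_mul] at h
  change ξ (ρ (torus w) (ρ (lower z) v)) = ξ (ρ (torus w) v)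
  rw [← Module.End.mul_apply, ← map_mul, h, map_mul, Module.End.mul_apply]
  exact hξ _ _

/-- Functions on `ℂˣ` that are polynomials in `w`, `conj w` and their inverses. -/
def laurent : Subalgebra ℂ (ℂˣ → ℂ) :=
  (MonoidAlgebra.lift ℂ (ℂˣ → ℂ) (Multiplicative (ℤ × ℤ))
    { toFun := fun p => (zmon p.toAdd : ℂˣ → ℂ)
      map_one' := by ext w; simp [zmon_apply]
      map_mul' := fun p q => by
        ext w
        have hw' : conj (w : ℂ) ≠ 0 := by simp
        simp only [Pi.mul_apply, zmon_apply, toAdd_mul, Prod.fst_add, Prod.snd_add,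
          zpow_add₀ w.ne_zero, zpow_add₀ hw']
        ring }).range

theorem zmon_mem_laurent (p : ℤ × ℤ) : (zmon p : ℂˣ → ℂ) ∈ laurent :=
  ⟨MonoidAlgebra.single (Multiplicative.ofAdd p) 1, by
    simp [MonoidAlgebra.lift_single]⟩

theorem laurent_le_span {f : ℂˣ → ℂ} (hf : f ∈ laurent) :
    f ∈ Submodule.span ℂ (Set.range fun p : ℤ × ℤ => (zmon p : ℂˣ → ℂ)) := by
  obtain ⟨x, rfl⟩ := hf
  induction x using MonoidAlgebra.induction_linear with
  | zero => simp
  | add x y hx hy => rw [map_add]; exact add_mem hx hy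
  | single p c =>
    simp only [AlgHom.toRingHom_eq_coe, RingHom.coe_coe, MonoidAlgebra.lift_single]
    exact Submodule.smul_mem _ _ (Submodule.subset_span ⟨p.toAdd, rfl⟩)

theorem IsPoly.mem_laurent {f : ℂ → ℂ} (hf : IsPoly f) :
    (fun w : ℂˣ => f w) ∈ laurent ∧ (fun w : ℂˣ => f (-(w⁻¹ : ℂˣ))) ∈ laurent := by
  obtain ⟨c, hc⟩ := hf.exists_finsupp
  simp only [hc, Finsupp.sum]
  constructor
  · have : (fun w : ℂˣ => ∑ q ∈ c.support, c q * ((w : ℂ) ^ q.1 * conj (w : ℂ) ^ q.2)) =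
        ∑ q ∈ c.support, c q • (zmon (q.1, q.2) : ℂˣ → ℂ) := by
      ext w
      simp [zmon_apply]
    rw [this]
    exact sum_mem fun q _ => laurent.smul_mem (zmon_mem_laurent _) _
  · have : (fun w : ℂˣ => ∑ q ∈ c.support, c q * ((-((w⁻¹ : ℂˣ) : ℂ)) ^ q.1 *
        conj (-((w⁻¹ : ℂˣ) : ℂ)) ^ q.2)) =
        ∑ q ∈ c.support, (c q * (-1) ^ q.1 * (-1) ^ q.2) •
          (zmon (-(q.1 : ℤ), -(q.2 : ℤ)) : ℂˣ → ℂ) := by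
      ext w
      simp only [Finset.sum_apply, Pi.smul_apply, smul_eq_mul, zmon_apply]
      refine Finset.sum_congr rfl fun q _ => ?_
      rw [neg_pow, map_neg, neg_pow (conj _), Units.val_inv_eq_inv_val, map_inv₀, zpow_neg,
        zpow_neg, zpow_natCast, zpow_natCast, inv_pow, inv_pow]
      ring
    rw [this]
    exact sum_mem fun q _ => laurent.smul_mem (zmon_mem_laurent _) _

/-- In the factorization of `torus_eq` every factor is unipotent with parameter `w`, `-w⁻¹` or a
constant. Inserting bases between the factors expresses the coefficient by polynomials in `w`, `w⁻¹`
and their conjugates. -/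
theorem IsContinuousRep.torus_mem_laurent [FiniteDimensional ℝ V] (hρ : IsContinuousRep ρ)
    (ξ : V →ₗ[ℝ] ℂ) (v : V) : (fun w => ξ (ρ (torus w) v)) ∈ laurent := by
  let b := Module.finBasis ℝ V
  have expand : ∀ (η : V →ₗ[ℝ] ℂ) (A : Module.End ℝ V) (x : V),
      η (A x) = ∑ k, η (A (b k)) * (Complex.ofRealCLM.toLinearMap ∘ₗ b.coord k) x := by
    intro η A x
    conv_lhs => rw [← b.sum_repr x, map_sum, map_sum]
    refine Finset.sum_congr rfl fun k _ => ?_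
    rw [map_smul, map_smul, Complex.real_smul, mul_comm]
    rfl
  have h : (fun w => ξ (ρ (torus w) v)) = ∑ k, ∑ l,
      (fun w : ℂˣ => ξ (ρ (upper w) (b k))) *
      ((fun w : ℂˣ => (Complex.ofRealCLM.toLinearMap ∘ₗ b.coord k)
        (ρ (lower (-(w⁻¹ : ℂˣ))) (b l))) *
      (fun w : ℂˣ => (Complex.ofRealCLM.toLinearMap ∘ₗ b.coord l)
        (ρ (upper w) (ρ (upper (-1) * lower 1 * upper (-1)) v)))) := by
    funext w
    rw [torus_eq, map_mul, map_mul, map_mul, Module.End.mul_apply, Module.End.mul_apply,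
      Module.End.mul_apply, expand ξ]
    simp only [Finset.sum_apply, Pi.mul_apply]
    refine Finset.sum_congr rfl fun k _ => ?_
    rw [expand (Complex.ofRealCLM.toLinearMap ∘ₗ b.coord k), Finset.mul_sum]
  rw [h]
  refine sum_mem fun k _ => sum_mem fun l _ => mul_mem ?_ (mul_mem ?_ ?_)
  · exact (hρ.isPoly_upper (b k) ξ).mem_laurent.1
  · exact (hρ.isPoly_lower (b l) _).mem_laurent.2
  · exact (hρ.isPoly_upper _ _).mem_laurent.1

/-- A nonzero continuous representation has a nonzero highest weight functional. -/
theorem IsContinuousRep.exists_isHighest [FiniteDimensional ℝ V] [Nontrivial V]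
    (hρ : IsContinuousRep ρ) :
    ∃ (ξ : V →ₗ[ℝ] ℂ) (a b : ℕ), ξ ≠ 0 ∧ IsHighest ρ ξ (a, b) := by
  obtain ⟨φ, hφ, hφ'⟩ := hρ.exists_lower_invariant
  have hfin : FiniteDimensional ℂ (V →ₗ[ℝ] ℂ) :=
    Module.Finite.of_restrictScalars_finite ℝ ℂ _
  have hnt : Nontrivial (lowerInvariants ρ) := by
    refine ⟨⟨⟨Complex.ofRealCLM.toLinearMap ∘ₗ φ, fun z v => ?_⟩, 0, fun h => hφ ?_⟩⟩
    · exact congrArg Complex.ofReal (hφ' z v)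
    · refine LinearMap.ext fun v => ?_
      have := LinearMap.congr_fun (congrArg Subtype.val h) v
      exact Complex.ofReal_eq_zero.1 this
  -- The torus is commutative and normalizes the lower unipotent group, so it acts on the complex
  -- space of invariant functionals by commuting operators.
  obtain ⟨⟨ξ, hlow⟩, hξ, heig⟩ := exists_common_eigenvector _
    (fun w : ℂˣ => (precomp (ρ (torus w))).restrict (precomp_torus_mem w))
    (fun w w' => LinearMap.ext fun ξ => Subtype.ext (LinearMap.ext fun v => by
      change ξ.1 (ρ (torus w') (ρ (torus w) v)) = ξ.1 (ρ (torus w) (ρ (torus w') v))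
      rw [← Module.End.mul_apply, ← Module.End.mul_apply, ← map_mul, ← map_mul, ← torus_mul,
        ← torus_mul, mul_comm])) le_rfl
  have hξ0 : ξ ≠ 0 := fun h => hξ (Subtype.ext h)
  choose χ hχ using heig
  have hχ' : ∀ w v, ξ (ρ (torus w) v) = χ w * ξ v := fun w v =>
    LinearMap.congr_fun (congrArg Subtype.val (hχ w)) v
  obtain ⟨v, hv⟩ : ∃ v, ξ v ≠ 0 := by
    by_contra! h
    exact hξ0 (LinearMap.ext h)
  let χhom : ℂˣ →* ℂ :=
    { toFun := χ
      map_one' := by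
        have := hχ' 1 v
        rw [torus_one, map_one, Module.End.one_apply] at this
        exact (mul_eq_right₀ hv).1 this.symm
      map_mul' := fun w w' => by
        have := hχ' (w * w') v
        rw [torus_mul, map_mul, Module.End.mul_apply, hχ', hχ', ← mul_assoc] at this
        exact (mul_right_cancel₀ hv this).symm }
  -- The eigencharacter is a matrix coefficient divided by a constant, hence a combination of the
  -- `zmon p`. By independence of characters it must be one of them.
  have hmem : (χhom : ℂˣ → ℂ) ∈ Submodule.span ℂ ((fun f : ℂˣ →* ℂ => (f : ℂˣ → ℂ)) ''
      Set.range zmon) := by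
    rw [← Set.range_comp]
    refine laurent_le_span ?_
    have h1 : (χhom : ℂˣ → ℂ) = (ξ v)⁻¹ • fun w => ξ (ρ (torus w) v) := by
      ext w
      simp only [Pi.smul_apply, smul_eq_mul, hχ']
      change χ w = _
      field_simp
    rw [h1]
    exact laurent.smul_mem (hρ.torus_mem_laurent ξ v) _
  have hrange : χhom ∈ Set.range zmon := by
    by_contra hn
    exact (linearIndependent_monoidHom ℂˣ ℂ).notMem_span_image hn hmem
  obtain ⟨p, hp⟩ := hrange
  have hhw : IsHighest ρ ξ p := ⟨hlow, fun w v => by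
    rw [hχ', hp]; rfl⟩
  obtain ⟨c, hc, hsupp⟩ := hhw.exists_finsupp hρ v
  -- Since `ξ v ≠ 0`, some exponent `q` occurs in the expansion, and `0 ≤ q ≤ p` componentwise makes
  -- both components of `p` natural numbers.
  have hc0 : c ≠ 0 := by
    rintro rfl
    have := hc 0
    rw [upper_zero, map_one] at this
    exact hv (by simpa using this)
  obtain ⟨q, hq⟩ := Finsupp.support_nonempty_iff.2 hc0
  have hq' := hsupp q hq
  refine ⟨ξ, p.1.toNat, p.2.toNat, hξ0, ?_⟩
  have : (((p.1.toNat : ℕ) : ℤ), ((p.2.toNat : ℕ) : ℤ)) = p := by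
    ext
    · exact Int.toNat_of_nonneg (by omega)
    · exact Int.toNat_of_nonneg (by omega)
  rwa [this]

end HighestWeight

/-! ### Representations determined by a highest weight functional -/

theorem coeff_eq_zero_of_sum_eq_zero {a b : ℕ} {c : ℕ → ℕ → ℂ}
    (h : ∀ z : ℂ, ∑ i ∈ Finset.range a, ∑ j ∈ Finset.range b,
      c i j * (z ^ i * conj z ^ j) = 0) {i j : ℕ} (hi : i < a) (hj : j < b) : c i j = 0 := by
  let S := Finset.range a ×ˢ Finset.range b
  let e : ℕ × ℕ →₀ ℂ := Finsupp.onFinset S (fun q => if q ∈ S then c q.1 q.2 else 0)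
    fun q hq => by by_contra hn; simp [hn] at hq
  have he : e = 0 := finsupp_eq_zero_of_sum_eq_zero fun w => by
    rw [Finsupp.onFinset_sum _ (by simp), ← h w, ← Finset.sum_product']
    exact Finset.sum_congr rfl fun q hq => by rw [if_pos hq]
  have := DFunLike.congr_fun he (i, j)
  simpa [e, S, hi, hj] using this

/-- The function `(α + β z) ^ a * conj (α + β z) ^ b` of the first row `(α, β)`. -/
def rowPow (a b : ℕ) (z : ℂ) (g : SL(2, ℂ)) : ℂ :=
  (g.1 0 0 + g.1 0 1 * z) ^ a * conj (g.1 0 0 + g.1 0 1 * z) ^ b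

theorem rowPow_eq (a b : ℕ) (z : ℂ) (g : SL(2, ℂ)) : rowPow a b z g =
    ∑ i ∈ Finset.range (a + 1), ∑ j ∈ Finset.range (b + 1),
      (a.choose i * b.choose j) * rowMono a b (i, j) g * (z ^ i * conj z ^ j) := by
  rw [rowPow, map_add, map_mul, add_comm, add_comm (conj _), add_pow, add_pow,
    Finset.sum_mul_sum]
  refine Finset.sum_congr rfl fun i _ => Finset.sum_congr rfl fun j _ => ?_
  rw [rowMono, mul_pow, mul_pow]
  ring

/-- A linear form that kills every `rowPow a b z` gives, after binomial expansion, a vanishing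
polynomial in `z` and `conj z`. Its coefficients are nonzero binomials times the values on the
monomials, so the form kills those too. -/
theorem rowMono_mem_span {a b : ℕ} {q : ℕ × ℕ} (h1 : q.1 ≤ a) (h2 : q.2 ≤ b) :
    rowMono a b q ∈ Submodule.span ℂ (Set.range (rowPow a b)) := by
  by_contra hn
  obtain ⟨f, hf, hle⟩ := Submodule.exists_le_ker_of_notMem hn
  refine hf ?_
  have h : ∀ z : ℂ, ∑ i ∈ Finset.range (a + 1), ∑ j ∈ Finset.range (b + 1),
      ((a.choose i * b.choose j) * f (rowMono a b (i, j))) * (z ^ i * conj z ^ j) = 0 := by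
    intro z
    have h0 : f (rowPow a b z) = 0 := hle (Submodule.subset_span ⟨z, rfl⟩)
    have h3 : rowPow a b z = ∑ i ∈ Finset.range (a + 1), ∑ j ∈ Finset.range (b + 1),
        ((a.choose i * b.choose j) * (z ^ i * conj z ^ j) : ℂ) • rowMono a b (i, j) := by
      funext g
      rw [rowPow_eq, Finset.sum_apply]
      refine Finset.sum_congr rfl fun i _ => ?_
      rw [Finset.sum_apply]
      refine Finset.sum_congr rfl fun j _ => ?_
      rw [Pi.smul_apply, smul_eq_mul]
      ring
    rw [h3, map_sum] at h0
    rw [← h0]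
    refine Finset.sum_congr rfl fun i _ => ?_
    rw [map_sum]
    refine Finset.sum_congr rfl fun j _ => ?_
    rw [map_smul, smul_eq_mul]
    ring
  have := coeff_eq_zero_of_sum_eq_zero (c := fun i j =>
    (a.choose i * b.choose j) * f (rowMono a b (i, j))) h
    (Nat.lt_succ_of_le h1) (Nat.lt_succ_of_le h2)
  have hc1 : (a.choose q.1 : ℂ) ≠ 0 := by exact_mod_cast (Nat.choose_pos h1).ne'
  have hc2 : (b.choose q.2 : ℂ) ≠ 0 := by exact_mod_cast (Nat.choose_pos h2).ne'
  simpa [hc1, hc2] using this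

/-- `R` is only a real subspace while the span is complex, so the complex factor `l` has to be
carried through the induction. -/
theorem comp_finsupp_sum_mem {a b : ℕ} {R : Submodule ℝ (SL(2, ℂ) → ℂ)} {π : ℂ →ₗ[ℝ] ℂ}
    (hR : ∀ (l z : ℂ), (fun g => π (l * rowPow a b z g)) ∈ R) {c : ℕ × ℕ →₀ ℂ}
    (hc : ∀ q ∈ c.support, q.1 ≤ a ∧ q.2 ≤ b) :
    (fun g => π (c.sum fun q x => x * rowMono a b q g)) ∈ R := by
  have key : ∀ h ∈ Submodule.span ℂ (Set.range (rowPow a b)),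
      ∀ l : ℂ, (fun g => π (l * h g)) ∈ R := by
    intro h hh
    induction hh using Submodule.span_induction with
    | mem h hh => obtain ⟨z, rfl⟩ := hh; exact fun l => hR l z
    | zero =>
      intro l
      simp only [Pi.zero_apply, mul_zero, map_zero]
      exact R.zero_mem
    | add h h' _ _ ih ih' =>
      intro l
      have : (fun g => π (l * (h + h') g)) =
          (fun g => π (l * h g)) + fun g => π (l * h' g) := by
        funext g; simp [mul_add]
      rw [this]
      exact R.add_mem (ih l) (ih' l)
    | smul x h _ ih =>
      intro l
      simpa [mul_assoc] using ih (l * x)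
  have hmem : (∑ q ∈ c.support, c q • rowMono a b q) ∈
      Submodule.span ℂ (Set.range (rowPow a b)) :=
    sum_mem fun q hq => Submodule.smul_mem _ _ (rowMono_mem_span (hc q hq).1 (hc q hq).2)
  simpa [Finsupp.sum] using key _ hmem 1

/-- The identity if `a ≠ b`, and the real part if `a = b`. -/
def realProj (a b : ℕ) : ℂ →ₗ[ℝ] ℂ :=
  if a = b then Complex.ofRealCLM.toLinearMap ∘ₗ Complex.reLm else LinearMap.id

theorem realProj_self (a : ℕ) (x : ℂ) : realProj a a x = (x.re : ℂ) := by
  simp [realProj]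

theorem realProj_of_ne {a b : ℕ} (h : a ≠ b) (x : ℂ) : realProj a b x = x := by
  simp [realProj, h]

/-! ### Matrix coefficients as functions of the first row -/

section Coefficients

variable {V : Type*} [AddCommGroup V] [Module ℝ V] (ρ : Representation ℝ SL(2, ℂ) V)

/-- The matrix coefficients `g ↦ ξ (ρ g v)`. -/
def coeffMap (ξ : V →ₗ[ℝ] ℂ) : V →ₗ[ℝ] (SL(2, ℂ) → ℂ) where
  toFun v g := ξ (ρ g v)
  map_add' v w := by ext g; simp
  map_smul' c v := by ext g; simp

theorem coeffMap_apply (ξ : V →ₗ[ℝ] ℂ) (v : V) (g : SL(2, ℂ)) :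
    coeffMap ρ ξ v g = ξ (ρ g v) := rfl

theorem coeffMap_rho (ξ : V →ₗ[ℝ] ℂ) (v : V) (g h : SL(2, ℂ)) :
    coeffMap ρ ξ (ρ h v) g = coeffMap ρ ξ v (g * h) := by
  rw [coeffMap_apply, coeffMap_apply, map_mul, Module.End.mul_apply]

theorem rowMono_upper (a b : ℕ) (q : ℕ × ℕ) (z : ℂ) :
    rowMono a b q (upper z) = z ^ q.1 * conj z ^ q.2 := by
  simp [rowMono, upper_val]

/-- A continuous finite-dimensional representation with a highest weight functional that separates
vectors, and that is real valued in the selfconjugate case. -/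
structure IsModel (ξ : V →ₗ[ℝ] ℂ) (a b : ℕ) : Prop where
  finite : FiniteDimensional ℝ V
  nontrivial : Nontrivial V
  cont : IsContinuousRep ρ
  highest : IsHighest ρ ξ (a, b)
  separating : ∀ v, (∀ z, ξ (ρ (upper z) v) = 0) → v = 0
  real : ∀ v, realProj a b (ξ v) = ξ v

variable {ρ}

theorem IsContinuousRep.restrict {ρ : Representation ℝ SL(2, ℂ) V} (hρ : IsContinuousRep ρ)
    (U : Subrepresentation ρ) : IsContinuousRep U.toRepresentation := by
  intro v φ
  obtain ⟨ψ, rfl⟩ := LinearMap.exists_extend φ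
  exact hρ v ψ

namespace IsModel

variable {ξ : V →ₗ[ℝ] ℂ} {a b : ℕ} (h : IsModel ρ ξ a b)
include h

theorem coeffMap_injective : Function.Injective (coeffMap ρ ξ) := by
  rw [injective_iff_map_eq_zero]
  exact fun v hv => h.separating v fun z => congrFun hv (upper z)

/-- Along the upper unipotent group the coefficient is the constant `ξ w`, so by uniqueness of
coefficients only the bidegree `(0, 0)` in the second entry of the row survives. -/
theorem apply_fixed {w : V} (hw : ∀ z, ρ (upper z) w = w) (g : SL(2, ℂ)) :
    ξ (ρ g w) = ξ w * (g.1 0 0 ^ a * conj (g.1 0 0) ^ b) := by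
  have := h.finite
  obtain ⟨c, hc, -⟩ := h.highest.exists_finsupp_row h.cont w
  have h1 : c - Finsupp.single (0, 0) (ξ w) = 0 := finsupp_eq_zero_of_sum_eq_zero fun z => by
    rw [Finsupp.sum_sub_index (by intros; ring), Finsupp.sum_single_index (by simp)]
    have := hc (upper z)
    simp only [rowMono_upper, hw] at this
    rw [← this]
    simp
  rw [hc, sub_eq_zero.1 h1, Finsupp.sum_single_index (by simp)]
  simp [rowMono]

theorem apply_fixed_ne_zero {w : V} (hw0 : w ≠ 0) (hw : ∀ z, ρ (upper z) w = w) : ξ w ≠ 0 :=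
  fun h0 => hw0 (h.separating w fun z => by rw [hw, h0])

/-- The coefficients of a nonzero subrepresentation exhaust the possible functions. -/
theorem exists_mem_of_finsupp (U : Subrepresentation ρ) (hU : U ≠ ⊥) {c : ℕ × ℕ →₀ ℂ}
    (hc : ∀ q ∈ c.support, q.1 ≤ a ∧ q.2 ≤ b) :
    ∃ u ∈ U, ∀ g, ξ (ρ g u) = realProj a b (c.sum fun q x => x * rowMono a b q g) := by
  have := h.finite
  have : Nontrivial U.toSubmodule := Submodule.nontrivial_iff_ne_bot.2 fun h0 =>
    hU (Subrepresentation.toSubmodule_injective h0)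
  obtain ⟨⟨w, hwU⟩, hw0, hw⟩ := (h.cont.restrict U).exists_upper_fixed
  replace hw0 : w ≠ 0 := fun h0 => hw0 (Subtype.ext h0)
  replace hw : ∀ z, ρ (upper z) w = w := fun z => congrArg Subtype.val (hw z)
  have hξ := h.apply_fixed_ne_zero hw0 hw
  -- Translating the fixed vector by `lower z * torus t` replaces the first entry `α` of the row
  -- `(α, β)` by `(α + β z) t`. This produces all the powers `rowPow a b z`.
  have hmem : ∀ (t : ℂˣ) (z : ℂ), (fun g => (t : ℂ) ^ a * conj (t : ℂ) ^ b * ξ w *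
      rowPow a b z g) ∈ U.toSubmodule.map (coeffMap ρ ξ) := by
    intro t z
    refine ⟨ρ (lower z) (ρ (torus t) w), U.apply_mem_toSubmodule _
      (U.apply_mem_toSubmodule _ hwU), funext fun g => ?_⟩
    rw [coeffMap_rho, coeffMap_rho, coeffMap_apply, h.apply_fixed hw, rowPow]
    have : (g * lower z * torus t).1 0 0 = (g.1 0 0 + g.1 0 1 * z) * t := by
      simp [lower_val, torus_val, Matrix.mul_apply]
    rw [this, map_mul, mul_pow, mul_pow]
    ring
  have hR : ∀ (l z : ℂ), (fun g => realProj a b (l * rowPow a b z g)) ∈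
      U.toSubmodule.map (coeffMap ρ ξ) := by
    intro l z
    by_cases hab : a = b
    · subst hab
      have h1 := h.real w
      rw [realProj_self] at h1
      -- For `a = b` the power is `|α + β z| ^ (2 a)`, a real function, and `ξ w` is real: real
      -- multiples suffice.
      have hre : (ξ w).re ≠ 0 := fun h0 => hξ (by rw [← h1, h0]; rfl)
      have h2 := Submodule.smul_mem _ (l.re / (ξ w).re) (hmem 1 z)
      convert h2 using 1
      funext g
      have h3 : rowPow a a z g = (Complex.normSq (g.1 0 0 + g.1 0 1 * z) ^ a : ℝ) := by
        rw [rowPow, ← mul_pow, Complex.mul_conj]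
        push_cast
        rfl
      have h4 : ((ξ w).re : ℂ) ≠ 0 := by exact_mod_cast hre
      rw [Pi.smul_apply, h3, realProj_self, Complex.re_mul_ofReal, ← h1, Complex.real_smul,
        Complex.ofReal_re]
      push_cast
      rw [map_one, one_pow, one_mul, one_mul]
      field_simp
    · have hab' : ((a : ℝ) - b) ≠ 0 := sub_ne_zero.2 (by exact_mod_cast hab)
      -- The angle is chosen so that `t = exp(iθ)` has `t ^ a * conj t ^ b = I`. The real span of
      -- the translates by `1` and `t` then contains all complex multiples.
      let θ : ℝ := Real.pi / (2 * (a - b))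
      let t : ℂˣ := Units.mk0 (Complex.exp (θ * Complex.I)) (Complex.exp_ne_zero _)
      have ht : (t : ℂ) ^ a * conj (t : ℂ) ^ b = Complex.I := by
        have h1 : conj (t : ℂ) = Complex.exp (-(θ * Complex.I)) := by
          rw [Units.val_mk0, ← Complex.exp_conj]
          simp
        rw [h1, Units.val_mk0, ← Complex.exp_nat_mul, ← Complex.exp_nat_mul, ← Complex.exp_add]
        have h2 : (a : ℂ) * (θ * Complex.I) + b * (-(θ * Complex.I)) =
            (Real.pi / 2 : ℝ) * Complex.I := by
          have h3 : (a - b : ℝ) * θ = Real.pi / 2 := by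
            simp only [θ]
            field_simp
          rw [← h3]
          push_cast
          ring
        rw [h2]
        push_cast
        exact Complex.exp_pi_div_two_mul_I
      have h1 := hmem 1 z
      have h2 := hmem t z
      rw [ht] at h2
      convert Submodule.add_mem _ (Submodule.smul_mem _ (l / ξ w).re h1)
        (Submodule.smul_mem _ (l / ξ w).im h2) using 1
      funext g
      rw [realProj_of_ne hab]
      simp only [Pi.add_apply, Pi.smul_apply, Complex.real_smul, Units.val_one, map_one, one_pow,
        one_mul]
      have h3 : l = ((l / ξ w).re + (l / ξ w).im * Complex.I) * ξ w := by
        rw [Complex.re_add_im, div_mul_cancel₀ _ hξ]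
      conv_lhs => rw [h3]
      ring
  obtain ⟨u, hu, hu'⟩ := comp_finsupp_sum_mem hR hc
  exact ⟨u, hu, fun g => congrFun hu' g⟩

/-- The coefficient function of any `v` is also that of some vector of a given nonzero
subrepresentation, and coefficient functions determine vectors. -/
theorem isIrreducible : ρ.IsIrreducible := by
  have := h.finite
  have := h.nontrivial
  have hnt : Nontrivial (Subrepresentation ρ) := by
    refine ⟨⟨⊥, ⊤, fun h0 => ?_⟩⟩
    have h1 : (⊥ : Submodule ℝ V) = ⊤ := congrArg Subrepresentation.toSubmodule h0
    exact bot_ne_top h1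
  refine { toNontrivial := hnt, eq_bot_or_eq_top := fun U => ?_ }
  by_cases hU : U = ⊥
  · exact Or.inl hU
  · refine Or.inr (Subrepresentation.toSubmodule_injective (Submodule.eq_top_iff'.2 fun v => ?_))
    obtain ⟨c, hc, hsupp⟩ := h.highest.exists_finsupp_row h.cont v
    obtain ⟨u, hu, hu'⟩ := h.exists_mem_of_finsupp U hU hsupp
    have : u = v := h.coeffMap_injective (funext fun g => by
      rw [coeffMap_apply, coeffMap_apply, hu', ← hc, h.real])
    exact this ▸ hu

/-- Irreducible representations with the same highest weight are equivalent. -/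
theorem nonempty_equiv {V' : Type*} [AddCommGroup V'] [Module ℝ V'] [FiniteDimensional ℝ V']
    {ρ' : Representation ℝ SL(2, ℂ) V'} (hρ' : IsContinuousRep ρ') (hirr : ρ'.IsIrreducible)
    {ξ' : V' →ₗ[ℝ] ℂ} (hξ' : ξ' ≠ 0) (hh : IsHighest ρ' ξ' (a, b))
    (hreal : ∀ v, realProj a b (ξ' v) = ξ' v) : Nonempty (ρ'.Equiv ρ) := by
  have := h.finite
  have := h.isIrreducible
  -- Both representations are realized by right translation on functions of the first row, and the
  -- functions of `ρ` exhaust those allowed. The resulting intertwiner is nonzero, hence bijective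
  -- by Schur's lemma.
  have hle : ∀ v, coeffMap ρ' ξ' v ∈ LinearMap.range (coeffMap ρ ξ) := by
    intro v
    obtain ⟨c, hc, hsupp⟩ := hh.exists_finsupp_row hρ' v
    obtain ⟨u, -, hu'⟩ := h.exists_mem_of_finsupp ⊤ bot_ne_top.symm hsupp
    refine ⟨u, funext fun g => ?_⟩
    rw [coeffMap_apply, coeffMap_apply, hu', ← hc, hreal]
  let e := LinearEquiv.ofInjective (coeffMap ρ ξ) h.coeffMap_injective
  let f : V' →ₗ[ℝ] V := e.symm.toLinearMap ∘ₗ (coeffMap ρ' ξ').codRestrict _ hle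
  have hf : ∀ v, coeffMap ρ ξ (f v) = coeffMap ρ' ξ' v := fun v =>
    congrArg Subtype.val (e.apply_symm_apply ((coeffMap ρ' ξ').codRestrict _ hle v))
  let F : Representation.IntertwiningMap ρ' ρ := ⟨f, fun g => LinearMap.ext fun v =>
    h.coeffMap_injective (funext fun x => by
      change coeffMap ρ ξ (f (ρ' g v)) x = coeffMap ρ ξ (ρ g (f v)) x
      rw [hf, coeffMap_rho, coeffMap_rho, hf])⟩
  rcases Representation.IsIrreducible.bijective_or_eq_zero F with hb | h0
  · exact ⟨F.ofBijective hb⟩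
  · refine absurd (LinearMap.ext fun v => ?_) hξ'
    have h1 : f v = 0 := congrArg (fun G : Representation.IntertwiningMap ρ' ρ => G v) h0
    have h2 := congrFun (hf v) 1
    rw [h1, map_zero, coeffMap_apply, map_one] at h2
    exact h2.symm

/-- A real representation need not have real eigenvalues for `torus t` on fixed vectors. Adding the
conjugate element gives conjugate characters, whose sum is a real scalar that does not depend on
`ξ`. -/
theorem torus_add_torus_conj {w : V} (hw : ∀ z, ρ (upper z) w = w) (t t' : ℂˣ)
    (ht : (t' : ℂ) = conj (t : ℂ)) :
    ρ (torus t) w + ρ (torus t') w = (2 * ((t : ℂ) ^ a * conj (t : ℂ) ^ b).re : ℝ) • w := by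
  have hfix : ∀ (t : ℂˣ) (z : ℂ), ρ (upper z) (ρ (torus t) w) = ρ (torus t) w := by
    intro t z
    have h1 := torus_mul_upper t ((t : ℂ)⁻¹ ^ 2 * z)
    rw [← mul_assoc, ← mul_pow, mul_inv_cancel₀ t.ne_zero, one_pow, one_mul] at h1
    rw [← Module.End.mul_apply, ← map_mul, ← h1, map_mul, Module.End.mul_apply, hw]
  rw [← sub_eq_zero]
  refine h.separating _ fun z => ?_
  rw [map_sub, map_add, map_smul, hfix, hfix, hw, map_sub, map_add, map_smul,
    h.highest.torus_apply, h.highest.torus_apply, zmon_natCast, zmon_natCast, ht, Complex.conj_conj,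
    Complex.real_smul]
  have h2 : (t : ℂ) ^ a * conj (t : ℂ) ^ b + conj (t : ℂ) ^ a * (t : ℂ) ^ b =
      (2 * ((t : ℂ) ^ a * conj (t : ℂ) ^ b).re : ℝ) := by
    rw [← Complex.add_conj]
    simp
  rw [← h2]
  ring

/-- An equivalence preserves the scalars `2 Re (t ^ a * conj t ^ b)`. The value at `t = 2` gives `a
+ b`, and a point of the unit circle gives `a - b`. -/
theorem eq_of_equiv {V' : Type*} [AddCommGroup V'] [Module ℝ V']
    {ρ' : Representation ℝ SL(2, ℂ) V'} {ξ' : V' →ₗ[ℝ] ℂ} {a' b' : ℕ}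
    (h' : IsModel ρ' ξ' a' b') (e : ρ.Equiv ρ') (hab : b ≤ a) (hab' : b' ≤ a') :
    a = a' ∧ b = b' := by
  have := h.finite
  have := h.nontrivial
  obtain ⟨w, hw0, hw⟩ := h.cont.exists_upper_fixed
  have he : ∀ g v, e (ρ g v) = ρ' g (e v) := fun g v =>
    LinearMap.congr_fun (e.isIntertwining' g) v
  have hw0' : e w ≠ 0 := fun h0 => hw0 (e.toLinearEquiv.map_eq_zero_iff.1 h0)
  have hw' : ∀ z, ρ' (upper z) (e w) = e w := fun z => by rw [← he, hw]
  have key : ∀ t : ℂ, t ≠ 0 → (t ^ a * conj t ^ b).re = (t ^ a' * conj t ^ b').re := by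
    intro t ht
    let t₁ : ℂˣ := Units.mk0 t ht
    let t₂ : ℂˣ := Units.mk0 (conj t) (by simpa using ht)
    have h1 := h.torus_add_torus_conj hw t₁ t₂ rfl
    have h2 := h'.torus_add_torus_conj hw' t₁ t₂ rfl
    rw [← he, ← he] at h2
    have h3 := congrArg e.toLinearEquiv h1
    rw [map_add, map_smul] at h3
    have h4 := (smul_left_injective ℝ hw0') (h3.symm.trans h2)
    simpa [t₁] using h4
  have hsum : a + b = a' + b' := by
    have := key 2 two_ne_zero
    rw [Complex.conj_ofNat, ← pow_add, ← pow_add] at this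
    have h2 : (2 : ℝ) ^ (a + b) = 2 ^ (a' + b') := by exact_mod_cast this
    exact pow_right_injective₀ (by norm_num) (by norm_num) h2
  have hcos : ∀ (m n : ℕ) (θ : ℝ), ((Complex.exp (θ * Complex.I)) ^ m *
      conj (Complex.exp (θ * Complex.I)) ^ n).re = Real.cos ((m - n) * θ) := by
    intro m n θ
    have h1 : conj (Complex.exp (θ * Complex.I)) = Complex.exp (-(θ * Complex.I)) := by
      rw [← Complex.exp_conj]
      simp
    rw [h1, ← Complex.exp_nat_mul, ← Complex.exp_nat_mul, ← Complex.exp_add,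
      ← Complex.exp_ofReal_mul_I_re]
    congr 2
    push_cast
    ring
  have hpi := Real.pi_pos
  -- The angle `π / (a + b + 1)` keeps `(m - n)` times it within `[0, π]`, where the cosine is
  -- injective. The `+ 1` avoids division by zero; `n ≤ m` is needed as the cosine is even.
  have hmem : ∀ m n : ℕ, n ≤ m → m + n = a + b →
      ((m : ℝ) - n) * (Real.pi / (a + b + 1)) ∈ Set.Icc 0 Real.pi := by
    intro m n hnm hmn
    have h1 : (n : ℝ) ≤ m := by exact_mod_cast hnm
    have h2 : (m : ℝ) + n = a + b := by exact_mod_cast hmn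
    have h3 : (0 : ℝ) ≤ n := n.cast_nonneg
    have h4 : (0 : ℝ) < a + b + 1 := by positivity
    refine ⟨mul_nonneg (by linarith) (by positivity), ?_⟩
    rw [mul_div_assoc', div_le_iff₀ h4, mul_comm]
    exact mul_le_mul_of_nonneg_left (by linarith) hpi.le
  have h1 := key (Complex.exp ((Real.pi / (a + b + 1) : ℝ) * Complex.I)) (Complex.exp_ne_zero _)
  rw [hcos, hcos] at h1
  have h2 := Real.injOn_cos (hmem a b hab rfl) (hmem a' b' hab' hsum.symm) h1
  have h3 : (a : ℝ) - b = a' - b' := mul_right_cancel₀ (by positivity) h2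
  have h4 : (a : ℤ) - b = a' - b' := by exact_mod_cast h3
  omega

end IsModel

end Coefficients

end MajoranaRep

end

noncomputable section

namespace MajoranaRep

open Filter Topology ComplexConjugate

/-! ### Operators and functionals on tensors -/

section Tensors

variable {𝕜 : Type*} [Field 𝕜] {E : Type*} [AddCommGroup E] [Module 𝕜 E] {k a b : ℕ}

theorem ten_ext {M : Type*} [AddCommGroup M] [Module 𝕜 M] {f g : Ten 𝕜 E k →ₗ[𝕜] M}
    (h : ∀ x, f (PiTensorProduct.tprod 𝕜 x) = g (PiTensorProduct.tprod 𝕜 x)) (w : Ten 𝕜 E k) :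
    f w = g w :=
  LinearMap.congr_fun (PiTensorProduct.ext (MultilinearMap.ext h)) w

theorem ten₂_ext {M : Type*} [AddCommGroup M] [Module 𝕜 M] {f g : Ten₂ 𝕜 E a b →ₗ[𝕜] M}
    (h : ∀ x y, f (PiTensorProduct.tprod 𝕜 x ⊗ₜ PiTensorProduct.tprod 𝕜 y) =
      g (PiTensorProduct.tprod 𝕜 x ⊗ₜ PiTensorProduct.tprod 𝕜 y)) (w : Ten₂ 𝕜 E a b) :
    f w = g w := by
  refine LinearMap.congr_fun (TensorProduct.ext ?_) w
  refine LinearMap.ext fun u => ?_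
  refine ten_ext (f := (TensorProduct.mk 𝕜 _ _).compr₂ f)
    (g := (TensorProduct.mk 𝕜 _ _).compr₂ g) (fun x => ?_) u
  refine LinearMap.ext fun v => ?_
  exact ten_ext (f := (TensorProduct.mk 𝕜 _ _).compr₂ f (PiTensorProduct.tprod 𝕜 x))
    (g := (TensorProduct.mk 𝕜 _ _).compr₂ g (PiTensorProduct.tprod 𝕜 x)) (h x) v

theorem onIndex_tprod (A : Module.End 𝕜 E) (i : Fin k) (x : Fin k → E) :
    onIndex A i (PiTensorProduct.tprod 𝕜 x) =
      PiTensorProduct.tprod 𝕜 (Function.update x i (A (x i))) := by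
  rw [onIndex, PiTensorProduct.map_tprod]
  congr 1
  funext j
  by_cases hj : j = i
  · subst hj; simp
  · simp [hj]

theorem onAll_tprod (S : Module.End 𝕜 E) (x : Fin k → E) :
    onAll k S (PiTensorProduct.tprod 𝕜 x) = PiTensorProduct.tprod 𝕜 fun i => S (x i) := by
  change PiTensorProduct.map (fun _ => S) _ = _
  rw [PiTensorProduct.map_tprod]

theorem act_tmul (S : Module.End 𝕜 E) (u : Ten 𝕜 E a) (v : Ten 𝕜 E b) :
    act a b S (u ⊗ₜ v) = onAll a S u ⊗ₜ onAll b S v := rfl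

theorem onIndex_mul (A B : Module.End 𝕜 E) (i : Fin k) (w : Ten 𝕜 E k) :
    onIndex A i (onIndex B i w) = onIndex (A * B) i w := by
  refine ten_ext (f := onIndex A i ∘ₗ onIndex B i) (g := onIndex (A * B) i) (fun x => ?_) w
  simp [onIndex_tprod]

theorem onIndex_comm (A B : Module.End 𝕜 E) {i j : Fin k} (h : i ≠ j) (w : Ten 𝕜 E k) :
    onIndex A i (onIndex B j w) = onIndex B j (onIndex A i w) := by
  refine ten_ext (f := onIndex A i ∘ₗ onIndex B j) (g := onIndex B j ∘ₗ onIndex A i)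
    (fun x => ?_) w
  simp only [LinearMap.comp_apply, onIndex_tprod]
  rw [Function.update_of_ne h, Function.update_of_ne h.symm, Function.update_comm h]

theorem onIndex_neg_one (i : Fin k) (w : Ten 𝕜 E k) : onIndex (-1 : Module.End 𝕜 E) i w = -w := by
  refine ten_ext (f := onIndex (-1 : Module.End 𝕜 E) i) (g := -LinearMap.id) (fun x => ?_) w
  have := (PiTensorProduct.tprod 𝕜).map_update_neg x i (x i)
  rw [Function.update_eq_self] at this
  rw [onIndex_tprod]
  exact this

/-- The action of permutations of the indexes. -/
def permTen (σ : Equiv.Perm (Fin k)) : Module.End 𝕜 (Ten 𝕜 E k) :=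
  (PiTensorProduct.reindex 𝕜 (fun _ => E) σ).toLinearMap

theorem permTen_tprod (σ : Equiv.Perm (Fin k)) (x : Fin k → E) :
    permTen σ (PiTensorProduct.tprod 𝕜 x) = PiTensorProduct.tprod 𝕜 fun i => x (σ.symm i) :=
  PiTensorProduct.reindex_tprod σ x

theorem isSymmetric_iff {w : Ten 𝕜 E k} : IsSymmetric w ↔ ∀ σ, permTen σ w = w := Iff.rfl

theorem permTen_permTen (σ τ : Equiv.Perm (Fin k)) (w : Ten 𝕜 E k) :
    permTen τ (permTen σ w) = permTen (τ * σ) w := by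
  refine ten_ext (f := permTen τ ∘ₗ permTen σ) (g := permTen (τ * σ)) (fun x => ?_) w
  simp only [LinearMap.comp_apply, permTen_tprod]
  rfl

theorem onIndex_permTen (A : Module.End 𝕜 E) (σ : Equiv.Perm (Fin k)) (i : Fin k)
    (w : Ten 𝕜 E k) : onIndex A i (permTen σ w) = permTen σ (onIndex A (σ.symm i) w) := by
  refine ten_ext (f := onIndex A i ∘ₗ permTen σ) (g := permTen σ ∘ₗ onIndex A (σ.symm i))
    (fun x => ?_) w
  simp only [LinearMap.comp_apply, permTen_tprod, onIndex_tprod]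
  congr 1
  funext j
  by_cases hj : j = i
  · subst hj; simp
  · have : σ.symm j ≠ σ.symm i := fun h => hj (σ.symm.injective h)
    simp [hj]

end Tensors

/-! ### Products of functionals on tensors -/

section Functionals

variable {𝕜 : Type*} [Field 𝕜] [Algebra 𝕜 ℂ] {E : Type*} [AddCommGroup E] [Module 𝕜 E] {k a b : ℕ}

/-- The product of functionals, one for each index. -/
def prodFun (c : Fin k → E →ₗ[𝕜] ℂ) : Ten 𝕜 E k →ₗ[𝕜] ℂ :=
  PiTensorProduct.lift ((MultilinearMap.mkPiAlgebra 𝕜 (Fin k) ℂ).compLinearMap c)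

theorem prodFun_tprod (c : Fin k → E →ₗ[𝕜] ℂ) (x : Fin k → E) :
    prodFun c (PiTensorProduct.tprod 𝕜 x) = ∏ i, c i (x i) := by
  simp [prodFun]

/-- The product of functionals, one for each index of the two groups. -/
def prodFun₂ (c : Fin a → E →ₗ[𝕜] ℂ) (d : Fin b → E →ₗ[𝕜] ℂ) : Ten₂ 𝕜 E a b →ₗ[𝕜] ℂ :=
  LinearMap.mul' 𝕜 ℂ ∘ₗ TensorProduct.map (prodFun c) (prodFun d)

theorem prodFun₂_tmul (c : Fin a → E →ₗ[𝕜] ℂ) (d : Fin b → E →ₗ[𝕜] ℂ) (u : Ten 𝕜 E a)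
    (v : Ten 𝕜 E b) : prodFun₂ c d (u ⊗ₜ v) = prodFun c u * prodFun d v := by
  simp [prodFun₂]

theorem prodFun_onAll (c : Fin k → E →ₗ[𝕜] ℂ) (S : Module.End 𝕜 E) (w : Ten 𝕜 E k) :
    prodFun c (onAll k S w) = prodFun (fun i => c i ∘ₗ S) w := by
  refine ten_ext (f := prodFun c ∘ₗ onAll k S) (fun x => ?_) w
  rw [LinearMap.comp_apply, onAll_tprod, prodFun_tprod, prodFun_tprod]
  rfl

theorem prodFun₂_act (c : Fin a → E →ₗ[𝕜] ℂ) (d : Fin b → E →ₗ[𝕜] ℂ) (S : Module.End 𝕜 E)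
    (w : Ten₂ 𝕜 E a b) :
    prodFun₂ c d (act a b S w) = prodFun₂ (fun i => c i ∘ₗ S) (fun i => d i ∘ₗ S) w := by
  refine ten₂_ext (f := prodFun₂ c d ∘ₗ act a b S) (fun x y => ?_) w
  rw [LinearMap.comp_apply, act_tmul, prodFun₂_tmul, prodFun₂_tmul, prodFun_onAll, prodFun_onAll]

theorem prodFun_permTen (c : Fin k → E →ₗ[𝕜] ℂ) (σ : Equiv.Perm (Fin k)) (w : Ten 𝕜 E k) :
    prodFun c (permTen σ w) = prodFun (c ∘ σ) w := by
  refine ten_ext (f := prodFun c ∘ₗ permTen σ) (fun x => ?_) w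
  rw [LinearMap.comp_apply, permTen_tprod, prodFun_tprod, prodFun_tprod,
    ← Equiv.prod_comp σ]
  simp

theorem prodFun_onIndex {c : Fin k → E →ₗ[𝕜] ℂ} {A : Module.End 𝕜 E} {i : Fin k} {l : ℂ}
    (h : ∀ x, c i (A x) = l * c i x) (w : Ten 𝕜 E k) :
    prodFun c (onIndex A i w) = l * prodFun c w := by
  refine ten_ext (f := prodFun c ∘ₗ onIndex A i) (g := LinearMap.mulLeft 𝕜 l ∘ₗ prodFun c)
    (fun x => ?_) w
  rw [LinearMap.comp_apply, LinearMap.comp_apply, onIndex_tprod, prodFun_tprod, prodFun_tprod,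
    LinearMap.mulLeft_apply]
  have h1 : ∀ j, c j (Function.update x i (A (x i)) j) =
      (if j = i then l else 1) * c j (x j) := by
    intro j
    by_cases hj : j = i
    · subst hj; simp [h]
    · simp [hj]
  simp only [h1, Finset.prod_mul_distrib]
  simp

theorem prodFun₂_sum {ι : Type*} [Fintype ι] (l : Fin a → ι → ℂ) (c : ι → E →ₗ[𝕜] ℂ)
    (l' : Fin b → ι → ℂ) (c' : ι → E →ₗ[𝕜] ℂ) (w : Ten₂ 𝕜 E a b) :
    prodFun₂ (fun i => ∑ m, l i m • c m) (fun j => ∑ m, l' j m • c' m) w =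
      ∑ p : Fin a → ι, ∑ q : Fin b → ι, ((∏ i, l i (p i)) * ∏ j, l' j (q j)) *
        prodFun₂ (fun i => c (p i)) (fun j => c' (q j)) w := by
  classical
  have key : ∀ {n : ℕ} (l : Fin n → ι → ℂ) (c : ι → E →ₗ[𝕜] ℂ) (x : Fin n → E),
      ∏ i, (∑ m, l i m • c m) (x i) =
        ∑ p : Fin n → ι, (∏ i, l i (p i)) * ∏ i, c (p i) (x i) := by
    intro n l c x
    simp only [LinearMap.sum_apply, LinearMap.smul_apply, smul_eq_mul]
    rw [Finset.prod_univ_sum, Fintype.piFinset_univ]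
    simp only [Finset.prod_mul_distrib]
  have := ten₂_ext (f := prodFun₂ (fun i => ∑ m, l i m • c m) (fun j => ∑ m, l' j m • c' m))
    (g := ∑ p : Fin a → ι, ∑ q : Fin b → ι, LinearMap.mulLeft 𝕜 ((∏ i, l i (p i)) *
      ∏ j, l' j (q j)) ∘ₗ prodFun₂ (fun i => c (p i)) (fun j => c' (q j))) (fun x y => ?_) w
  · rw [this]
    simp only [LinearMap.sum_apply, LinearMap.comp_apply, LinearMap.mulLeft_apply]
  · rw [prodFun₂_tmul, prodFun_tprod, prodFun_tprod, key, key, Finset.sum_mul_sum]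
    simp only [LinearMap.sum_apply, LinearMap.comp_apply, LinearMap.mulLeft_apply, prodFun₂_tmul,
      prodFun_tprod]
    refine Finset.sum_congr rfl fun p _ => Finset.sum_congr rfl fun q _ => ?_
    ring

end Functionals

/-! ### Separation of tensors and continuity of the tensor action -/

section Continuity

variable {E : Type*} [AddCommGroup E] [Module ℝ E] [FiniteDimensional ℝ E] {a b : ℕ}

variable (E a b) in
/-- The basis of products of basis vectors. -/
def tenBasis : Module.Basis ((Fin a → Fin (Module.finrank ℝ E)) ×
    (Fin b → Fin (Module.finrank ℝ E))) ℝ (Ten₂ ℝ E a b) :=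
  (Basis.piTensorProduct fun _ => Module.finBasis ℝ E).tensorProduct
    (Basis.piTensorProduct fun _ => Module.finBasis ℝ E)

theorem tenBasis_repr (x : Fin a → E) (y : Fin b → E) (p) :
    (tenBasis E a b).repr (PiTensorProduct.tprod ℝ x ⊗ₜ PiTensorProduct.tprod ℝ y) p =
      (∏ i, (Module.finBasis ℝ E).coord (p.1 i) (x i)) *
        ∏ j, (Module.finBasis ℝ E).coord (p.2 j) (y j) := by
  obtain ⟨p, q⟩ := p
  rw [tenBasis, Module.Basis.tensorProduct_repr_tmul_apply,
    Basis.piTensorProduct_repr_tprod_apply, Basis.piTensorProduct_repr_tprod_apply, smul_eq_mul,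
    mul_comm]
  rfl

theorem eq_zero_of_prodFun₂ {w : Ten₂ ℝ E a b}
    (h : ∀ (c : Fin a → E →ₗ[ℝ] ℂ) (d : Fin b → E →ₗ[ℝ] ℂ), prodFun₂ c d w = 0) : w = 0 := by
  refine (tenBasis E a b).ext_elem fun p => ?_
  have h1 := ten₂_ext
    (f := Complex.ofRealCLM.toLinearMap ∘ₗ (tenBasis E a b).coord p)
    (g := prodFun₂
      (fun i => Complex.ofRealCLM.toLinearMap ∘ₗ (Module.finBasis ℝ E).coord (p.1 i))
      (fun j => Complex.ofRealCLM.toLinearMap ∘ₗ (Module.finBasis ℝ E).coord (p.2 j)))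
    (fun x y => by
      rw [prodFun₂_tmul, prodFun_tprod, prodFun_tprod, LinearMap.comp_apply,
        Module.Basis.coord_apply, tenBasis_repr]
      simp) w
  rw [h] at h1
  have h2 : (tenBasis E a b).coord p w = 0 := Complex.ofReal_eq_zero.1 h1
  simpa using h2

theorem continuous_act {X : Type*} [TopologicalSpace X] {S : X → Module.End ℝ E}
    (hS : ∀ (y : E) (ψ : Module.Dual ℝ E), Continuous fun t => ψ (S t y))
    (w : Ten₂ ℝ E a b) (φ : Module.Dual ℝ (Ten₂ ℝ E a b)) :
    Continuous fun t => φ (act a b (S t) w) := by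
  have hspan : w ∈ Submodule.span ℝ (Set.range (tenBasis E a b)) := by
    rw [Module.Basis.span_eq]; trivial
  induction hspan using Submodule.span_induction with
  | zero => simpa using continuous_const
  | add u v _ _ hu hv =>
    simp only [map_add]
    exact hu.add hv
  | smul c u _ hu =>
    simp only [map_smul]
    exact hu.const_smul c
  | mem x hx =>
    obtain ⟨⟨p, q⟩, rfl⟩ := hx
    have h1 : (tenBasis E a b) (p, q) =
        PiTensorProduct.tprod ℝ (fun i => Module.finBasis ℝ E (p i)) ⊗ₜ
          PiTensorProduct.tprod ℝ (fun i => Module.finBasis ℝ E (q i)) := by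
      simp [tenBasis, Module.Basis.tensorProduct_apply]
    have h2 : ∀ y, φ y = ∑ r, (tenBasis E a b).repr y r * φ (tenBasis E a b r) := by
      intro y
      conv_lhs => rw [← (tenBasis E a b).sum_repr y, map_sum]
      simp
    simp only [h1, act_tmul, onAll_tprod]
    simp_rw [h2 (_ ⊗ₜ _), tenBasis_repr]
    refine continuous_finsetSum _ fun r _ => Continuous.mul (Continuous.mul ?_ ?_)
      continuous_const
    · exact continuous_finsetProd _ fun i _ => hS _ _
    · exact continuous_finsetProd _ fun i _ => hS _ _

end Continuity

/-! ### The spaces `W` -/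

section SpaceW

variable {E : Type*} [AddCommGroup E] [Module ℝ E] {J : Module.End ℝ E} {k a b : ℕ}

theorem onIndex_J_sq (hJ : J * J = -1) (i : Fin k) (w : Ten ℝ E k) :
    onIndex J i (onIndex J i w) = -w := by
  rw [onIndex_mul, hJ, onIndex_neg_one]

theorem symW_onIndex_eq_zero_index (hJ : J * J = -1) {w : Ten ℝ E k} {i₀ : Fin k}
    (hw : ∀ i, onIndex J i₀ (onIndex J i w) = -w) (i : Fin k) :
    onIndex J i w = onIndex J i₀ w := by
  have h := congrArg (onIndex J i₀) (hw i)
  rw [onIndex_J_sq hJ, map_neg] at h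
  exact neg_injective h

/-- As `J² = -1`, the condition `J₁ Jᵢ = -1` amounts to `Jᵢ = J₁`: the space `W_m` carries a single
complex structure, shared by all indexes. -/
theorem symW_onIndex_eq (hJ : J * J = -1) {w : Ten ℝ E k} (hw : w ∈ symW J k) (i j : Fin k) :
    onIndex J i w = onIndex J j w := by
  have hk : 0 < k := i.pos
  rw [symW_onIndex_eq_zero_index hJ (hw.2 hk) i, symW_onIndex_eq_zero_index hJ (hw.2 hk) j]

theorem onIndex_mem_symW (hJ : J * J = -1) {w : Ten ℝ E k} (hw : w ∈ symW J k) (i : Fin k) :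
    onIndex J i w ∈ symW J k := by
  refine ⟨isSymmetric_iff.2 fun σ => ?_, fun hk j => ?_⟩
  · rw [symW_onIndex_eq hJ hw i (σ.symm i), ← onIndex_permTen, isSymmetric_iff.1 hw.1 σ,
      symW_onIndex_eq hJ hw i (σ.symm i)]
  · rw [symW_onIndex_eq hJ hw i j, onIndex_J_sq hJ, map_neg, symW_onIndex_eq hJ hw ⟨0, hk⟩ j]

theorem symSq_le_tensW (J : Module.End ℝ E) (a : ℕ) : symSq J a ≤ tensW J a a := by
  refine Submodule.span_le.2 ?_
  rintro _ ⟨u, hu, v, hv, rfl⟩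
  exact add_mem (Submodule.subset_span ⟨u, hu, v, hv, rfl⟩)
    (Submodule.subset_span ⟨v, hv, u, hu, rfl⟩)

theorem spaceW_self (J : Module.End ℝ E) (a : ℕ) :
    spaceW J a a = (symSq J a).map (projJ J a a) := by
  simp [spaceW]

theorem spaceW_of_ne (J : Module.End ℝ E) (h : a ≠ b) :
    spaceW J a b = (tensW J a b).map (projJ J a b) := by
  simp [spaceW, h]

theorem spaceW_le_map (J : Module.End ℝ E) (a b : ℕ) :
    spaceW J a b ≤ (tensW J a b).map (projJ J a b) := by
  by_cases h : a = b
  · subst h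
    rw [spaceW_self]
    exact Submodule.map_mono (symSq_le_tensW J a)
  · rw [spaceW_of_ne J h]

theorem projJ_tmul (J : Module.End ℝ E) (ha : 0 < a) (hb : 0 < b) (u : Ten ℝ E a)
    (v : Ten ℝ E b) : projJ J a b (u ⊗ₜ v) =
      (1 / 2 : ℝ) • (u ⊗ₜ v + onIndex J ⟨0, ha⟩ u ⊗ₜ onIndex J ⟨0, hb⟩ v) := by
  rw [projJ, dif_pos ⟨ha, hb⟩]
  rfl

theorem projJ_mem_tensW (hJ : J * J = -1) {w : Ten₂ ℝ E a b} (hw : w ∈ tensW J a b) :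
    projJ J a b w ∈ tensW J a b := by
  by_cases h : 0 < a ∧ 0 < b
  · refine (Submodule.span_le (p := (tensW J a b).comap (projJ J a b))).2 ?_ hw
    rintro _ ⟨u, hu, v, hv, rfl⟩
    change projJ J a b (u ⊗ₜ v) ∈ tensW J a b
    rw [projJ_tmul J h.1 h.2]
    exact Submodule.smul_mem _ _ (add_mem (Submodule.subset_span ⟨u, hu, v, hv, rfl⟩)
      (Submodule.subset_span ⟨_, onIndex_mem_symW hJ hu _, _, onIndex_mem_symW hJ hv _, rfl⟩))
  · rw [projJ, dif_neg h]
    exact hw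

theorem spaceW_le_tensW (hJ : J * J = -1) : spaceW J a b ≤ tensW J a b := by
  refine (spaceW_le_map J a b).trans ?_
  rintro _ ⟨w, hw, rfl⟩
  exact projJ_mem_tensW hJ hw

/-! #### Coordinate functionals -/

variable (κ : E ≃ₗ[ℝ] Pauli)

/-- The two coordinates (for `true`) and their conjugates (for `false`). -/
def coordFun (m : Fin 2 × Bool) : E →ₗ[ℝ] ℂ :=
  (if m.2 then LinearMap.id else Complex.conjAe.toLinearMap) ∘ₗ
    (LinearMap.proj m.1 : Pauli →ₗ[ℝ] ℂ) ∘ₗ κ.toLinearMap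

theorem coordFun_true (i : Fin 2) (x : E) : coordFun κ (i, true) x = κ x i := by
  simp [coordFun]

theorem coordFun_false (i : Fin 2) (x : E) : coordFun κ (i, false) x = conj (κ x i) := by
  simp [coordFun]

/-- `i` for the coordinates and `-i` for their conjugates. -/
def typeSign (e : Bool) : ℂ := if e then Complex.I else -Complex.I

theorem typeSign_injective : Function.Injective typeSign := by
  have h : Complex.I ≠ -Complex.I := fun h => Complex.I_ne_zero (self_eq_neg.1 h)
  intro e e' he
  cases e <;> cases e' <;> simp_all [typeSign]

variable {κ}

theorem coordFun_J (hκ : ∀ x, κ (J x) = Complex.I • κ x) (m : Fin 2 × Bool) (x : E) :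
    coordFun κ m (J x) = typeSign m.2 * coordFun κ m x := by
  obtain ⟨i, e⟩ := m
  cases e
  · simp [coordFun_false, hκ, typeSign]
  · simp [coordFun_true, hκ, typeSign]

theorem exists_eq_sum_coordFun (hκ : ∀ x, κ (J x) = Complex.I • κ x) (f : E →ₗ[ℝ] ℂ) :
    ∃ l : Fin 2 × Bool → ℂ, f = ∑ m, l m • coordFun κ m := by
  let e : Fin 2 → E := fun i => κ.symm (Pi.single i 1)
  -- The two cases are the coefficients of the `J`-linear part `(f - i f J) / 2` and of the
  -- `J`-antilinear part `(f + i f J) / 2`.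
  refine ⟨fun m => if m.2 then (f (e m.1) - Complex.I * f (J (e m.1))) / 2
    else (f (e m.1) + Complex.I * f (J (e m.1))) / 2, LinearMap.ext fun x => ?_⟩
  have hx : x = ∑ i, ((κ x i).re • e i + (κ x i).im • J (e i)) := by
    apply κ.injective
    rw [map_sum]
    funext j
    simp only [map_add, map_smul, hκ, e, LinearEquiv.apply_symm_apply, Finset.sum_apply,
      Pi.add_apply, Pi.smul_apply, Fin.sum_univ_two]
    fin_cases j <;> simp [Complex.re_add_im]
  conv_lhs => rw [hx]
  rw [map_sum, LinearMap.sum_apply, Fintype.sum_prod_type]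
  refine Finset.sum_congr rfl fun i _ => ?_
  rw [Fintype.sum_bool]
  simp only [map_add, map_smul, LinearMap.smul_apply, smul_eq_mul, Complex.real_smul,
    coordFun_true, coordFun_false, if_true, Bool.false_eq_true, if_false]
  have h1 : κ x i = (κ x i).re + (κ x i).im * Complex.I := (Complex.re_add_im _).symm
  have h2 : conj (κ x i) = (κ x i).re - (κ x i).im * Complex.I := by
    apply Complex.ext <;> simp
  rw [h2]
  conv_rhs => rw [h1]
  simp only [Complex.add_re, Complex.ofReal_re, Complex.mul_re, Complex.I_re, mul_zero,
    Complex.ofReal_im, Complex.I_im, mul_one, sub_self, add_zero, Complex.add_im, Complex.mul_im,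
    zero_add]
  linear_combination ((κ x i).im * f (J (e i))) * Complex.I_sq

theorem eq_zero_of_coordFun (hκ : ∀ x, κ (J x) = Complex.I • κ x) {w : Ten₂ ℝ E a b}
    (h : ∀ (p : Fin a → Fin 2 × Bool) (q : Fin b → Fin 2 × Bool),
      prodFun₂ (fun i => coordFun κ (p i)) (fun j => coordFun κ (q j)) w = 0) : w = 0 := by
  have : FiniteDimensional ℝ E := κ.symm.finiteDimensional
  refine eq_zero_of_prodFun₂ fun c d => ?_
  choose l hl using fun i => exists_eq_sum_coordFun hκ (c i)
  choose l' hl' using fun j => exists_eq_sum_coordFun hκ (d j)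
  rw [show c = _ from funext hl, show d = _ from funext hl', prodFun₂_sum]
  exact Finset.sum_eq_zero fun p _ => Finset.sum_eq_zero fun q _ => by rw [h, mul_zero]

theorem J_sq_of_equiv (hκ : ∀ x, κ (J x) = Complex.I • κ x) : J * J = -1 := by
  refine LinearMap.ext fun x => κ.injective ?_
  rw [Module.End.mul_apply, hκ, hκ, smul_smul, Complex.I_mul_I]
  simp

/-- `Jᵢ` and `Jⱼ` agree on `u`, but multiply the product functional by `i` and `-i` when the two
indexes carry a coordinate and a conjugate coordinate. -/
theorem prodFun_symW_mixed (hκ : ∀ x, κ (J x) = Complex.I • κ x) {u : Ten ℝ E k}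
    (hu : u ∈ symW J k) {p : Fin k → Fin 2 × Bool} {i j : Fin k} (h : (p i).2 ≠ (p j).2) :
    prodFun (fun i => coordFun κ (p i)) u = 0 := by
  have hi := prodFun_onIndex (c := fun i => coordFun κ (p i)) (i := i) (coordFun_J hκ (p i)) u
  have hj := prodFun_onIndex (c := fun i => coordFun κ (p i)) (i := j) (coordFun_J hκ (p j)) u
  rw [symW_onIndex_eq (J_sq_of_equiv hκ) hu i j, hj] at hi
  by_contra h0
  exact h (typeSign_injective (mul_right_cancel₀ h0 hi)).symm

theorem prodFun_symW_perm {u : Ten ℝ E k} (hu : u ∈ symW J k) (c : Fin k → E →ₗ[ℝ] ℂ)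
    (σ : Equiv.Perm (Fin k)) : prodFun (c ∘ σ) u = prodFun c u := by
  rw [← prodFun_permTen, isSymmetric_iff.1 hu.1]

theorem tensW_induction {f g : Ten₂ ℝ E a b →ₗ[ℝ] ℂ}
    (h : ∀ u ∈ symW J a, ∀ v ∈ symW J b, f (u ⊗ₜ v) = g (u ⊗ₜ v)) {w : Ten₂ ℝ E a b}
    (hw : w ∈ tensW J a b) : f w = g w := by
  refine LinearMap.eqOn_span (f := f) (g := g) ?_ hw
  rintro _ ⟨u, hu, v, hv, rfl⟩
  exact h u hu v hv

theorem prodFun₂_tensW_mixed (hκ : ∀ x, κ (J x) = Complex.I • κ x) {w : Ten₂ ℝ E a b}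
    (hw : w ∈ tensW J a b) {p : Fin a → Fin 2 × Bool} {q : Fin b → Fin 2 × Bool}
    (h : (∃ i j, (p i).2 ≠ (p j).2) ∨ ∃ i j, (q i).2 ≠ (q j).2) :
    prodFun₂ (fun i => coordFun κ (p i)) (fun j => coordFun κ (q j)) w = 0 := by
  refine tensW_induction (g := 0) (fun u hu v hv => ?_) hw
  rw [prodFun₂_tmul, LinearMap.zero_apply]
  rcases h with ⟨i, j, h⟩ | ⟨i, j, h⟩
  · rw [prodFun_symW_mixed hκ hu h, zero_mul]
  · rw [prodFun_symW_mixed hκ hv h, mul_zero]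

/-- The factor is `0` if the two leading indexes are of the same type and `1` if they are of
opposite type: the projection selects linear times antilinear. -/
theorem prodFun₂_projJ (hκ : ∀ x, κ (J x) = Complex.I • κ x) (ha : 0 < a) (hb : 0 < b)
    (p : Fin a → Fin 2 × Bool) (q : Fin b → Fin 2 × Bool) (w : Ten₂ ℝ E a b) :
    prodFun₂ (fun i => coordFun κ (p i)) (fun j => coordFun κ (q j)) (projJ J a b w) =
      (1 + typeSign (p ⟨0, ha⟩).2 * typeSign (q ⟨0, hb⟩).2) / 2 *
        prodFun₂ (fun i => coordFun κ (p i)) (fun j => coordFun κ (q j)) w := by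
  refine ten₂_ext
    (f := prodFun₂ (fun i => coordFun κ (p i)) (fun j => coordFun κ (q j)) ∘ₗ projJ J a b)
    (g := LinearMap.mulLeft ℝ _ ∘ₗ
      prodFun₂ (fun i => coordFun κ (p i)) (fun j => coordFun κ (q j))) (fun x y => ?_) w
  rw [LinearMap.comp_apply, LinearMap.comp_apply, projJ_tmul J ha hb, map_smul, map_add,
    prodFun₂_tmul, prodFun₂_tmul, LinearMap.mulLeft_apply,
    prodFun_onIndex (c := fun i => coordFun κ (p i)) (i := ⟨0, ha⟩) (coordFun_J hκ _),
    prodFun_onIndex (c := fun i => coordFun κ (q i)) (i := ⟨0, hb⟩) (coordFun_J hκ _),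
    Complex.real_smul]
  push_cast
  ring

theorem typeSign_mul_self (e : Bool) : typeSign e * typeSign e = -1 := by
  cases e <;> simp [typeSign]

theorem typeSign_mul_of_ne {e e' : Bool} (h : e ≠ e') : typeSign e * typeSign e' = 1 := by
  cases e <;> cases e' <;> simp_all [typeSign]

theorem prodFun₂_spaceW_eq_types (hκ : ∀ x, κ (J x) = Complex.I • κ x) {w : Ten₂ ℝ E a b}
    (hw : w ∈ spaceW J a b) {p : Fin a → Fin 2 × Bool} {q : Fin b → Fin 2 × Bool}
    {i : Fin a} {j : Fin b} (h : (p i).2 = (q j).2) :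
    prodFun₂ (fun i => coordFun κ (p i)) (fun j => coordFun κ (q j)) w = 0 := by
  have hw' := spaceW_le_tensW (J_sq_of_equiv hκ) hw
  by_cases hmix : (∃ i j, (p i).2 ≠ (p j).2) ∨ ∃ i j, (q i).2 ≠ (q j).2
  · exact prodFun₂_tensW_mixed hκ hw' hmix
  · push Not at hmix
    obtain ⟨y, -, rfl⟩ := spaceW_le_map J a b hw
    rw [prodFun₂_projJ hκ i.pos j.pos, hmix.1 _ i, hmix.2 _ j, h, typeSign_mul_self]
    simp

theorem conj_prodFun₂ (p : Fin a → Fin 2 × Bool) (q : Fin b → Fin 2 × Bool)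
    (w : Ten₂ ℝ E a b) :
    conj (prodFun₂ (fun i => coordFun κ (p i)) (fun j => coordFun κ (q j)) w) =
      prodFun₂ (fun i => coordFun κ ((p i).1, !(p i).2))
        (fun j => coordFun κ ((q j).1, !(q j).2)) w := by
  have h : ∀ (m : Fin 2 × Bool) (x : E),
      conj (coordFun κ m x) = coordFun κ (m.1, !m.2) x := by
    rintro ⟨i, e⟩ x
    cases e <;> simp [coordFun_true, coordFun_false]
  refine ten₂_ext (f := Complex.conjAe.toLinearMap ∘ₗ
    prodFun₂ (fun i => coordFun κ (p i)) (fun j => coordFun κ (q j))) (fun x y => ?_) w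
  rw [LinearMap.comp_apply, prodFun₂_tmul, prodFun₂_tmul, prodFun_tprod, prodFun_tprod,
    prodFun_tprod, prodFun_tprod]
  simp [map_prod, h]

/-- A string of zeros and ones is determined up to permutation by the number of ones. -/
theorem exists_perm_of_sum_eq {p q : Fin k → Fin 2}
    (h : ∑ i, (p i : ℕ) = ∑ i, (q i : ℕ)) : ∃ σ : Equiv.Perm (Fin k), q = p ∘ σ := by
  have hcard : ∀ r : Fin k → Fin 2, Fintype.card {i // r i = 1} = ∑ i, (r i : ℕ) := by
    intro r
    rw [Fintype.card_subtype, Finset.card_filter]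
    refine Finset.sum_congr rfl fun i _ => ?_
    generalize r i = x
    fin_cases x <;> simp
  let e : {i // q i = 1} ≃ {i // p i = 1} :=
    Fintype.equivOfCardEq (by rw [hcard, hcard, h])
  have two : ∀ x : Fin 2, x ≠ 1 → x = 0 := by decide
  refine ⟨e.extendSubtype, funext fun i => ?_⟩
  by_cases hi : q i = 1
  · rw [hi]
    exact (e.extendSubtype_mem i hi).symm
  · rw [two _ hi]
    exact (two _ (e.extendSubtype_not_mem i hi)).symm

variable (κ) in
/-- The highest weight functional on tensors. -/
def topFun (a b : ℕ) : Ten₂ ℝ E a b →ₗ[ℝ] ℂ :=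
  prodFun₂ (fun _ => coordFun κ (0, true)) (fun _ => coordFun κ (0, false))

theorem topFun_projJ (hκ : ∀ x, κ (J x) = Complex.I • κ x) (w : Ten₂ ℝ E a b) :
    topFun κ a b (projJ J a b w) = topFun κ a b w := by
  by_cases h : 0 < a ∧ 0 < b
  · rw [topFun, prodFun₂_projJ hκ h.1 h.2 (fun _ => (0, true)) (fun _ => (0, false)),
      typeSign_mul_of_ne (by simp)]
    norm_num
  · rw [projJ, dif_neg h]
    rfl

/-- The first coordinate of `upper z` applied to `p` is `p 0 + z * p 1`. Multiplying out, the
exponents of `z` and `conj z` count the indexes equal to `1` in each group. -/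
theorem topFun_upper {S : ℂ → Module.End ℝ E}
    (hS : ∀ z x, κ (S z x) = (upper z).1 *ᵥ κ x) (z : ℂ) (w : Ten₂ ℝ E a b) :
    topFun κ a b (act a b (S z) w) =
      ∑ p : Fin a → Fin 2, ∑ q : Fin b → Fin 2,
        (z ^ (∑ i, (p i : ℕ)) * conj z ^ (∑ j, (q j : ℕ))) *
          prodFun₂ (fun i => coordFun κ (p i, true)) (fun j => coordFun κ (q j, false)) w := by
  have h1 : coordFun κ (0, true) ∘ₗ S z = ∑ m : Fin 2, z ^ (m : ℕ) • coordFun κ (m, true) := by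
    refine LinearMap.ext fun x => ?_
    simp [coordFun_true, hS, upper_val, Fin.sum_univ_two, Matrix.mulVec, dotProduct]
  have h2 : coordFun κ (0, false) ∘ₗ S z =
      ∑ m : Fin 2, conj z ^ (m : ℕ) • coordFun κ (m, false) := by
    refine LinearMap.ext fun x => ?_
    simp [coordFun_false, hS, upper_val, Fin.sum_univ_two, Matrix.mulVec, dotProduct]
  rw [topFun, prodFun₂_act, h1, h2]
  rw [prodFun₂_sum (fun _ (m : Fin 2) => z ^ (m : ℕ)) (fun m => coordFun κ (m, true))
    (fun _ (m : Fin 2) => conj z ^ (m : ℕ)) (fun m => coordFun κ (m, false))]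
  simp only [Finset.prod_pow_eq_pow_sum]

/-- Elements of `W_(m,n)` are determined by the highest weight functional on the orbit of the upper
unipotent group. -/
theorem spaceW_separating (hκ : ∀ x, κ (J x) = Complex.I • κ x) {S : ℂ → Module.End ℝ E}
    (hS : ∀ z x, κ (S z x) = (upper z).1 *ᵥ κ x) {w : Ten₂ ℝ E a b} (hw : w ∈ spaceW J a b)
    (h : ∀ z, topFun κ a b (act a b (S z) w) = 0) : w = 0 := by
  classical
  have hw' := spaceW_le_tensW (J_sq_of_equiv hκ) hw
  let B : (Fin a → Fin 2) → (Fin b → Fin 2) → ℂ := fun p q =>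
    prodFun₂ (fun i => coordFun κ (p i, true)) (fun j => coordFun κ (q j, false)) w
  have hperm : ∀ p q (σ : Equiv.Perm (Fin a)) (τ : Equiv.Perm (Fin b)),
      B (p ∘ σ) (q ∘ τ) = B p q := by
    intro p q σ τ
    refine tensW_induction (fun u hu v hv => ?_) hw'
    rw [prodFun₂_tmul, prodFun₂_tmul]
    congr 1
    · exact prodFun_symW_perm hu (fun i => coordFun κ (p i, true)) σ
    · exact prodFun_symW_perm hv (fun i => coordFun κ (q i, false)) τ
  have hle : ∀ {n : ℕ} (p : Fin n → Fin 2), ∑ i, (p i : ℕ) < n + 1 := by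
    intro n p
    have : ∑ i, (p i : ℕ) ≤ ∑ _i : Fin n, 1 := Finset.sum_le_sum fun i _ => by omega
    simp at this
    omega
  have hB : ∀ p q, B p q = 0 := by
    intro p q
    have hzero : ∀ z : ℂ, ∑ i ∈ Finset.range (a + 1), ∑ j ∈ Finset.range (b + 1),
        (∑ p' with ∑ i, ((p' : Fin a → Fin 2) i : ℕ) = i,
          ∑ q' with ∑ i, ((q' : Fin b → Fin 2) i : ℕ) = j, B p' q') *
            (z ^ i * conj z ^ j) = 0 := by
      intro z
      rw [← h z, topFun_upper hS]
      rw [← Finset.sum_fiberwise_of_maps_to (s := Finset.univ) (t := Finset.range (a + 1))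
        (g := fun p : Fin a → Fin 2 => ∑ i, (p i : ℕ)) fun p _ => Finset.mem_range.2 (hle p)]
      refine Finset.sum_congr rfl fun i _ => ?_
      simp only [Finset.sum_mul]
      rw [Finset.sum_comm]
      refine Finset.sum_congr rfl fun p' hp' => ?_
      rw [← Finset.sum_fiberwise_of_maps_to (s := Finset.univ) (t := Finset.range (b + 1))
        (g := fun p : Fin b → Fin 2 => ∑ i, (p i : ℕ)) fun p _ => Finset.mem_range.2 (hle p)]
      refine Finset.sum_congr rfl fun j _ => Finset.sum_congr rfl fun q' hq' => ?_
      rw [(Finset.mem_filter.1 hp').2, (Finset.mem_filter.1 hq').2, mul_comm]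
    have hc := coeff_eq_zero_of_sum_eq_zero (c := fun i j =>
      ∑ p' with ∑ i', ((p' : Fin a → Fin 2) i' : ℕ) = i,
          ∑ q' with ∑ i', ((q' : Fin b → Fin 2) i' : ℕ) = j, B p' q') hzero (hle p) (hle q)
    -- By symmetry all terms with the same numbers of ones are equal, so the coefficient of `z ^ i *
    -- conj z ^ j` is a positive integer times `B p q`.
    have hconst : ∀ p' ∈ Finset.univ.filter (fun p' : Fin a → Fin 2 =>
        ∑ i, (p' i : ℕ) = ∑ i, (p i : ℕ)), ∑ q' with ∑ i', ((q' : Fin b → Fin 2) i' : ℕ) =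
          ∑ i, (q i : ℕ), B p' q' = ∑ q' with ∑ i', ((q' : Fin b → Fin 2) i' : ℕ) =
          ∑ i, (q i : ℕ), B p q := by
      intro p' hp'
      refine Finset.sum_congr rfl fun q' hq' => ?_
      obtain ⟨σ, rfl⟩ := exists_perm_of_sum_eq (Finset.mem_filter.1 hp').2.symm
      obtain ⟨τ, rfl⟩ := exists_perm_of_sum_eq (Finset.mem_filter.1 hq').2.symm
      exact hperm p q σ τ
    simp only [Finset.sum_congr rfl hconst, Finset.sum_const, nsmul_eq_mul, mul_eq_zero,
      Nat.cast_eq_zero, Finset.card_eq_zero] at hc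
    rcases hc with hc | hc | hc
    · exact absurd hc (Finset.Nonempty.ne_empty ⟨p, by simp⟩)
    · exact absurd hc (Finset.Nonempty.ne_empty ⟨q, by simp⟩)
    · exact hc
  -- Mixed types within a group vanish on `W_m ⊗ W_n`, and equal types across the groups are removed
  -- by the projection. What is left is linear on one group and antilinear on the other.
  refine eq_zero_of_coordFun hκ fun p q => ?_
  by_cases hmix : (∃ i j, (p i).2 ≠ (p j).2) ∨ ∃ i j, (q i).2 ≠ (q j).2
  · exact prodFun₂_tensW_mixed hκ hw' hmix
  by_cases heq : ∃ i j, (p i).2 = (q j).2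
  · obtain ⟨i, j, hij⟩ := heq
    exact prodFun₂_spaceW_eq_types hκ hw hij
  push Not at hmix heq
  have hex : ∃ e : Bool, (∀ i, (p i).2 = e) ∧ ∀ j, (q j).2 = !e := by
    rcases Nat.eq_zero_or_pos a with rfl | ha
    · rcases Nat.eq_zero_or_pos b with rfl | hb
      · exact ⟨true, fun i => i.elim0, fun j => j.elim0⟩
      · exact ⟨!(q ⟨0, hb⟩).2, fun i => i.elim0, fun j => by
          rw [Bool.not_not]; exact hmix.2 _ _⟩
    · refine ⟨(p ⟨0, ha⟩).2, fun i => hmix.1 _ _, fun j => ?_⟩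
      exact Bool.eq_not.2 (heq ⟨0, ha⟩ j).symm
  obtain ⟨e, hp, hq⟩ := hex
  cases e with
  | true =>
    have h1 : p = fun i => ((p i).1, true) := funext fun i => Prod.ext rfl (hp i)
    have h2 : q = fun i => ((q i).1, false) := funext fun i => Prod.ext rfl (hq i)
    rw [h1, h2]
    exact hB _ _
  | false =>
    -- The antilinear-linear coordinates are the conjugates of the linear-antilinear ones, since the
    -- tensor is real.
    rw [← map_eq_zero_iff (starRingEnd ℂ) (RingHom.injective _), conj_prodFun₂]
    simp only [hp, hq]
    exact hB _ _

end SpaceW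

/-! ### Nonvanishing and reality of the highest weight functional -/

section Existence

variable {E : Type*} [AddCommGroup E] [Module ℝ E] {J : Module.End ℝ E} {k a b : ℕ}
  {κ : E ≃ₗ[ℝ] Pauli}

theorem onIndex_J_comm (J : Module.End ℝ E) (i j : Fin k) (w : Ten ℝ E k) :
    onIndex J i (onIndex J j w) = onIndex J j (onIndex J i w) := by
  by_cases h : i = j
  · rw [h]
  · exact onIndex_comm J J h w

/-- There are tensors on which `J` acts in the same way on all indexes. -/
theorem exists_onIndex_J_eq (hκ : ∀ x, κ (J x) = Complex.I • κ x) (hk : 0 < k)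
    (A : Finset (Fin k)) : ∃ w : Ten ℝ E k,
      (∀ i ∈ A, onIndex J ⟨0, hk⟩ (onIndex J i w) = -w) ∧
      prodFun (fun _ => coordFun κ (0, true)) w = 1 := by
  have hJ := J_sq_of_equiv hκ
  have hP : ∀ i (w : Ten ℝ E k), prodFun (fun _ => coordFun κ (0, true)) (onIndex J i w) =
      Complex.I * prodFun (fun _ => coordFun κ (0, true)) w := fun i w =>
    prodFun_onIndex (c := fun _ => coordFun κ (0, true)) (coordFun_J hκ _) w
  induction A using Finset.induction_on with
  | empty =>
    refine ⟨PiTensorProduct.tprod ℝ fun _ => κ.symm (Pi.single 0 1), by simp, ?_⟩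
    simp [prodFun_tprod, coordFun_true]
  | insert i A _ ih =>
    obtain ⟨w, hw, hw1⟩ := ih
    have hsq : onIndex J ⟨0, hk⟩ (onIndex J i (onIndex J ⟨0, hk⟩ (onIndex J i w))) = w := by
      rw [onIndex_J_comm J i, onIndex_J_sq hJ, onIndex_J_sq hJ, neg_neg]
    -- This is the projection `(1 - J₁ Jᵢ) / 2`. It commutes with the conditions already obtained,
    -- and keeps the value `1` because `J₁ Jᵢ` acts on the functional as `i² = -1`.
    refine ⟨(1 / 2 : ℝ) • (w - onIndex J ⟨0, hk⟩ (onIndex J i w)), fun j hj => ?_, ?_⟩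
    · rcases Finset.mem_insert.1 hj with rfl | hj
      · rw [map_smul, map_smul, map_sub, map_sub, hsq, ← smul_neg, neg_sub]
      · have h1 : onIndex J ⟨0, hk⟩ (onIndex J j (onIndex J ⟨0, hk⟩ (onIndex J i w))) =
            -onIndex J ⟨0, hk⟩ (onIndex J i w) := by
          rw [onIndex_J_comm J j ⟨0, hk⟩, onIndex_J_comm J j i, onIndex_J_comm J ⟨0, hk⟩ i, hw j hj,
            map_neg, map_neg]
        rw [map_smul, map_smul, map_sub, map_sub, hw j hj, h1, ← smul_neg]
        congr 1
        abel
    · rw [map_smul, map_sub, hP, hP, hw1, ← mul_assoc, Complex.I_mul_I, Complex.real_smul]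
      norm_num

/-- Averaging over permutations preserves the conditions on `J`, which treat all pairs of indexes
alike, and the value of a functional that is the same on every index. -/
theorem exists_mem_symW (hκ : ∀ x, κ (J x) = Complex.I • κ x) (k : ℕ) :
    ∃ w ∈ symW J k, prodFun (fun _ => coordFun κ (0, true)) w = 1 := by
  have hJ := J_sq_of_equiv hκ
  obtain ⟨w, hw, hw1⟩ : ∃ w : Ten ℝ E k,
      (∀ i j, onIndex J i (onIndex J j w) = -w) ∧
      prodFun (fun _ => coordFun κ (0, true)) w = 1 := by
    rcases Nat.eq_zero_or_pos k with rfl | hk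
    · exact ⟨PiTensorProduct.tprod ℝ fun _ => 0, fun i => i.elim0, by simp [prodFun_tprod]⟩
    · obtain ⟨w, hw, hw1⟩ := exists_onIndex_J_eq hκ hk Finset.univ
      refine ⟨w, fun i j => ?_, hw1⟩
      have h := fun i => symW_onIndex_eq_zero_index hJ (fun i => hw i (Finset.mem_univ _)) i
      rw [h j, onIndex_J_comm, h i, onIndex_J_sq hJ]
  refine ⟨((k.factorial : ℝ)⁻¹) • ∑ σ, permTen σ w, ⟨isSymmetric_iff.2 fun τ => ?_,
    fun hk i => ?_⟩, ?_⟩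
  · rw [map_smul, map_sum]
    simp only [permTen_permTen]
    rw [Fintype.sum_equiv (Equiv.mulLeft τ) (fun σ => permTen (τ * σ) w) (fun σ => permTen σ w)
      fun σ => rfl]
  · rw [map_smul, map_smul, map_sum, map_sum, ← smul_neg, ← Finset.sum_neg_distrib]
    congr 1
    refine Finset.sum_congr rfl fun σ _ => ?_
    rw [onIndex_permTen, onIndex_permTen, hw, map_neg]
  · rw [map_smul, map_sum]
    have h1 : ∀ σ : Equiv.Perm (Fin k), prodFun (fun _ => coordFun κ (0, true)) (permTen σ w) = 1 :=
      fun σ => by rw [prodFun_permTen]; exact hw1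
    simp only [h1, Finset.sum_const, Finset.card_univ, Fintype.card_perm, Fintype.card_fin]
    rw [Complex.real_smul, nsmul_eq_mul, mul_one]
    push_cast
    exact inv_mul_cancel₀ (by exact_mod_cast k.factorial_ne_zero)

theorem prodFun_conj (w : Ten ℝ E k) : prodFun (fun _ => coordFun κ (0, false)) w =
    conj (prodFun (fun _ => coordFun κ (0, true)) w) := by
  refine ten_ext (g := Complex.conjAe.toLinearMap ∘ₗ prodFun (fun _ => coordFun κ (0, true)))
    (fun x => ?_) w
  rw [LinearMap.comp_apply, prodFun_tprod, prodFun_tprod]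
  simp [coordFun_true, coordFun_false]

theorem topFun_tmul (u : Ten ℝ E a) (v : Ten ℝ E b) : topFun κ a b (u ⊗ₜ v) =
    prodFun (fun _ => coordFun κ (0, true)) u *
      conj (prodFun (fun _ => coordFun κ (0, true)) v) := by
  rw [topFun, prodFun₂_tmul, prodFun_conj]

theorem exists_mem_spaceW (hκ : ∀ x, κ (J x) = Complex.I • κ x) (a b : ℕ) :
    ∃ w ∈ spaceW J a b, topFun κ a b w ≠ 0 := by
  obtain ⟨u, hu, hu1⟩ := exists_mem_symW hκ a
  obtain ⟨v, hv, hv1⟩ := exists_mem_symW hκ b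
  by_cases h : a = b
  · subst h
    refine ⟨projJ J a a (u ⊗ₜ u + u ⊗ₜ u), ?_, ?_⟩
    · rw [spaceW_self]
      exact Submodule.mem_map_of_mem (Submodule.subset_span ⟨u, hu, u, hu, rfl⟩)
    · rw [topFun_projJ hκ, map_add, topFun_tmul, hu1]
      norm_num
  · refine ⟨projJ J a b (u ⊗ₜ v), ?_, ?_⟩
    · rw [spaceW_of_ne J h]
      exact Submodule.mem_map_of_mem (Submodule.subset_span ⟨u, hu, v, hv, rfl⟩)
    · rw [topFun_projJ hκ, topFun_tmul, hu1, hv1]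
      norm_num

/-- On `u ⊗ v + v ⊗ u` the functional is a complex number plus its conjugate. This is why `W_(m,m)`
is built from the symmetric square: on all of `W_m ⊗ W_m` it would take nonreal values when `u` and
`v` have values with different phases. -/
theorem realProj_topFun (hκ : ∀ x, κ (J x) = Complex.I • κ x) {w : Ten₂ ℝ E a b}
    (hw : w ∈ spaceW J a b) : realProj a b (topFun κ a b w) = topFun κ a b w := by
  by_cases h : a = b
  · subst h
    rw [spaceW_self] at hw
    obtain ⟨y, hy, rfl⟩ := hw
    rw [topFun_projJ hκ]
    refine LinearMap.eqOn_span (f := realProj a a ∘ₗ topFun κ a a) (g := topFun κ a a) ?_ hy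
    rintro _ ⟨u, hu, v, hv, rfl⟩
    rw [LinearMap.comp_apply, map_add, topFun_tmul, topFun_tmul, realProj_self]
    apply Complex.ext
    · simp
    · simp
      ring
  · rw [realProj_of_ne h]

end Existence

/-! ### The spaces `W_(m,n)` as models, and the classification -/

namespace MajoranaSystem.PauliIso

variable {D : MajoranaSystem} (s : D.PauliIso)

theorem symm_maj5 (x : D.Pinor) :
    s.toEquiv.symm (D.maj5 x) = Complex.I • s.toEquiv.symm x := by
  rw [LinearEquiv.symm_apply_eq, s.map_I, LinearEquiv.apply_symm_apply]

theorem symm_spin (T : SL(2, ℂ)) (x : D.Pinor) :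
    s.toEquiv.symm (s.spin T x) = T.1 *ᵥ s.toEquiv.symm x := by
  simp [spin]

/-- The highest weight functional on `W_(m,n)`. -/
def topW (a b : ℕ) : WSpace D.maj5 a b →ₗ[ℝ] ℂ :=
  topFun s.toEquiv.symm a b ∘ₗ WSpace.incl D.maj5 a b

theorem incl_repW (a b : ℕ) (T : SL(2, ℂ)) (w : WSpace D.maj5 a b) :
    WSpace.incl D.maj5 a b (s.repW a b T w) = act a b (s.spin T) (WSpace.incl D.maj5 a b w) := rfl

theorem finiteDimensional_pinor (s : D.PauliIso) : FiniteDimensional ℝ D.Pinor :=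
  s.toEquiv.finiteDimensional

theorem continuous_spin (y : D.Pinor) (ψ : Module.Dual ℝ D.Pinor) :
    Continuous fun T => ψ (s.spin T y) := by
  have h : ∀ T, ψ (s.spin T y) = (ψ ∘ₗ s.toEquiv.toLinearMap) (T.1 *ᵥ s.toEquiv.symm y) := by
    intro T
    rw [LinearMap.comp_apply, ← symm_spin]
    simp
  simp only [h]
  refine (LinearMap.continuous_of_finiteDimensional (ψ ∘ₗ s.toEquiv.toLinearMap)).comp ?_
  exact Continuous.matrix_mulVec continuous_subtype_val continuous_const

/-- The first rows of `lower z` and `torus t` are `(1, 0)` and `(t, 0)`. The first Pauli coordinate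
is thus invariant under the former and scaled by `t` under the latter, and each of the `a + b`
indexes contributes one factor to the weight. -/
theorem isModel_repW (a b : ℕ) : IsModel (s.repW a b) (s.topW a b) a b := by
  have hfin := s.finiteDimensional_pinor
  have hκ := s.symm_maj5
  obtain ⟨w, hw, hw0⟩ := exists_mem_spaceW hκ a b
  refine ⟨?_, ?_, fun v φ => ?_, ⟨fun z v => ?_, fun t v => ?_⟩, fun v hv => ?_, fun v => ?_⟩
  · exact inferInstanceAs (FiniteDimensional ℝ (spaceW D.maj5 a b))
  · refine ⟨⟨(⟨w, hw⟩ : spaceW D.maj5 a b), 0, fun h0 => hw0 ?_⟩⟩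
    rw [show w = 0 from congrArg (WSpace.incl D.maj5 a b) h0, map_zero]
  · obtain ⟨ψ, rfl⟩ := LinearMap.exists_extend (p := spaceW D.maj5 a b) φ
    exact continuous_act s.continuous_spin (WSpace.incl D.maj5 a b v) ψ
  · rw [topW, LinearMap.comp_apply, LinearMap.comp_apply, incl_repW, topFun, prodFun₂_act]
    have h1 : coordFun s.toEquiv.symm (0, true) ∘ₗ s.spin (lower z) =
        coordFun s.toEquiv.symm (0, true) := LinearMap.ext fun x => by
      simp [coordFun_true, symm_spin, lower_val, Matrix.mulVec, dotProduct]
    have h2 : coordFun s.toEquiv.symm (0, false) ∘ₗ s.spin (lower z) =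
        coordFun s.toEquiv.symm (0, false) := LinearMap.ext fun x => by
      simp [coordFun_false, symm_spin, lower_val, Matrix.mulVec, dotProduct]
    rw [h1, h2]
  · rw [topW, LinearMap.comp_apply, LinearMap.comp_apply, incl_repW, topFun, prodFun₂_act,
      zmon_natCast]
    have h1 : coordFun s.toEquiv.symm (0, true) ∘ₗ s.spin (torus t) =
        ∑ _m : Unit, (t : ℂ) • coordFun s.toEquiv.symm (0, true) := LinearMap.ext fun x => by
      simp [coordFun_true, symm_spin, torus_val, Matrix.mulVec, dotProduct]
    have h2 : coordFun s.toEquiv.symm (0, false) ∘ₗ s.spin (torus t) =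
        ∑ _m : Unit, conj (t : ℂ) • coordFun s.toEquiv.symm (0, false) :=
      LinearMap.ext fun x => by
        simp [coordFun_false, symm_spin, torus_val, Matrix.mulVec, dotProduct]
    rw [h1, h2, prodFun₂_sum (fun _ _ => (t : ℂ)) (fun _ => coordFun s.toEquiv.symm (0, true))
      (fun _ _ => conj (t : ℂ)) (fun _ => coordFun s.toEquiv.symm (0, false))]
    simp
  · have := spaceW_separating hκ (S := fun z => s.spin (upper z))
      (fun z x => s.symm_spin (upper z) x) v.2 hv
    exact Subtype.ext this
  · exact realProj_topFun hκ v.2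

theorem exists_equiv_repW {V : Type*} [AddCommGroup V] [Module ℝ V] [FiniteDimensional ℝ V]
    (ρ : Representation ℝ SL(2, ℂ) V) (hρ : IsContinuousRep ρ) (hirr : ρ.IsIrreducible) :
    ∃ a b : ℕ, b ≤ a ∧ Nonempty (ρ.Equiv (s.repW a b)) := by
  have hnt : Nontrivial V := by
    by_contra hn
    rw [not_nontrivial_iff_subsingleton] at hn
    refine absurd ?_ (bot_ne_top (α := Subrepresentation ρ))
    exact Subrepresentation.toSubmodule_injective (Subsingleton.elim _ _)
  obtain ⟨ξ, a, b, hξ, hh⟩ := hρ.exists_isHighest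
  rcases lt_trichotomy a b with hab | rfl | hab
  -- On a real space the conjugate of a highest weight functional is again one, with the two
  -- exponents exchanged.
  · refine ⟨b, a, hab.le, (s.isModel_repW b a).nonempty_equiv hρ hirr
      (ξ' := Complex.conjAe.toLinearMap ∘ₗ ξ) (fun h0 => hξ (LinearMap.ext fun v => ?_)) ?_ ?_⟩
    · have := LinearMap.congr_fun h0 v
      simpa using this
    · refine ⟨fun z v => ?_, fun w v => ?_⟩
      · rw [LinearMap.comp_apply, hh.lower_apply]; rfl
      · rw [LinearMap.comp_apply, hh.torus_apply, zmon_natCast, zmon_natCast]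
        change conj ((w : ℂ) ^ a * conj (w : ℂ) ^ b * ξ v) = _ * conj (ξ v)
        rw [map_mul, map_mul, map_pow, map_pow, Complex.conj_conj]
        ring
    · exact fun v => realProj_of_ne hab.ne' _
  -- For `a = b` the character is real, so the real and imaginary parts of `ξ` are themselves
  -- highest weight functionals, and one of them is nonzero.
  · have key : ∀ L : ℂ →ₗ[ℝ] ℝ, (∀ (x : ℝ) (y : ℂ), L (x * y) = x * L y) → L ∘ₗ ξ ≠ 0 →
        Nonempty (ρ.Equiv (s.repW a a)) := by
      intro L hL h0
      refine (s.isModel_repW a a).nonempty_equiv hρ hirr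
        (ξ' := Complex.ofRealCLM.toLinearMap ∘ₗ L ∘ₗ ξ) (fun h1 => h0 (LinearMap.ext fun v => ?_))
        ⟨fun z v => ?_, fun w v => ?_⟩ fun v => ?_
      · exact Complex.ofReal_eq_zero.1 (LinearMap.congr_fun h1 v)
      · rw [LinearMap.comp_apply, LinearMap.comp_apply, hh.lower_apply]; rfl
      · rw [LinearMap.comp_apply, LinearMap.comp_apply, hh.torus_apply, zmon_natCast, ← mul_pow,
          Complex.mul_conj, ← Complex.ofReal_pow, hL]
        simp
      · rw [realProj_self]; simp
    refine ⟨a, a, le_rfl, ?_⟩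
    by_cases hre : Complex.reLm ∘ₗ ξ = 0
    · refine key Complex.imLm (by simp) fun him => hξ (LinearMap.ext fun v => ?_)
      exact Complex.ext (LinearMap.congr_fun hre v) (LinearMap.congr_fun him v)
    · exact key Complex.reLm (by simp) hre
  · exact ⟨a, b, hab.le, (s.isModel_repW a b).nonempty_equiv hρ hirr hξ hh
      fun v => realProj_of_ne hab.ne' _⟩

theorem nonempty_equiv_trivial :
    Nonempty ((s.repW 0 0).Equiv (Representation.trivial ℝ SL(2, ℂ) ℝ)) := by
  have hirr : (Representation.trivial ℝ SL(2, ℂ) ℝ).IsIrreducible := by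
    have hnt : Nontrivial (Subrepresentation (Representation.trivial ℝ SL(2, ℂ) ℝ)) := by
      refine ⟨⟨⊥, ⊤, fun h0 => ?_⟩⟩
      have h1 : (⊥ : Submodule ℝ ℝ) = ⊤ := congrArg Subrepresentation.toSubmodule h0
      exact bot_ne_top h1
    refine { toNontrivial := hnt, eq_bot_or_eq_top := fun U => ?_ }
    rcases eq_bot_or_eq_top U.toSubmodule with h | h
    · exact Or.inl (Subrepresentation.toSubmodule_injective h)
    · exact Or.inr (Subrepresentation.toSubmodule_injective h)
  obtain ⟨e⟩ := (s.isModel_repW 0 0).nonempty_equiv (ρ' := Representation.trivial ℝ SL(2, ℂ) ℝ)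
    (fun v φ => by simpa using continuous_const) hirr
    (ξ' := Complex.ofRealCLM.toLinearMap) (fun h0 => by
      have := LinearMap.congr_fun h0 1
      simp at this)
    ⟨fun z v => by simp, fun w v => by simp [zmon_apply]⟩ (fun v => by simp [realProj_self])
  exact ⟨e.symm⟩

end MajoranaSystem.PauliIso

/-! ### Clifford relations -/

theorem eta_zero : eta 0 0 = 1 := by simp [eta]

theorem eta_of_ne {μ ν : Fin 4} (h : μ ≠ ν) : eta μ ν = 0 := by simp [eta, h]

theorem eta_of_ne_zero {μ : Fin 4} (h : μ ≠ 0) : eta μ μ = -1 := by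
  fin_cases μ <;> simp_all [eta]

theorem eta_mul_eta : eta * eta = 1 := by
  rw [eta, Matrix.diagonal_mul_diagonal, ← Matrix.diagonal_one]
  congr 1
  funext i
  fin_cases i <;> simp

theorem eta_mul_self (μ : Fin 4) : eta μ μ * eta μ μ = 1 := by
  fin_cases μ <;> simp [eta]

/-- The Clifford relations of the Majorana matrices. -/
def IsClifford {R : Type*} [Ring R] [Algebra ℝ R] (f : Fin 4 → R) : Prop :=
  ∀ μ ν, f μ * f ν + f ν * f μ = (-2 * eta μ ν) • (1 : R)

namespace IsClifford

variable {R : Type*} [Ring R] [Algebra ℝ R] {f : Fin 4 → R} (h : IsClifford f)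
include h

theorem sq (μ : Fin 4) : f μ * f μ = (-eta μ μ) • (1 : R) := by
  have h1 := h μ μ
  rw [← two_smul ℝ, neg_mul, ← mul_neg, mul_smul] at h1
  exact smul_right_injective R (two_ne_zero (α := ℝ)) h1

theorem sq_zero : f 0 * f 0 = -1 := by rw [h.sq, eta_zero]; simp

theorem sq_of_ne_zero {μ : Fin 4} (hμ : μ ≠ 0) : f μ * f μ = 1 := by
  rw [h.sq, eta_of_ne_zero hμ]; simp

theorem anticomm {μ ν : Fin 4} (hne : μ ≠ ν) : f μ * f ν = -(f ν * f μ) := by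
  have h1 := h μ ν
  rw [eta_of_ne hne, mul_zero, zero_smul] at h1
  exact eq_neg_of_add_eq_zero_left h1

theorem anticomm_assoc {μ ν : Fin 4} (hne : μ ≠ ν) (x : R) :
    f μ * (f ν * x) = -(f ν * (f μ * x)) := by
  rw [← mul_assoc, h.anticomm hne, neg_mul, mul_assoc]

theorem sq_assoc (μ : Fin 4) (x : R) : f μ * (f μ * x) = (-eta μ μ) • x := by
  rw [← mul_assoc, h.sq, smul_mul_assoc, one_mul]

/-- The product of the four generators anticommutes with each of them. -/
theorem prod_anticomm (μ : Fin 4) :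
    f μ * (f 0 * f 1 * f 2 * f 3) = -(f 0 * f 1 * f 2 * f 3 * f μ) := by
  have r30 := h.anticomm (μ := 3) (ν := 0) (by decide)
  have r31 := h.anticomm (μ := 3) (ν := 1) (by decide)
  have r32 := h.anticomm (μ := 3) (ν := 2) (by decide)
  have s10 := h.anticomm_assoc (μ := 1) (ν := 0) (by decide)
  have s20 := h.anticomm_assoc (μ := 2) (ν := 0) (by decide)
  have s30 := h.anticomm_assoc (μ := 3) (ν := 0) (by decide)
  have s21 := h.anticomm_assoc (μ := 2) (ν := 1) (by decide)
  have s31 := h.anticomm_assoc (μ := 3) (ν := 1) (by decide)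
  have s32 := h.anticomm_assoc (μ := 3) (ν := 2) (by decide)
  fin_cases μ <;>
    simp [mul_assoc, r30, r31, r32, s10, s20, s30, s21, s31, s32, h.sq, h.sq_assoc]

theorem prod_sq : f 0 * f 1 * f 2 * f 3 * (f 0 * f 1 * f 2 * f 3) = -1 := by
  rw [mul_assoc (f 0 * f 1 * f 2) (f 3), h.prod_anticomm]
  have h1 : f 0 * f 1 * f 2 * -(f 0 * f 1 * f 2 * f 3 * f 3) =
      -(f 0 * (f 1 * (f 2 * (f 0 * (f 1 * (f 2 * (f 3 * f 3))))))) := by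
    simp only [mul_assoc, mul_neg]
  rw [h1, h.sq_of_ne_zero (by decide), mul_one,
    h.anticomm_assoc (μ := 2) (ν := 0) (by decide), h.anticomm_assoc (μ := 2) (ν := 1) (by decide),
    h.sq_of_ne_zero (by decide), mul_one]
  simp only [mul_neg, neg_neg]
  rw [h.anticomm_assoc (μ := 1) (ν := 0) (by decide), h.sq_of_ne_zero (by decide), mul_one, mul_neg,
    neg_neg, h.sq_zero]

theorem isUnit_gen (μ : Fin 4) : IsUnit (f μ) := by
  have h1 : f μ * ((-eta μ μ) • f μ) = 1 := by
    rw [mul_smul_comm, h.sq, smul_smul, neg_mul_neg, eta_mul_self, one_smul]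
  have h2 : ((-eta μ μ) • f μ) * f μ = 1 := by
    rw [smul_mul_assoc, h.sq, smul_smul, neg_mul_neg, eta_mul_self, one_smul]
  exact ⟨⟨f μ, _, h1, h2⟩, rfl⟩

theorem isUnit_prod : IsUnit (f 0 * f 1 * f 2 * f 3) :=
  (((h.isUnit_gen 0).mul (h.isUnit_gen 1)).mul (h.isUnit_gen 2)).mul (h.isUnit_gen 3)

theorem sum_mul_sum_add (v w : Fin 4 → ℝ) :
    (∑ ρ, v ρ • f ρ) * (∑ σ, w σ • f σ) + (∑ σ, w σ • f σ) * (∑ ρ, v ρ • f ρ) =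
      (-2 * ∑ ρ, ∑ σ, v ρ * eta ρ σ * w σ) • (1 : R) := by
  rw [Finset.sum_mul_sum, Finset.sum_mul_sum, Finset.sum_comm (s := Finset.univ)
    (f := fun σ ρ => w σ • f σ * v ρ • f ρ), ← Finset.sum_add_distrib, Finset.mul_sum,
    Finset.sum_smul]
  refine Finset.sum_congr rfl fun ρ _ => ?_
  rw [← Finset.sum_add_distrib, Finset.mul_sum, Finset.sum_smul]
  refine Finset.sum_congr rfl fun σ _ => ?_
  have : v ρ • f ρ * w σ • f σ + w σ • f σ * v ρ • f ρ =
      (v ρ * w σ) • (f ρ * f σ + f σ * f ρ) := by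
    rw [smul_mul_smul_comm, smul_mul_smul_comm, mul_comm (w σ), smul_add]
  rw [this, h, smul_smul]
  congr 1
  ring

/-- Two Clifford families have a nonzero intertwiner. -/
theorem exists_intertwiner [Nontrivial R] {f' : Fin 4 → R} (h' : IsClifford f') :
    ∃ X : R, X ≠ 0 ∧ ∀ μ, f μ * X = X * f' μ := by
  have key : ∀ s : Finset (Fin 4), ∃ X : R, X ≠ 0 ∧ ∀ μ ∈ s, f μ * X = X * f' μ := by
    intro s
    induction s using Finset.induction_on with
    | empty => exact ⟨1, one_ne_zero, by simp⟩
    | insert ν s hν ih =>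
      obtain ⟨X, hX, hs⟩ := ih
      -- Since `(-eta ν ν) • f ν` is the inverse of `f ν`, this sum is an average that intertwines
      -- the generator `ν`, and the two sign changes keep the relations already achieved.
      by_cases hY : X + (-eta ν ν) • (f ν * X * f' ν) = 0
      · have hflip : f ν * X = -(X * f' ν) := by
          have h1 := congrArg (f ν * ·) hY
          simp only [mul_add, mul_smul_comm, mul_zero, ← mul_assoc] at h1
          rw [h.sq, smul_mul_assoc, one_mul, smul_mul_assoc, smul_smul, neg_mul_neg, eta_mul_self,
            one_smul] at h1
          exact eq_neg_of_add_eq_zero_left h1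
        -- If the average vanishes, `X` has the wrong sign at `ν` only. The product of all
        -- generators times `f' ν` is invertible, anticommutes with `f' ν` and commutes with the
        -- other generators, so it corrects exactly that sign.
        refine ⟨X * (f' 0 * f' 1 * f' 2 * f' 3 * f' ν), fun h0 => hX ?_, fun μ hμ => ?_⟩
        · exact (h'.isUnit_prod.mul (h'.isUnit_gen ν)).mul_left_eq_zero.1 h0
        · rcases Finset.mem_insert.1 hμ with rfl | hμ
          · rw [← mul_assoc, hflip, neg_mul, mul_assoc, ← mul_assoc (f' μ), h'.prod_anticomm, neg_mul,
              mul_neg, neg_neg]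
            simp only [mul_assoc]
          · have hne : μ ≠ ν := fun h => hν (h ▸ hμ)
            rw [← mul_assoc, hs μ hμ, mul_assoc, ← mul_assoc (f' μ), h'.prod_anticomm, neg_mul,
              mul_assoc _ (f' μ), h'.anticomm hne]
            simp only [mul_assoc, mul_neg, neg_neg]
      · refine ⟨_, hY, fun μ hμ => ?_⟩
        rcases Finset.mem_insert.1 hμ with rfl | hμ
        · rw [mul_add, add_mul, mul_smul_comm, smul_mul_assoc, ← mul_assoc, ← mul_assoc, h.sq,
            smul_mul_assoc, smul_mul_assoc, one_mul, smul_smul, neg_mul_neg, eta_mul_self, one_smul,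
            mul_assoc _ (f' μ), h'.sq, mul_smul_comm, mul_one, smul_smul, neg_mul_neg, eta_mul_self,
            one_smul, add_comm]
        · have hne : μ ≠ ν := fun h => hν (h ▸ hμ)
          have h1 : f μ * (f ν * X * f' ν) = f ν * X * f' ν * f' μ := by
            rw [← mul_assoc, ← mul_assoc, h.anticomm hne, neg_mul, neg_mul, mul_assoc (f ν), hs μ hμ,
              mul_assoc (f ν * X), h'.anticomm hne.symm, mul_neg]
            simp only [mul_assoc]
          rw [mul_add, add_mul, hs μ hμ, mul_smul_comm, smul_mul_assoc, h1]
  obtain ⟨X, hX, hs⟩ := key Finset.univ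
  exact ⟨X, hX, fun μ => hs μ (Finset.mem_univ _)⟩

end IsClifford

/-! ### Majorana spinors -/

namespace MajoranaSystem

variable (D : MajoranaSystem)

instance : FiniteDimensional ℝ D.Pinor := inferInstanceAs (FiniteDimensional ℝ D.pinor)

theorem isClifford_maj : IsClifford D.maj := by
  intro μ ν
  refine LinearMap.ext fun x => D.incl_injective ?_
  have h := congrArg (· *ᵥ D.incl x) (D.clifford μ ν)
  simp only [Matrix.add_mulVec, ← Matrix.mulVec_mulVec, Matrix.smul_mulVec, Matrix.one_mulVec] at h
  rw [LinearMap.add_apply, map_add, Module.End.mul_apply, Module.End.mul_apply, incl_maj, incl_maj,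
    incl_maj, incl_maj, h, LinearMap.smul_apply, map_smul, Module.End.one_apply]
  funext i
  simp

/-- The Dirac spinors are the complexification of the Majorana spinors. -/
def prodEquiv : (D.Pinor × D.Pinor) ≃ₗ[ℝ] Dirac :=
  LinearEquiv.ofBijective
    { toFun := fun x => D.incl x.1 + Complex.I • D.incl x.2
      map_add' := fun x y => by simp only [Prod.fst_add, Prod.snd_add, map_add, smul_add]; abel
      map_smul' := fun c x => by
        simp only [Prod.smul_fst, Prod.smul_snd, map_smul, RingHom.id_apply, smul_add,
          smul_comm c Complex.I] }
    ⟨by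
      rw [injective_iff_map_eq_zero]
      rintro ⟨x, y⟩ hxy
      replace hxy : D.incl x + Complex.I • D.incl y = 0 := hxy
      have hx : x = 0 := by
        have := congrArg D.rePart hxy
        rwa [map_add, rePart_incl, rePart_I_incl, add_zero, map_zero] at this
      rw [hx, map_zero, zero_add, smul_eq_zero] at hxy
      have hy : y = 0 := D.incl_injective
        ((hxy.resolve_left Complex.I_ne_zero).trans (map_zero _).symm)
      rw [hx, hy]; rfl,
    fun u => ⟨(D.rePart u, D.rePart (-(Complex.I • u))), D.rePart_decomp u⟩⟩

theorem finrank_pinor : Module.finrank ℝ D.Pinor = 4 := by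
  have h := D.prodEquiv.finrank_eq
  rw [Module.finrank_prod, Module.finrank_pi_fintype] at h
  simp [Complex.finrank_real_complex] at h
  omega

instance : Nontrivial D.Pinor :=
  Module.nontrivial_of_finrank_pos (R := ℝ) (by rw [D.finrank_pinor]; norm_num)

theorem maj5_sq : D.maj5 * D.maj5 = -1 := by
  rw [maj5, neg_mul_neg]
  exact D.isClifford_maj.prod_sq

theorem maj5_anticomm (μ : Fin 4) : D.maj μ * D.maj5 = -(D.maj5 * D.maj μ) := by
  rw [maj5, mul_neg, neg_mul, D.isClifford_maj.prod_anticomm]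

/-- The operator `γ⁰γ³`. -/
def boost : Module.End ℝ D.Pinor := -(D.maj 0 * D.maj 3)

theorem boost_sq : D.boost * D.boost = 1 := by
  have h := D.isClifford_maj
  rw [boost, neg_mul_neg, mul_assoc, h.anticomm_assoc (μ := 3) (ν := 0) (by decide), mul_neg,
    h.sq_assoc, h.sq_of_ne_zero (by decide), eta_zero]
  simp

theorem boost_zero : D.boost * D.maj 0 = -(D.maj 0 * D.boost) := by
  have h := D.isClifford_maj
  rw [boost, mul_neg, neg_neg, neg_mul, mul_assoc, h.anticomm (μ := 3) (ν := 0) (by decide),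
    mul_neg, neg_neg]

theorem boost_one : D.boost * D.maj 1 = D.maj 1 * D.boost := by
  have h := D.isClifford_maj
  rw [boost, mul_neg, neg_mul, mul_assoc, h.anticomm (μ := 3) (ν := 1) (by decide),
    mul_neg, h.anticomm_assoc (μ := 0) (ν := 1) (by decide), neg_neg]

theorem boost_maj5 : D.boost * D.maj5 = D.maj5 * D.boost := by
  rw [boost, mul_neg, neg_mul, mul_assoc, maj5_anticomm, mul_neg, ← mul_assoc, maj5_anticomm,
    neg_mul, neg_neg, mul_assoc]

end MajoranaSystem

namespace MajoranaSystem

variable (D : MajoranaSystem)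

/-! ### The complex structure of Majorana spinors -/

/-- The complex numbers as operators on Majorana spinors, with `i` acting as `iγ⁵`. -/
def cplx : ℂ →ₐ[ℝ] Module.End ℝ D.Pinor := Complex.lift ⟨D.maj5, D.maj5_sq⟩

theorem cplx_apply (z : ℂ) : D.cplx z = z.re • (1 : Module.End ℝ D.Pinor) + z.im • D.maj5 := by
  rw [cplx, Complex.lift_apply, Complex.liftAux_apply, Algebra.algebraMap_eq_smul_one]

theorem cplx_I : D.cplx Complex.I = D.maj5 := by simp [cplx_apply]

theorem maj_cplx (μ : Fin 4) (z : ℂ) : D.maj μ * D.cplx z = D.cplx (conj z) * D.maj μ := by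
  rw [cplx_apply, cplx_apply, mul_add, add_mul, mul_smul_comm, mul_smul_comm, maj5_anticomm]
  simp

theorem commute_cplx {S : Module.End ℝ D.Pinor} (h : S * D.maj5 = D.maj5 * S) (z : ℂ) :
    S * D.cplx z = D.cplx z * S := by
  rw [cplx_apply, mul_add, add_mul, mul_smul_comm, mul_smul_comm, h]
  simp

theorem boost_cplx (z : ℂ) : D.boost * D.cplx z = D.cplx z * D.boost :=
  D.commute_cplx D.boost_maj5 z

theorem eq_zero_of_cplx_eq_zero {M : D.Pinor} (hM : M ≠ 0) {z : ℂ} (h : D.cplx z M = 0) :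
    z = 0 := by
  by_contra hz
  refine hM ?_
  have h1 := congrArg (D.cplx z⁻¹) h
  rwa [← Module.End.mul_apply, ← map_mul, inv_mul_cancel₀ hz, map_one, map_zero] at h1

/-- The map `(p₀, p₁) ↦ p₀ M + p₁ iγ⁰ M` from Pauli spinors to Majorana spinors. -/
def pauliMap (M : D.Pinor) : Pauli →ₗ[ℝ] D.Pinor where
  toFun p := D.cplx (p 0) M + D.cplx (p 1) (D.maj 0 M)
  map_add' p q := by
    simp only [Pi.add_apply, map_add, LinearMap.add_apply]
    abel
  map_smul' c p := by
    simp only [Pi.smul_apply, map_smul, LinearMap.smul_apply, smul_add, RingHom.id_apply]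

theorem pauliMap_apply (M : D.Pinor) (p : Pauli) :
    D.pauliMap M p = D.cplx (p 0) M + D.cplx (p 1) (D.maj 0 M) := rfl

variable {D} {M : D.Pinor} {ε : ℝ}

theorem boost_maj_zero_apply (hM : D.boost M = ε • M) :
    D.boost (D.maj 0 M) = -(ε • D.maj 0 M) := by
  rw [← Module.End.mul_apply, boost_zero, LinearMap.neg_apply, Module.End.mul_apply, hM, map_smul]

theorem boost_pauliMap (hM : D.boost M = ε • M) (p : Pauli) :
    D.boost (D.pauliMap M p) = ε • (D.cplx (p 0) M - D.cplx (p 1) (D.maj 0 M)) := by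
  rw [pauliMap_apply, map_add, ← Module.End.mul_apply, ← Module.End.mul_apply, boost_cplx,
    boost_cplx, Module.End.mul_apply, Module.End.mul_apply, boost_maj_zero_apply hM, hM, map_neg,
    map_smul, map_smul, smul_sub, sub_eq_add_neg]

instance : IsAddTorsionFree D.Pinor := .of_isTorsionFree ℝ D.Pinor

theorem maj_zero_ne_zero (hM0 : M ≠ 0) : D.maj 0 M ≠ 0 := by
  intro h
  have h1 := LinearMap.congr_fun D.isClifford_maj.sq_zero M
  rw [Module.End.mul_apply, h, map_zero] at h1
  exact hM0 (neg_eq_zero.1 h1.symm)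

/-- The two summands of `pauliMap` are eigenvectors of `γ⁰γ³` for `ε` and `-ε`, because `iγ⁰`
anticommutes with it and the complex scalars commute. -/
theorem pauliMap_eq_zero_of_boost_neg (hε : ε ≠ 0) (hM0 : M ≠ 0) (hM : D.boost M = ε • M)
    {p : Pauli} (h : D.boost (D.pauliMap M p) = -(ε • D.pauliMap M p)) : p 0 = 0 := by
  rw [boost_pauliMap hM, ← smul_neg] at h
  have h1 := smul_right_injective D.Pinor hε h
  rw [pauliMap_apply] at h1
  refine D.eq_zero_of_cplx_eq_zero hM0 (self_eq_neg.1 (?_ : D.cplx (p 0) M = -D.cplx (p 0) M))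
  rw [← sub_eq_zero] at h1 ⊢
  rw [← h1]
  abel

theorem pauliMap_eq_zero_of_boost (hε : ε ≠ 0) (hM0 : M ≠ 0) (hM : D.boost M = ε • M)
    {p : Pauli} (h : D.boost (D.pauliMap M p) = ε • D.pauliMap M p) : p 1 = 0 := by
  rw [boost_pauliMap hM] at h
  have h1 := smul_right_injective D.Pinor hε h
  rw [pauliMap_apply] at h1
  refine D.eq_zero_of_cplx_eq_zero (maj_zero_ne_zero hM0)
    (self_eq_neg.1 (?_ : D.cplx (p 1) (D.maj 0 M) = -D.cplx (p 1) (D.maj 0 M)))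
  rw [← sub_eq_zero] at h1 ⊢
  rw [← neg_eq_zero, ← h1]
  abel

/-- A vector sent to `0` meets both eigenvalue conditions, so both its components vanish; the real
dimensions are both `4`. -/
theorem pauliMap_bijective (hε : ε ≠ 0) (hM0 : M ≠ 0) (hM : D.boost M = ε • M) :
    Function.Bijective (D.pauliMap M) := by
  have hinj : Function.Injective (D.pauliMap M) := by
    rw [injective_iff_map_eq_zero]
    intro p hp
    funext i
    fin_cases i
    · exact pauliMap_eq_zero_of_boost_neg hε hM0 hM (by simp [hp])
    · exact pauliMap_eq_zero_of_boost hε hM0 hM (by simp [hp])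
  refine ⟨hinj, (LinearMap.injective_iff_surjective_of_finrank_eq_finrank ?_).1 hinj⟩
  rw [D.finrank_pinor, Module.finrank_pi_fintype]
  simp [Complex.finrank_real_complex]

theorem boost_mem {U : Submodule ℝ D.Pinor} (hU : ∀ μ, ∀ x ∈ U, D.maj μ x ∈ U) {x : D.Pinor}
    (hx : x ∈ U) : D.boost x ∈ U :=
  U.neg_mem (hU 0 _ (hU 3 _ hx))

theorem maj5_mem {U : Submodule ℝ D.Pinor} (hU : ∀ μ, ∀ x ∈ U, D.maj μ x ∈ U) {x : D.Pinor}
    (hx : x ∈ U) : D.maj5 x ∈ U :=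
  U.neg_mem (hU 0 _ (hU 1 _ (hU 2 _ (hU 3 _ hx))))

/-- `y + γ⁰γ³ y` has eigenvalue `1`. If it vanishes, `y` has eigenvalue `-1` and `iγ⁰` reverses the
sign. -/
theorem exists_mem_boost_eq {U : Submodule ℝ D.Pinor} (hU : ∀ μ, ∀ x ∈ U, D.maj μ x ∈ U)
    (h0 : U ≠ ⊥) : ∃ M ∈ U, M ≠ 0 ∧ D.boost M = M := by
  obtain ⟨y, hy, hy0⟩ := U.ne_bot_iff.1 h0
  have hsq : ∀ x, D.boost (D.boost x) = x := fun x => LinearMap.congr_fun D.boost_sq x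
  by_cases h : y + D.boost y = 0
  · refine ⟨D.maj 0 y, hU 0 y hy, maj_zero_ne_zero hy0, ?_⟩
    have h1 : D.boost y = (-1 : ℝ) • y := by
      rw [neg_one_smul]
      exact eq_neg_of_add_eq_zero_right h
    rw [boost_maj_zero_apply h1]
    simp
  · exact ⟨_, add_mem hy (boost_mem hU hy), h, by rw [map_add, hsq, add_comm]⟩

/-- The Majorana spinors are irreducible under the Majorana matrices. -/
theorem eq_top_of_maj_mem {U : Submodule ℝ D.Pinor} (hU : ∀ μ, ∀ x ∈ U, D.maj μ x ∈ U)
    (h0 : U ≠ ⊥) : U = ⊤ := by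
  obtain ⟨M, hM, hM0, hb⟩ := exists_mem_boost_eq hU h0
  have hc : ∀ z, ∀ x ∈ U, D.cplx z x ∈ U := by
    intro z x hx
    rw [cplx_apply]
    exact add_mem (U.smul_mem _ hx) (U.smul_mem _ (maj5_mem hU hx))
  rw [eq_top_iff]
  intro y _
  obtain ⟨p, rfl⟩ := (pauliMap_bijective one_ne_zero hM0 (by rw [hb, one_smul])).2 y
  exact add_mem (hc _ _ hM) (hc _ _ (hU 0 _ hM))

variable (D)

/-- `iγ¹` is an involution commuting with `γ⁰γ³`, and `iγ⁵` commutes with `γ⁰γ³` while exchanging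
the eigenvalues of `iγ¹`. The condition on `iγ¹` singles out a real line in a complex one. -/
theorem exists_boost_eq_maj_one_eq : ∃ M : D.Pinor, M ≠ 0 ∧ D.boost M = M ∧ D.maj 1 M = M := by
  obtain ⟨y, -, hy0, hy⟩ := exists_mem_boost_eq (D := D) (U := ⊤) (by simp) top_ne_bot
  have hb : D.boost (D.maj 1 y) = D.maj 1 y := by
    rw [← Module.End.mul_apply, boost_one, Module.End.mul_apply, hy]
  have hsq : ∀ x, D.maj 1 (D.maj 1 x) = x := fun x =>
    LinearMap.congr_fun (D.isClifford_maj.sq_of_ne_zero (μ := 1) (by decide)) x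
  by_cases h : y + D.maj 1 y = 0
  · refine ⟨D.maj5 y, fun h0 => Complex.I_ne_zero (D.eq_zero_of_cplx_eq_zero hy0 ?_), ?_, ?_⟩
    · rw [cplx_I, h0]
    · rw [← Module.End.mul_apply, boost_maj5, Module.End.mul_apply, hy]
    · rw [← Module.End.mul_apply, maj5_anticomm, LinearMap.neg_apply, Module.End.mul_apply,
        eq_neg_of_add_eq_zero_right h, map_neg, neg_neg]
  · exact ⟨_, h, by rw [map_add, hy, hb], by rw [map_add, hsq, add_comm]⟩

/-- The commutant of the Majorana matrices is `ℝ`. -/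
theorem exists_eq_smul_one {S : Module.End ℝ D.Pinor} (h : ∀ μ, S * D.maj μ = D.maj μ * S) :
    ∃ r : ℝ, S = r • (1 : Module.End ℝ D.Pinor) := by
  obtain ⟨M, hM0, hb, h1⟩ := D.exists_boost_eq_maj_one_eq
  have hb' : D.boost M = (1 : ℝ) • M := by rw [hb, one_smul]
  have hbij := pauliMap_bijective one_ne_zero hM0 hb'
  have h5 : S * D.maj5 = D.maj5 * S := by
    simp only [maj5, mul_neg, neg_mul, ← mul_assoc, h]
    simp only [mul_assoc, h]
  have hSb : S * D.boost = D.boost * S := by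
    simp only [boost, mul_neg, neg_mul, ← mul_assoc, h]
    simp only [mul_assoc, h]
  obtain ⟨p, hp⟩ := hbij.2 (S M)
  -- `S` preserves the eigenspaces of `γ⁰γ³`, so `S M` is a complex multiple of `M`.
  have hp1 : p 1 = 0 := by
    refine pauliMap_eq_zero_of_boost one_ne_zero hM0 hb' ?_
    rw [hp, ← Module.End.mul_apply, ← hSb, Module.End.mul_apply, hb, one_smul]
  have hSM : S M = D.cplx (p 0) M := by
    rw [← hp, pauliMap_apply, hp1, map_zero, LinearMap.zero_apply, add_zero]
  -- `iγ¹` fixes `M`, commutes with `S` and is antilinear for `iγ⁵`, so the multiple is real. As `M`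
  -- generates the space, `S` is this multiple everywhere.
  have hreal : D.cplx (conj (p 0)) M = D.cplx (p 0) M := by
    conv_rhs => rw [← hSM, ← h1, ← Module.End.mul_apply, h, Module.End.mul_apply, hSM,
      ← Module.End.mul_apply, maj_cplx, Module.End.mul_apply, h1]
  have him : conj (p 0) - p 0 = 0 := by
    refine D.eq_zero_of_cplx_eq_zero hM0 ?_
    rw [map_sub, LinearMap.sub_apply, hreal, sub_self]
  obtain ⟨r, hr⟩ := Complex.conj_eq_iff_real.1 (sub_eq_zero.1 him)
  have hSM' : S M = r • M := by
    rw [hSM, hr, cplx_apply]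
    simp
  refine ⟨r, LinearMap.ext fun y => ?_⟩
  obtain ⟨q, rfl⟩ := hbij.2 y
  rw [pauliMap_apply, map_add, ← Module.End.mul_apply, ← Module.End.mul_apply S,
    D.commute_cplx h5, D.commute_cplx h5, Module.End.mul_apply, Module.End.mul_apply,
    ← Module.End.mul_apply S, h, Module.End.mul_apply, hSM']
  simp

theorem nonempty_pauliIso : Nonempty D.PauliIso := by
  obtain ⟨M, -, hM0, hb⟩ := exists_mem_boost_eq (D := D) (U := ⊤) (by simp) top_ne_bot
  have hb' : D.boost M = (1 : ℝ) • M := by rw [hb, one_smul]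
  refine ⟨⟨LinearEquiv.ofBijective _ (pauliMap_bijective one_ne_zero hM0 hb'), fun p => ?_,
    fun p => ?_⟩⟩
  · change D.pauliMap M _ = D.maj5 (D.pauliMap M p)
    simp only [pauliMap_apply, Pi.smul_apply, smul_eq_mul, map_mul, cplx_I, map_add,
      Module.End.mul_apply]
  · change D.pauliMap M _ = D.boost (D.pauliMap M p)
    rw [boost_pauliMap hb', one_smul]
    simp [pauliMap_apply, dotProduct, Fin.sum_univ_two, sub_eq_add_neg]

end MajoranaSystem

/-! ### The covering map of the Lorentz group -/

theorem mul_eta_mul_transpose {A : Matrix (Fin 4) (Fin 4) ℝ} (h : Aᵀ * eta * A = eta) :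
    A * eta * Aᵀ = eta := by
  have h1 : (eta * Aᵀ * eta) * A = 1 := by
    rw [mul_assoc eta, mul_assoc eta, h, eta_mul_eta]
  have h2 := congrArg (· * eta) (mul_eq_one_comm.1 h1)
  simp only [one_mul] at h2
  simpa only [mul_assoc, eta_mul_eta, mul_one] using h2

namespace MajoranaSystem

variable {D : MajoranaSystem}

local notation "End₄" => Module.End ℝ D.Pinor

theorem smul_one_injective : Function.Injective fun r : ℝ => r • (1 : End₄) :=
  smul_left_injective ℝ one_ne_zero

theorem isLorentzImage_iff {S : (End₄)ˣ} {A : Matrix (Fin 4) (Fin 4) ℝ} :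
    D.IsLorentzImage S A ↔ ∀ μ, D.maj μ * (S : End₄) = S * ∑ ν, A μ ν • D.maj ν := by
  refine forall_congr' fun μ => ?_
  rw [mul_assoc, Units.inv_mul_eq_iff_eq_mul]

/-- Conjugation preserves the Clifford relations; comparing the scalars in the relations of the
transformed generators gives the identity. -/
theorem IsLorentzImage.mul_eta {S : (End₄)ˣ} {A : Matrix (Fin 4) (Fin 4) ℝ}
    (h : D.IsLorentzImage S A) : A * eta * Aᵀ = eta := by
  ext μ ν
  have h1 := D.isClifford_maj.sum_mul_sum_add (A μ) (A ν)
  rw [← h μ, ← h ν] at h1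
  have h2 : ∀ μ ν, (↑S⁻¹ : End₄) * D.maj μ * S * (↑S⁻¹ * D.maj ν * S) =
      ↑S⁻¹ * (D.maj μ * D.maj ν) * S := by
    intro μ ν
    simp only [mul_assoc, Units.mul_inv_cancel_left]
  rw [h2, h2, ← add_mul, ← mul_add, D.isClifford_maj, mul_smul_comm, smul_mul_assoc, mul_one,
    Units.inv_mul] at h1
  have h3 := mul_left_cancel₀ (by norm_num) (smul_one_injective h1)
  rw [h3, Matrix.mul_apply, Finset.sum_comm]
  simp only [Matrix.mul_apply, Matrix.transpose_apply, Finset.sum_mul]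

theorem IsLorentzImage.exists_mem {S : (End₄)ˣ} {A : Matrix (Fin 4) (Fin 4) ℝ}
    (h : D.IsLorentzImage S A) : ∃ B ∈ lorentzGroup, (B : Matrix (Fin 4) (Fin 4) ℝ) = A := by
  have h1 : A * (eta * Aᵀ * eta) = 1 := by
    rw [← mul_assoc, ← mul_assoc, h.mul_eta, eta_mul_eta]
  refine ⟨⟨A, eta * Aᵀ * eta, h1, mul_eq_one_comm.1 h1⟩, ?_, rfl⟩
  have h2 := h.mul_eta
  have h3 := mul_eta_mul_transpose (A := Aᵀ) (by rwa [Matrix.transpose_transpose])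
  rwa [Matrix.transpose_transpose] at h3

theorem IsLorentzImage.mul {S S' : (End₄)ˣ} {A B : Matrix (Fin 4) (Fin 4) ℝ}
    (h : D.IsLorentzImage S A) (h' : D.IsLorentzImage S' B) :
    D.IsLorentzImage (S * S') (A * B) := by
  rw [isLorentzImage_iff] at *
  intro μ
  rw [Units.val_mul, ← mul_assoc, h, mul_assoc, mul_assoc]
  congr 1
  simp only [Finset.sum_mul, smul_mul_assoc, h', Matrix.mul_apply, Finset.sum_smul]
  rw [Finset.sum_comm, Finset.mul_sum]
  simp only [Finset.mul_sum, mul_smul_comm, Finset.smul_sum, smul_smul]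

theorem IsLorentzImage.mem_majSpan {S : (End₄)ˣ} {A : Matrix (Fin 4) (Fin 4) ℝ}
    (h : D.IsLorentzImage S A) (μ : Fin 4) : (↑S⁻¹ : End₄) * D.maj μ * S ∈ D.majSpan := by
  rw [h μ]
  exact Submodule.sum_mem _ fun ν _ => Submodule.smul_mem _ _ (Submodule.subset_span ⟨ν, rfl⟩)

theorem exists_isLorentzImage {S : (End₄)ˣ} (hS : S ∈ D.pin) :
    ∃ A ∈ lorentzGroup, D.IsLorentzImage S (A : Matrix (Fin 4) (Fin 4) ℝ) := by
  choose A hA using fun μ => (Submodule.mem_span_range_iff_exists_fun ℝ).1 (hS.2 μ)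
  have h : D.IsLorentzImage S A := fun μ => (hA μ).symm
  obtain ⟨B, hB, rfl⟩ := h.exists_mem
  exact ⟨B, hB, h⟩

theorem abs_det_smul (c : ℝ) (S : End₄) :
    |LinearMap.det (c • S)| = |c| ^ 4 * |LinearMap.det S| := by
  rw [LinearMap.det_smul, D.finrank_pinor, abs_mul, abs_pow]

/-- The Lorentz transformed matrices satisfy the same Clifford relations, so an intertwiner `X ≠ 0`
exists. Its range is stable under all `iγ^μ`, hence everything by irreducibility. -/
theorem exists_mem_pin {A : GL (Fin 4) ℝ} (hA : A ∈ lorentzGroup) :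
    ∃ S ∈ D.pin, D.IsLorentzImage S (A : Matrix (Fin 4) (Fin 4) ℝ) := by
  have hη := mul_eta_mul_transpose hA
  have h' : IsClifford fun μ => ∑ ν, (A : Matrix (Fin 4) (Fin 4) ℝ) μ ν • D.maj ν := by
    intro μ ν
    rw [D.isClifford_maj.sum_mul_sum_add]
    conv_rhs => rw [← hη, Matrix.mul_apply, Finset.sum_congr rfl fun ρ _ => congrArg (· * _)
      (Matrix.mul_apply (i := μ))]
    simp only [Finset.sum_mul, Matrix.transpose_apply]
    rw [Finset.sum_comm]
  obtain ⟨X, hX0, hX⟩ := D.isClifford_maj.exists_intertwiner h'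
  have htop : LinearMap.range X = ⊤ := by
    refine eq_top_of_maj_mem (fun μ => ?_) fun h0 => hX0 (LinearMap.range_eq_bot.1 h0)
    rintro _ ⟨y, rfl⟩
    rw [← Module.End.mul_apply, hX]
    exact ⟨_, rfl⟩
  have hdet : LinearMap.det X ≠ 0 :=
    ((LinearMap.isUnit_iff_isUnit_det X).1 ((LinearMap.isUnit_iff_range_eq_top X).2 htop)).ne_zero
  have hpos : 0 < |LinearMap.det X|⁻¹ := inv_pos.2 (abs_pos.2 hdet)
  -- A fourth root, because rescaling by `c` multiplies the determinant by `c ^ 4`.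
  let c := √√|LinearMap.det X|⁻¹
  have hc4 : c ^ 4 = |LinearMap.det X|⁻¹ := by
    rw [show c ^ 4 = (c ^ 2) ^ 2 by ring, Real.sq_sqrt (Real.sqrt_nonneg _), Real.sq_sqrt hpos.le]
  have hdet1 : |LinearMap.det (c • X)| = 1 := by
    rw [abs_det_smul, abs_of_nonneg (Real.sqrt_nonneg _), hc4,
      inv_mul_cancel₀ (abs_ne_zero.2 hdet)]
  have hunit : IsUnit (c • X) := by
    rw [LinearMap.isUnit_iff_isUnit_det, isUnit_iff_ne_zero]
    intro h0
    rw [h0, abs_zero] at hdet1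
    exact zero_ne_one hdet1
  obtain ⟨S, hS⟩ := hunit
  have himg : D.IsLorentzImage S (A : Matrix (Fin 4) (Fin 4) ℝ) := by
    rw [isLorentzImage_iff]
    intro μ
    rw [hS, mul_smul_comm, hX, smul_mul_assoc]
  exact ⟨S, ⟨by rw [hS, hdet1], himg.mem_majSpan⟩, himg⟩

/-- `S' S⁻¹` commutes with every `iγ^μ`, hence is a real scalar `r`, and the determinants force `|r|
^ 4 = 1`. -/
theorem IsLorentzImage.eq_or_eq_neg {S S' : (End₄)ˣ} {A : Matrix (Fin 4) (Fin 4) ℝ}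
    (h : D.IsLorentzImage S A) (h' : D.IsLorentzImage S' A)
    (hd : |LinearMap.det (S : End₄)| = 1) (hd' : |LinearMap.det (S' : End₄)| = 1) :
    ∃ r : ℝ, (r = 1 ∨ r = -1) ∧ (S' : End₄) = r • (S : End₄) := by
  obtain ⟨r, hr⟩ := D.exists_eq_smul_one (S := (S' : End₄) * ↑S⁻¹) fun μ => by
    have h1 := (h μ).trans (h' μ).symm
    rw [mul_assoc (↑S'⁻¹ : End₄), Units.eq_inv_mul_iff_mul_eq] at h1
    rw [← mul_assoc, Units.eq_mul_inv_iff_mul_eq, ← h1]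
    simp only [mul_assoc]
  have hS' : (S' : End₄) = r • (S : End₄) := by
    rw [Units.mul_inv_eq_iff_eq_mul] at hr
    rw [hr, smul_mul_assoc, one_mul]
  refine ⟨r, ?_, hS'⟩
  rw [hS', abs_det_smul, hd, mul_one] at hd'
  exact eq_or_eq_neg_of_abs_eq ((pow_eq_one_iff_of_nonneg (abs_nonneg r) (by norm_num)).1 hd')

theorem mul_mem_pin {S S' : (End₄)ˣ} (hS : S ∈ D.pin) (hS' : S' ∈ D.pin) : S * S' ∈ D.pin := by
  obtain ⟨A, -, hA⟩ := exists_isLorentzImage hS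
  obtain ⟨B, -, hB⟩ := exists_isLorentzImage hS'
  refine ⟨?_, (hA.mul hB).mem_majSpan⟩
  rw [Units.val_mul, map_mul, abs_mul, hS.1, hS'.1, one_mul]

theorem majSpan_anticomm {v : End₄} (hv : v ∈ D.majSpan) : v * D.maj5 = -(D.maj5 * v) := by
  induction hv using Submodule.span_induction with
  | mem x hx => obtain ⟨μ, rfl⟩ := hx; exact D.maj5_anticomm μ
  | zero => simp
  | add x y _ _ hx hy => rw [add_mul, mul_add, hx, hy, neg_add]
  | smul c x _ hx => rw [smul_mul_assoc, hx, mul_smul_comm, smul_neg]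

/-- The elements of `Pin(3,1)` commute or anticommute with `iγ⁵`. -/
theorem pin_maj5 {S : (End₄)ˣ} (hS : S ∈ D.pin) :
    ∃ r : ℝ, r * r = 1 ∧ (S : End₄) * D.maj5 = r • (D.maj5 * S) := by
  obtain ⟨K, hK⟩ : ∃ K : End₄, K = S * D.maj5 * ↑S⁻¹ := ⟨_, rfl⟩
  have hanti : ∀ μ, D.maj μ * K = -(K * D.maj μ) := by
    intro μ
    have h1 := congrArg (fun x => (S : End₄) * x * ↑S⁻¹) (majSpan_anticomm (hS.2 μ))
    simpa only [mul_assoc, Units.mul_inv_cancel_left, mul_neg, neg_mul, Units.mul_inv, mul_one,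
      hK] using h1
  -- `K` anticommutes with all `iγ^μ`, as `iγ⁵` does, so `iγ⁵ K` commutes with them and is a real
  -- scalar. Then `K² = -1` makes the square of the scalar `1`.
  obtain ⟨r, hr⟩ := D.exists_eq_smul_one (S := D.maj5 * K) fun μ => by
    rw [← mul_assoc (D.maj μ), maj5_anticomm, neg_mul, mul_assoc, mul_assoc, hanti, mul_neg,
      neg_neg]
  have hKr : K = (-r) • D.maj5 := by
    have h1 := congrArg (D.maj5 * ·) hr
    simp only [← mul_assoc, maj5_sq, mul_smul_comm, mul_one, neg_mul, one_mul] at h1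
    rw [neg_smul, ← h1, neg_neg]
  refine ⟨-r, ?_, ?_⟩
  · have hsq : K * K = -1 := by
      simp only [hK, mul_assoc, Units.inv_mul_cancel_left]
      rw [← mul_assoc D.maj5, maj5_sq]
      simp
    rw [hKr, smul_mul_smul_comm, maj5_sq, smul_neg, neg_inj] at hsq
    exact smul_one_injective (hsq.trans (one_smul ℝ _).symm)
  · rw [hK, Units.mul_inv_eq_iff_eq_mul, smul_mul_assoc] at hKr
    exact hKr

/-! ### Parity and time reversal -/

theorem abs_det_of_sq_eq_neg_one {X : End₄} (h : X * X = -1) : |LinearMap.det X| = 1 := by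
  have h1 := congrArg LinearMap.det h
  rw [map_mul, ← neg_one_smul ℝ (1 : End₄), LinearMap.det_smul, D.finrank_pinor, map_one] at h1
  rw [← abs_one, ← sq_eq_sq_iff_abs_eq_abs, sq, h1]
  norm_num

theorem exists_mem_pin_of_sq {X : End₄} (h : X * X = -1) {A : Matrix (Fin 4) (Fin 4) ℝ}
    (hA : ∀ μ, D.maj μ * X = X * ∑ ν, A μ ν • D.maj ν) :
    ∃ S ∈ D.pin, (S : End₄) = X ∧ D.IsLorentzImage S A := by
  let S : (End₄)ˣ := ⟨X, -X, by rw [mul_neg, h, neg_neg], by rw [neg_mul, h, neg_neg]⟩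
  have hS : D.IsLorentzImage S A := isLorentzImage_iff.2 hA
  exact ⟨S, ⟨abs_det_of_sq_eq_neg_one h, hS.mem_majSpan⟩, rfl, hS⟩

theorem sum_eta_smul (μ : Fin 4) : ∑ ν, eta μ ν • D.maj ν = eta μ μ • D.maj μ :=
  Finset.sum_eq_single μ (fun ν _ hν => by rw [eta_of_ne hν.symm, zero_smul]) (by simp)

theorem maj_mul_maj_zero (μ : Fin 4) : D.maj μ * D.maj 0 = D.maj 0 * eta μ μ • D.maj μ := by
  by_cases h : μ = 0
  · subst h; rw [eta_zero, one_smul]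
  · rw [eta_of_ne_zero h, D.isClifford_maj.anticomm h]; simp

variable (D)

theorem exists_mem_pin_parity :
    ∃ S ∈ D.pin, (S : End₄) = D.maj 0 ∧ D.IsLorentzImage S eta :=
  exists_mem_pin_of_sq D.isClifford_maj.sq_zero fun μ => by rw [sum_eta_smul, maj_mul_maj_zero]

theorem exists_mem_pin_timeReversal :
    ∃ S ∈ D.pin, (S : End₄) = -(D.maj 0 * D.maj5) ∧ D.IsLorentzImage S (-eta) := by
  refine exists_mem_pin_of_sq ?_ fun μ => ?_
  · rw [neg_mul_neg, mul_assoc, ← mul_assoc D.maj5, ← neg_eq_iff_eq_neg.2 (D.maj5_anticomm 0),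
      neg_mul, mul_neg, mul_assoc, maj5_sq, ← mul_assoc, D.isClifford_maj.sq_zero]
    simp
  · simp only [Matrix.neg_apply, neg_smul, Finset.sum_neg_distrib]
    rw [sum_eta_smul, neg_mul_neg, mul_neg, ← mul_assoc, maj_mul_maj_zero, mul_assoc, mul_assoc,
      mul_smul_comm, smul_mul_assoc, maj5_anticomm, smul_neg, mul_neg, neg_neg]

end MajoranaSystem

namespace MajoranaSystem

variable {D : MajoranaSystem}

/-! ### `Spin⁺(3,1)` is contained in `Pin(3,1)` -/

theorem maj_mem_majSpan (μ : Fin 4) : D.maj μ ∈ D.majSpan := Submodule.subset_span ⟨μ, rfl⟩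

theorem majSpan_mul_add {v w : Module.End ℝ D.Pinor} (hv : v ∈ D.majSpan) (hw : w ∈ D.majSpan) :
    ∃ r : ℝ, v * w = r • 1 - w * v := by
  obtain ⟨c, rfl⟩ := (Submodule.mem_span_range_iff_exists_fun ℝ).1 hv
  obtain ⟨d, rfl⟩ := (Submodule.mem_span_range_iff_exists_fun ℝ).1 hw
  exact ⟨_, eq_sub_of_add_eq (D.isClifford_maj.sum_mul_sum_add c d)⟩

/-- The null rotations preserve the span of the Majorana matrices. -/
theorem nullRotation_mem_majSpan {k l v : Module.End ℝ D.Pinor} (hk : k ∈ D.majSpan)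
    (hl : l ∈ D.majSpan) (hv : v ∈ D.majSpan) (hkk : k * k = 0) (hkl : l * k = -(k * l)) :
    (1 - k * l) * v * (1 + k * l) ∈ D.majSpan := by
  obtain ⟨r, hr⟩ := majSpan_mul_add hv hk
  obtain ⟨t, ht⟩ := majSpan_mul_add hl hv
  obtain ⟨q, hq⟩ := majSpan_mul_add hl hl
  have hq' : l * l = (q / 2) • (1 : Module.End ℝ D.Pinor) := by
    have h2 : (2 : ℝ) • (l * l) = q • (1 : Module.End ℝ D.Pinor) := by
      rw [two_smul]; nth_rewrite 1 [hq]; abel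
    rw [div_eq_inv_mul, mul_smul, ← h2, smul_smul]
    norm_num
  have h1 : v * (k * l) = r • l - k * (v * l) := by
    rw [← mul_assoc, hr, sub_mul, smul_mul_assoc, one_mul, mul_assoc]
  have h2 : k * l * v = t • k - k * (v * l) := by
    rw [mul_assoc, ht, mul_sub, mul_smul_comm, mul_one]
  have hklk : k * l * k = 0 := by rw [mul_assoc, hkl, mul_neg, ← mul_assoc, hkk, zero_mul, neg_zero]
  have h3 : k * l * v * (k * l) = (r * (q / 2)) • k := by
    rw [mul_assoc, h1, mul_sub, ← mul_assoc _ k, hklk, zero_mul, sub_zero, mul_smul_comm, mul_assoc,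
      hq', mul_smul_comm, mul_one, smul_smul]
  -- The two cubic terms `k * (v * l)` cancel, and the remaining terms lie in the span.
  have h4 : (1 - k * l) * v * (1 + k * l) = v + r • l - t • k - (r * (q / 2)) • k := by
    have h5 : (1 - k * l) * v * (1 + k * l) = v + v * (k * l) - k * l * v - k * l * v * (k * l) := by
      noncomm_ring
    rw [h5, h3, h1, h2]
    abel
  rw [h4]
  exact sub_mem (sub_mem (add_mem hv (Submodule.smul_mem _ _ hl)) (Submodule.smul_mem _ _ hk))
    (Submodule.smul_mem _ _ hk)

theorem maj_three_apply {ε : ℝ} {M : D.Pinor} (hM : D.boost M = ε • M) :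
    D.maj 3 M = ε • D.maj 0 M := by
  have h1 : D.maj 0 (D.maj 3 M) = -(ε • M) := by rw [← hM, boost]; simp
  have h2 := congrArg (D.maj 0) h1
  have h3 : ∀ x, D.maj 0 (D.maj 0 x) = -x := fun x => LinearMap.congr_fun D.isClifford_maj.sq_zero x
  rw [h3, map_neg, map_smul, neg_inj] at h2
  exact h2

theorem maj_one_maj_two_apply {ε : ℝ} {M : D.Pinor} (hM : D.boost M = ε • M) :
    D.maj 1 (D.maj 2 M) = ε • D.maj5 M := by
  have h : D.maj 1 * D.maj 2 = D.maj5 * D.boost := by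
    have hc := D.isClifford_maj
    rw [maj5, boost, neg_mul_neg]
    simp only [mul_assoc]
    rw [hc.anticomm_assoc (μ := 3) (ν := 0) (by decide), hc.sq_of_ne_zero (μ := 3) (by decide),
      mul_one, mul_neg, mul_neg, mul_neg, hc.anticomm (μ := 2) (ν := 0) (by decide), mul_neg,
      mul_neg, neg_neg, hc.anticomm_assoc (μ := 1) (ν := 0) (by decide), mul_neg, hc.sq_assoc,
      eta_zero]
    simp
  rw [← Module.End.mul_apply, h, Module.End.mul_apply, hM, map_smul]

/-- The null vector `iγ⁰ + ε iγ³`. -/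
def nullVector (D : MajoranaSystem) (ε : ℝ) : Module.End ℝ D.Pinor := D.maj 0 + ε • D.maj 3

theorem nullVector_sq {ε : ℝ} (hε : ε * ε = 1) : D.nullVector ε * D.nullVector ε = 0 := by
  have hc := D.isClifford_maj
  rw [nullVector, add_mul, mul_add, mul_add, smul_mul_smul_comm, hε, hc.sq_zero,
    hc.sq_of_ne_zero (μ := 3) (by decide), smul_mul_assoc, mul_smul_comm,
    hc.anticomm (μ := 3) (ν := 0) (by decide)]
  simp

theorem nullVector_mem (ε : ℝ) : D.nullVector ε ∈ D.majSpan :=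
  add_mem (maj_mem_majSpan 0) (Submodule.smul_mem _ _ (maj_mem_majSpan 3))

theorem maj_mul_nullVector (ε : ℝ) {μ : Fin 4} (h0 : μ ≠ 0) (h3 : μ ≠ 3) :
    D.maj μ * D.nullVector ε = -(D.nullVector ε * D.maj μ) := by
  have hc := D.isClifford_maj
  rw [nullVector, mul_add, add_mul, mul_smul_comm, hc.anticomm h0, hc.anticomm h3, smul_mul_assoc,
    smul_neg, neg_add]

/-- Nilpotent operators that lower (or raise) the eigenvalue of `γ⁰γ³` are products of a null vector
and an orthogonal vector. -/
theorem exists_nullRotation {ε : ℝ} (hε : ε * ε = 1) {M M' : D.Pinor} (hM0 : M ≠ 0)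
    (hM : D.boost M = ε • M) (hM' : D.boost M' = -(ε • M')) :
    ∃ l ∈ D.majSpan, l * D.nullVector ε = -(D.nullVector ε * l) ∧
      D.nullVector ε (l M) = M' ∧
      ∀ N, D.boost N = -(ε • N) → D.nullVector ε (l N) = 0 := by
  have hε0 : ε ≠ 0 := fun h => by simp [h] at hε
  have hc := D.isClifford_maj
  have hb1 : ∀ x, D.boost (D.maj 1 x) = D.maj 1 (D.boost x) :=
    fun x => LinearMap.congr_fun D.boost_one x
  have hb2 : ∀ x, D.boost (D.maj 2 x) = D.maj 2 (D.boost x) := by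
    refine fun x => LinearMap.congr_fun (?_ : D.boost * D.maj 2 = D.maj 2 * D.boost) x
    rw [boost, mul_neg, neg_mul, mul_assoc, hc.anticomm (μ := 3) (ν := 2) (by decide),
      mul_neg, hc.anticomm_assoc (μ := 0) (ν := 2) (by decide), neg_neg]
  have hsq1 : ∀ x, D.maj 1 (D.maj 1 x) = x := fun x =>
    LinearMap.congr_fun (hc.sq_of_ne_zero (μ := 1) (by decide)) x
  have hM1 : D.boost (D.maj 1 M) = ε • D.maj 1 M := by rw [hb1, hM, map_smul]
  have hM10 : D.maj 1 M ≠ 0 := fun h => hM0 (by rw [← hsq1 M, h, map_zero])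
  -- `M'` has the opposite eigenvalue, so it is a complex multiple `p 1` of `iγ⁰ iγ¹ M`.
  obtain ⟨p, hp⟩ := (pauliMap_bijective hε0 hM10 hM1).2 M'
  have hp0 : p 0 = 0 := pauliMap_eq_zero_of_boost_neg hε0 hM10 hM1 (by rw [hp, hM'])
  rw [pauliMap_apply, hp0, map_zero, LinearMap.zero_apply, zero_add] at hp
  have hM2 : D.maj 2 M = -(ε • D.maj5 (D.maj 1 M)) := by
    rw [← hsq1 (D.maj 2 M), maj_one_maj_two_apply hM, map_smul, ← Module.End.mul_apply,
      maj5_anticomm, LinearMap.neg_apply, Module.End.mul_apply, smul_neg]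
  -- The null vector acts as `2 iγ⁰` on the eigenspace of `ε`, whence the halves. There `iγ² M`
  -- equals `-ε iγ⁵ iγ¹ M`, so the second term supplies the imaginary part of `p 1`.
  refine ⟨((p 1).re / 2) • D.maj 1 + (ε * (p 1).im / 2) • D.maj 2,
    add_mem (Submodule.smul_mem _ _ (maj_mem_majSpan 1)) (Submodule.smul_mem _ _ (maj_mem_majSpan 2)),
    ?_, ?_, fun N hN => ?_⟩
  · rw [add_mul, mul_add, smul_mul_assoc, smul_mul_assoc, mul_smul_comm, mul_smul_comm,
      maj_mul_nullVector ε (by decide) (by decide), maj_mul_nullVector ε (by decide) (by decide),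
      smul_neg, smul_neg, neg_add]
  · have h1 : D.nullVector ε (D.maj 1 M) = (2 : ℝ) • D.maj 0 (D.maj 1 M) := by
      rw [nullVector, LinearMap.add_apply, LinearMap.smul_apply, maj_three_apply hM1, smul_smul,
        hε, one_smul, two_smul]
    have h2 : D.nullVector ε (D.maj 2 M) = (2 * ε) • D.maj5 (D.maj 0 (D.maj 1 M)) := by
      have h3 : D.boost (D.maj 2 M) = ε • D.maj 2 M := by rw [hb2, hM, map_smul]
      rw [nullVector, LinearMap.add_apply, LinearMap.smul_apply, maj_three_apply h3, smul_smul,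
        hε, one_smul, ← two_smul ℝ, hM2, map_neg, map_smul, ← Module.End.mul_apply (D.maj 0),
        maj5_anticomm, LinearMap.neg_apply, Module.End.mul_apply, smul_neg, smul_neg, smul_neg, neg_neg,
        smul_smul]
    rw [LinearMap.add_apply, map_add, LinearMap.smul_apply, LinearMap.smul_apply, map_smul, map_smul,
      h1, h2, smul_smul, smul_smul, ← hp, cplx_apply, LinearMap.add_apply, LinearMap.smul_apply,
      LinearMap.smul_apply, Module.End.one_apply]
    congr 2
    · ring
    · linear_combination (p 1).im * hε
  · have h1 : ∀ x, D.boost x = -(ε • x) → D.nullVector ε x = 0 := by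
      intro x hx
      rw [nullVector, LinearMap.add_apply, LinearMap.smul_apply, maj_three_apply (ε := -ε)
        (by rw [hx, neg_smul]), smul_smul, mul_neg, hε]
      simp
    rw [LinearMap.add_apply, map_add, LinearMap.smul_apply, LinearMap.smul_apply, map_smul, map_smul,
      h1 (D.maj 1 N) (by rw [hb1, hN, map_neg, map_smul]),
      h1 (D.maj 2 N) (by rw [hb2, hN, map_neg, map_smul])]
    simp

namespace PauliIso

variable (s : D.PauliIso)

theorem spin_apply (T : SL(2, ℂ)) (p : Pauli) : s.spin T (s.toEquiv p) = s.toEquiv (T.1 *ᵥ p) := by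
  simp [spin]

theorem toEquiv_smul (z : ℂ) (p : Pauli) : s.toEquiv (z • p) = D.cplx z (s.toEquiv p) := by
  have h : z • p = z.re • p + z.im • (Complex.I • p) := by
    funext i
    simp only [Pi.add_apply, Pi.smul_apply, smul_eq_mul, Complex.real_smul]
    conv_lhs => rw [← Complex.re_add_im z]
    ring
  rw [h, map_add, map_smul, map_smul, s.map_I, cplx_apply]
  simp

theorem boost_toEquiv (p : Pauli) :
    D.boost (s.toEquiv p) = s.toEquiv (!![1, 0; 0, -1] *ᵥ p) := by
  rw [s.map_sigma3]
  rfl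

theorem ext_of_single {A B : Module.End ℝ D.Pinor} (hA : A * D.maj5 = D.maj5 * A)
    (hB : B * D.maj5 = D.maj5 * B)
    (h : ∀ i : Fin 2, A (s.toEquiv (Pi.single i 1)) = B (s.toEquiv (Pi.single i 1))) : A = B := by
  refine LinearMap.ext fun x => ?_
  obtain ⟨p, rfl⟩ := s.toEquiv.surjective x
  have hp : p = ∑ i, p i • (Pi.single i 1 : Pauli) := by
    funext j
    fin_cases j <;> simp
  rw [hp, map_sum, map_sum, map_sum]
  refine Finset.sum_congr rfl fun i _ => ?_
  rw [toEquiv_smul, ← Module.End.mul_apply, ← Module.End.mul_apply B, D.commute_cplx hA,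
    D.commute_cplx hB, Module.End.mul_apply, Module.End.mul_apply, h]

theorem boost_single_zero (z : ℂ) :
    D.boost (s.toEquiv (Pi.single 0 z)) = s.toEquiv (Pi.single 0 z) := by
  rw [boost_toEquiv]
  congr 1
  funext i
  fin_cases i <;> simp

theorem boost_single_one (z : ℂ) :
    D.boost (s.toEquiv (Pi.single 1 z)) = -s.toEquiv (Pi.single 1 z) := by
  rw [boost_toEquiv, ← map_neg]
  congr 1
  funext i
  fin_cases i <;> simp

theorem toEquiv_single_ne_zero (i : Fin 2) : s.toEquiv (Pi.single i 1) ≠ 0 := by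
  rw [Ne, LinearEquiv.map_eq_zero_iff, Pi.single_eq_zero_iff]
  exact one_ne_zero

theorem abs_det_spin (T : SL(2, ℂ)) : |LinearMap.det (s.spin T)| = 1 := by
  have h : LinearMap.det (s.spin T) =
      LinearMap.det ((Matrix.toLin' T.1).restrictScalars ℝ) :=
    LinearMap.det_conj _ s.toEquiv
  rw [h, LinearMap.det_restrictScalars, LinearMap.det_toLin', T.2, map_one, abs_one]

/-- The elements of `SL(2,ℂ)` that preserve the span of the Majorana matrices. -/
def PreservesMaj (T : SL(2, ℂ)) : Prop :=
  ∀ v ∈ D.majSpan, s.spin T⁻¹ * v * s.spin T ∈ D.majSpan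

variable {s}

theorem PreservesMaj.mul {T T' : SL(2, ℂ)} (h : s.PreservesMaj T) (h' : s.PreservesMaj T') :
    s.PreservesMaj (T * T') := by
  intro v hv
  have := h' _ (h v hv)
  rw [mul_inv_rev, map_mul, map_mul]
  simpa only [mul_assoc] using this

/-- `k * l` squares to zero, so the inverse of `1 + k * l` is `1 - k * l`. -/
theorem preservesMaj_of_nullRotation {T : SL(2, ℂ)} {k l : Module.End ℝ D.Pinor}
    (hk : k ∈ D.majSpan) (hl : l ∈ D.majSpan) (hkk : k * k = 0) (hkl : l * k = -(k * l))
    (h : s.spin T = 1 + k * l) : s.PreservesMaj T := by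
  intro v hv
  have hinv : s.spin T⁻¹ = 1 - k * l := by
    have h1 : s.spin T⁻¹ * s.spin T = 1 := by rw [← map_mul, inv_mul_cancel, map_one]
    have h2 : s.spin T * (1 - k * l) = 1 := by
      have h3 : k * l * (k * l) = 0 := by
        rw [mul_assoc, ← mul_assoc l, hkl, neg_mul, mul_neg, mul_assoc, ← mul_assoc, hkk, zero_mul,
          neg_zero]
      rw [h, mul_sub, mul_one, add_mul, one_mul, h3]
      abel
    calc s.spin T⁻¹ = s.spin T⁻¹ * (s.spin T * (1 - k * l)) := by rw [h2, mul_one]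
      _ = 1 - k * l := by rw [← mul_assoc, h1, one_mul]
  rw [hinv, h]
  exact nullRotation_mem_majSpan hk hl hv hkk hkl

theorem commute_one_add_mul {k l : Module.End ℝ D.Pinor} (hk : k ∈ D.majSpan)
    (hl : l ∈ D.majSpan) : (1 + k * l) * D.maj5 = D.maj5 * (1 + k * l) := by
  rw [add_mul, mul_add, mul_assoc, majSpan_anticomm hl, mul_neg, ← mul_assoc, majSpan_anticomm hk]
  simp [mul_assoc]

variable (s)

/-- `lower z` fixes the second basis spinor and adds `z` times it to the first, which is the action
of a null rotation with `ε = 1`. The upper matrices correspond to `ε = -1`. -/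
theorem preservesMaj_lower (z : ℂ) : s.PreservesMaj (lower z) := by
  obtain ⟨l, hl, hkl, h0, h1⟩ := exists_nullRotation (D := D) (ε := 1) (one_mul 1)
    (s.toEquiv_single_ne_zero 0) (by rw [boost_single_zero, one_smul])
    (M' := s.toEquiv (Pi.single 1 z)) (by rw [boost_single_one, one_smul])
  refine preservesMaj_of_nullRotation (nullVector_mem 1) hl (nullVector_sq (one_mul 1)) hkl
    (s.ext_of_single (s.spin_comm _) (commute_one_add_mul (nullVector_mem 1) hl) fun i => ?_)
  rw [spin_apply, LinearMap.add_apply, Module.End.one_apply, Module.End.mul_apply]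
  fin_cases i
  · change _ = s.toEquiv (Pi.single 0 1) + D.nullVector 1 (l (s.toEquiv (Pi.single 0 1)))
    rw [h0, ← map_add]
    congr 1
    funext j
    fin_cases j <;> simp [lower_val]
  · change _ = s.toEquiv (Pi.single 1 1) + D.nullVector 1 (l (s.toEquiv (Pi.single 1 1)))
    rw [h1 _ (by rw [boost_single_one, one_smul]), add_zero]
    congr 1
    funext j
    fin_cases j <;> simp [lower_val]

theorem preservesMaj_upper (z : ℂ) : s.PreservesMaj (upper z) := by
  have hε : (-1 : ℝ) * -1 = 1 := by norm_num
  obtain ⟨l, hl, hkl, h0, h1⟩ := exists_nullRotation (D := D) (ε := -1) hε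
    (s.toEquiv_single_ne_zero 1) (by rw [boost_single_one, neg_one_smul])
    (M' := s.toEquiv (Pi.single 0 z)) (by rw [boost_single_zero, neg_one_smul, neg_neg])
  refine preservesMaj_of_nullRotation (nullVector_mem (-1)) hl (nullVector_sq hε) hkl
    (s.ext_of_single (s.spin_comm _) (commute_one_add_mul (nullVector_mem (-1)) hl) fun i => ?_)
  rw [spin_apply, LinearMap.add_apply, Module.End.one_apply, Module.End.mul_apply]
  fin_cases i
  · change _ = s.toEquiv (Pi.single 0 1) + D.nullVector (-1) (l (s.toEquiv (Pi.single 0 1)))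
    rw [h1 _ (by rw [boost_single_zero, neg_one_smul, neg_neg]), add_zero]
    congr 1
    funext j
    fin_cases j <;> simp [upper_val]
  · change _ = s.toEquiv (Pi.single 1 1) + D.nullVector (-1) (l (s.toEquiv (Pi.single 1 1)))
    rw [h0, ← map_add]
    congr 1
    funext j
    fin_cases j <;> simp [upper_val]

theorem preservesMaj (T : SL(2, ℂ)) : s.PreservesMaj T := by
  have htorus : ∀ w, s.PreservesMaj (torus w) := by
    intro w
    rw [torus_eq]
    exact (s.preservesMaj_upper _).mul ((s.preservesMaj_lower _).mul ((s.preservesMaj_upper _).mul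
      (((s.preservesMaj_upper _).mul (s.preservesMaj_lower _)).mul (s.preservesMaj_upper _))))
  have hgen : ∀ g : SL(2, ℂ), g.1 0 0 ≠ 0 → s.PreservesMaj g := by
    intro g hg
    rw [eq_lower_torus_upper g (Units.mk0 _ hg) rfl]
    exact ((s.preservesMaj_lower _).mul (htorus _)).mul (s.preservesMaj_upper _)
  by_cases h : T.1 0 0 = 0
  -- Adding the second row to the first makes the upper left entry nonzero, so the factorization
  -- applies.
  · have h1 : T = upper (-1) * (upper 1 * T) := by
      rw [← mul_assoc, ← upper_add, neg_add_cancel, upper_zero, one_mul]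
    rw [h1]
    refine (s.preservesMaj_upper _).mul (hgen _ ?_)
    have hdet := T.2
    rw [Matrix.det_fin_two, h, zero_mul, zero_sub] at hdet
    have h2 : (upper 1 * T).1 0 0 = T.1 1 0 := by
      change ((upper 1).1 * T.1) 0 0 = _
      rw [upper_val, Matrix.mul_apply, Fin.sum_univ_two]
      simp [h]
    rw [h2]
    intro h3
    rw [h3, mul_zero, neg_zero] at hdet
    exact zero_ne_one hdet
  · exact hgen T h

theorem exists_mem_pin_spin (T : SL(2, ℂ)) :
    ∃ S ∈ D.pin, (S : Module.End ℝ D.Pinor) = s.spin T := by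
  refine ⟨⟨s.spin T, s.spin T⁻¹, by rw [← map_mul, mul_inv_cancel, map_one],
    by rw [← map_mul, inv_mul_cancel, map_one]⟩, ⟨s.abs_det_spin T, fun μ => ?_⟩, rfl⟩
  exact s.preservesMaj T _ (maj_mem_majSpan μ)

end PauliIso

end MajoranaSystem

/-! ### The action of `Pin(3,1)` on tensors -/

theorem onAll_onIndex_of_smul {𝕜 : Type*} [Field 𝕜] {E : Type*} [AddCommGroup E] [Module 𝕜 E]
    {J S : Module.End 𝕜 E} {r : 𝕜} {k : ℕ} (h : S * J = r • (J * S)) (i : Fin k) (w : Ten 𝕜 E k) :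
    onAll k S (onIndex J i w) = r • onIndex J i (onAll k S w) := by
  refine ten_ext (f := onAll k S ∘ₗ onIndex J i) (g := r • (onIndex J i ∘ₗ onAll k S))
    (fun x => ?_) w
  rw [LinearMap.smul_apply, LinearMap.comp_apply, LinearMap.comp_apply, onIndex_tprod, onAll_tprod,
    onAll_tprod, onIndex_tprod, ← MultilinearMap.map_update_smul]
  congr 1
  funext j
  by_cases hj : j = i
  · subst hj
    simpa using LinearMap.congr_fun h (x j)
  · simp [hj]

section Action

variable {E : Type*} [AddCommGroup E] [Module ℝ E] {J S : Module.End ℝ E} {r : ℝ} {k a b : ℕ}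

/-- `J` occurs twice in `J₁ Jᵢ`, so the sign picked up by an operator that anticommutes with `J` is
squared away. The same holds for `J₁ ⊗ J₁` in the projection. -/
theorem onAll_mem_symW (hr : r * r = 1) (h : S * J = r • (J * S)) {w : Ten ℝ E k}
    (hw : w ∈ symW J k) : onAll k S w ∈ symW J k := by
  refine ⟨hw.1.onAll S, fun hk i => ?_⟩
  have h1 := congrArg (onAll k S) (hw.2 hk i)
  rwa [onAll_onIndex_of_smul h, onAll_onIndex_of_smul h, map_smul, smul_smul, hr, one_smul,
    map_neg] at h1

theorem act_projJ (hr : r * r = 1) (h : S * J = r • (J * S)) (x : Ten₂ ℝ E a b) :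
    act a b S (projJ J a b x) = projJ J a b (act a b S x) := by
  by_cases hab : 0 < a ∧ 0 < b
  · refine ten₂_ext (f := act a b S ∘ₗ projJ J a b) (g := projJ J a b ∘ₗ act a b S)
      (fun u v => ?_) x
    rw [LinearMap.comp_apply, LinearMap.comp_apply, projJ_tmul J hab.1 hab.2, act_tmul,
      projJ_tmul J hab.1 hab.2, map_smul, map_add, act_tmul, act_tmul, onAll_onIndex_of_smul h,
      onAll_onIndex_of_smul h, TensorProduct.smul_tmul_smul, hr, one_smul]
  · rw [projJ, dif_neg hab]
    rfl

theorem act_mem_spaceW (hr : r * r = 1) (h : S * J = r • (J * S)) {x : Ten₂ ℝ E a b}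
    (hx : x ∈ spaceW J a b) : act a b S x ∈ spaceW J a b := by
  by_cases hab : a = b
  · subst hab
    rw [spaceW_self] at hx ⊢
    obtain ⟨y, hy, rfl⟩ := hx
    refine ⟨act a a S y, ?_, (act_projJ hr h y).symm⟩
    refine (Submodule.span_le (p := (symSq J a).comap (act a a S))).2 ?_ hy
    rintro _ ⟨u, hu, v, hv, rfl⟩
    exact Submodule.subset_span
      ⟨_, onAll_mem_symW hr h hu, _, onAll_mem_symW hr h hv, by rw [map_add]; rfl⟩
  · rw [spaceW_of_ne J hab] at hx ⊢
    obtain ⟨y, hy, rfl⟩ := hx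
    refine ⟨act a b S y, ?_, (act_projJ hr h y).symm⟩
    refine (Submodule.span_le (p := (tensW J a b).comap (act a b S))).2 ?_ hy
    rintro _ ⟨u, hu, v, hv, rfl⟩
    exact Submodule.subset_span ⟨_, onAll_mem_symW hr h hu, _, onAll_mem_symW hr h hv, rfl⟩

theorem act_smul (c : ℝ) (w : Ten₂ ℝ E a b) :
    act a b (c • S) w = c ^ (a + b) • act a b S w := by
  refine ten₂_ext (f := act a b (c • S)) (g := c ^ (a + b) • act a b S) (fun x y => ?_) w
  have h : ∀ {n : ℕ} (x : Fin n → E), onAll n (c • S) (PiTensorProduct.tprod ℝ x) =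
      c ^ n • onAll n S (PiTensorProduct.tprod ℝ x) := by
    intro n x
    rw [onAll_tprod, onAll_tprod]
    have := (PiTensorProduct.tprod ℝ).map_smul_univ (fun _ : Fin n => c) fun i => S (x i)
    simpa using this
  rw [LinearMap.smul_apply, act_tmul, act_tmul, h, h, TensorProduct.smul_tmul_smul, pow_add]

theorem inv_mul_eq_smul {S : (Module.End ℝ E)ˣ} (hr : r * r = 1)
    (h : (S : Module.End ℝ E) * J = r • (J * S)) :
    (↑S⁻¹ : Module.End ℝ E) * J = r • (J * ↑S⁻¹) := by
  have h1 := congrArg (fun x => r • ((↑S⁻¹ : Module.End ℝ E) * x * ↑S⁻¹)) h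
  simp only [mul_smul_comm, smul_mul_assoc, smul_smul, hr, one_smul, ← mul_assoc, Units.inv_mul,
    one_mul] at h1
  rw [h1, mul_assoc, Units.mul_inv, mul_one]

theorem act_inv_apply (S : (Module.End ℝ E)ˣ) (x : Ten₂ ℝ E a b) :
    act a b (S : Module.End ℝ E) (act a b (↑S⁻¹ : Module.End ℝ E) x) = x := by
  rw [← Module.End.mul_apply, ← map_mul, Units.mul_inv, map_one, Module.End.one_apply]

theorem inv_act_apply (S : (Module.End ℝ E)ˣ) (x : Ten₂ ℝ E a b) :
    act a b (↑S⁻¹ : Module.End ℝ E) (act a b (S : Module.End ℝ E) x) = x := by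
  rw [← Module.End.mul_apply, ← map_mul, Units.inv_mul, map_one, Module.End.one_apply]

/-- The action on `spaceW` of an operator that commutes or anticommutes with `J`. -/
def actEquiv (a b : ℕ) (S : (Module.End ℝ E)ˣ)
    (h : ∃ r : ℝ, r * r = 1 ∧ (S : Module.End ℝ E) * J = r • (J * S)) :
    WSpace J a b ≃ₗ[ℝ] WSpace J a b :=
  LinearEquiv.ofLinearMap
    ((act a b (S : Module.End ℝ E)).restrict (p := spaceW J a b) (q := spaceW J a b)
      fun _ hx => by
        obtain ⟨r, hr, h⟩ := h
        exact act_mem_spaceW hr h hx)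
    ((act a b (↑S⁻¹ : Module.End ℝ E)).restrict (p := spaceW J a b) (q := spaceW J a b)
      fun _ hx => by
        obtain ⟨r, hr, h⟩ := h
        exact act_mem_spaceW hr (inv_mul_eq_smul hr h) hx)
    (LinearMap.ext fun w => Subtype.ext (act_inv_apply S (WSpace.incl J a b w)))
    (LinearMap.ext fun w => Subtype.ext (inv_act_apply S (WSpace.incl J a b w)))

theorem incl_actEquiv (S : (Module.End ℝ E)ˣ)
    (h : ∃ r : ℝ, r * r = 1 ∧ (S : Module.End ℝ E) * J = r • (J * S)) (w : WSpace J a b) :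
    WSpace.incl J a b (actEquiv a b S h w) =
      act a b (S : Module.End ℝ E) (WSpace.incl J a b w) := rfl

theorem map_act_spaceW (S : (Module.End ℝ E)ˣ)
    (h : ∃ r : ℝ, r * r = 1 ∧ (S : Module.End ℝ E) * J = r • (J * S)) :
    (spaceW J a b).map (act a b (S : Module.End ℝ E)) = spaceW J a b := by
  obtain ⟨r, hr, h⟩ := h
  refine le_antisymm ?_ fun x hx =>
    ⟨_, act_mem_spaceW hr (inv_mul_eq_smul hr h) hx, act_inv_apply S x⟩
  rintro _ ⟨x, hx, rfl⟩
  exact act_mem_spaceW hr h hx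

end Action

/-- One preimage in `Pin(3,1)` is chosen for each Lorentz transformation. Any other preimage is its
multiple by `±1`, which acts on tensors as `(±1) ^ (a + b)`. -/
theorem MajoranaSystem.exists_projective (D : MajoranaSystem) (a b : ℕ) :
    ∃ P : lorentzGroup → (WSpace D.maj5 a b ≃ₗ[ℝ] WSpace D.maj5 a b),
      (∀ A B : lorentzGroup, (∀ w, P (A * B) w = P A (P B w)) ∨
        (∀ w, P (A * B) w = -P A (P B w))) ∧
      ∀ S ∈ D.pin, ∀ A : lorentzGroup, D.IsLorentzImage S (A : GL (Fin 4) ℝ) →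
        (∀ w, WSpace.incl _ a b (P A w) =
          act a b (S : Module.End ℝ D.Pinor) (WSpace.incl _ a b w)) ∨
        (∀ w, WSpace.incl _ a b (P A w) =
          -act a b (S : Module.End ℝ D.Pinor) (WSpace.incl _ a b w)) := by
  choose S hS hA using fun A : lorentzGroup => exists_mem_pin (D := D) A.2
  have key : ∀ R ∈ D.pin, ∀ A : lorentzGroup, D.IsLorentzImage R (A : GL (Fin 4) ℝ) →
      (∀ w, WSpace.incl _ a b (actEquiv a b (S A) (pin_maj5 (hS A)) w) =
        act a b (R : Module.End ℝ D.Pinor) (WSpace.incl _ a b w)) ∨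
      (∀ w, WSpace.incl _ a b (actEquiv a b (S A) (pin_maj5 (hS A)) w) =
        -act a b (R : Module.End ℝ D.Pinor) (WSpace.incl _ a b w)) := by
    intro R hR A hRA
    obtain ⟨r, hr, hSR⟩ := hRA.eq_or_eq_neg (hA A) hR.1 (hS A).1
    have hpow : r ^ (a + b) = 1 ∨ r ^ (a + b) = -1 := by
      rcases hr with rfl | rfl
      · exact Or.inl (one_pow _)
      · exact neg_one_pow_eq_or ℝ _
    refine hpow.imp (fun h w => ?_) fun h w => ?_
    · rw [incl_actEquiv, hSR, act_smul, h, one_smul]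
    · rw [incl_actEquiv, hSR, act_smul, h]
      exact neg_one_smul ℝ (act a b (R : Module.End ℝ D.Pinor) (WSpace.incl _ a b w))
  refine ⟨fun A => actEquiv a b (S A) (pin_maj5 (hS A)), fun A B => ?_, key⟩
  have hincl : Function.Injective (WSpace.incl D.maj5 a b) := Subtype.val_injective
  refine (key _ (mul_mem_pin (hS A) (hS B)) (A * B) ((hA A).mul (hA B))).imp
    (fun h w => hincl ?_) fun h w => hincl ?_
  · rw [h, Units.val_mul, map_mul, Module.End.mul_apply, incl_actEquiv, incl_actEquiv]
  · rw [h, Units.val_mul, map_mul, Module.End.mul_apply, map_neg, incl_actEquiv, incl_actEquiv]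

/-! ### Operators that are diagonal in a basis of tensors -/

theorem repr_apply_of_diagonal {𝕜 V ι : Type*} [Field 𝕜] [AddCommGroup V] [Module 𝕜 V]
    [Finite ι] (B : Module.Basis ι 𝕜 V) {A : Module.End 𝕜 V} {l : ι → 𝕜}
    (h : ∀ m, A (B m) = l m • B m) (x : V) (m : ι) : B.repr (A x) m = l m * B.repr x m := by
  have := Fintype.ofFinite ι
  classical
  refine LinearMap.congr_fun (?_ : B.coord m ∘ₗ A = l m • B.coord m) x
  refine B.ext fun n => ?_
  rw [LinearMap.comp_apply, h, LinearMap.smul_apply, map_smul, Module.Basis.coord_apply,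
    Module.Basis.repr_self, smul_eq_mul, smul_eq_mul]
  by_cases hn : n = m
  · rw [hn]
  · rw [Finsupp.single_eq_of_ne' hn, mul_zero, mul_zero]

theorem zmon_add (p q : ℤ × ℤ) (w : ℂˣ) : zmon (p + q) w = zmon p w * zmon q w := by
  have h : conj (w : ℂ) ≠ 0 := (map_ne_zero _).2 w.ne_zero
  rw [zmon_apply, zmon_apply, zmon_apply, Prod.fst_add, Prod.snd_add, zpow_add₀ w.ne_zero,
    zpow_add₀ h]
  ring

theorem zmon_zero (w : ℂˣ) : zmon 0 w = 1 := by simp [zmon_apply]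

theorem zmon_sum {ι : Type*} (s : Finset ι) (p : ι → ℤ × ℤ) (w : ℂˣ) :
    zmon (∑ i ∈ s, p i) w = ∏ i ∈ s, zmon (p i) w := by
  classical
  induction s using Finset.induction_on with
  | empty => simp [zmon_zero]
  | insert i s hi ih => rw [Finset.sum_insert hi, Finset.prod_insert hi, zmon_add, ih]

/-! ### Tensors of definite chirality -/

section Chirality

variable {E : Type*} [AddCommGroup E] [Module ℂ E] {G : Module.End ℂ E} {ε δ : ℂ} {k a b : ℕ}

theorem onAll_mem_chiral_neg {S : Module.End ℂ E} (h : S * G = -(G * S)) {v : Ten ℂ E k}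
    (hv : v ∈ chiral G ε k) : onAll k S v ∈ chiral G (-ε) k := by
  refine ⟨hv.1.onAll S, fun i => ?_⟩
  have h1 := congrArg (onAll k S) (hv.2 i)
  rw [onAll_onIndex_of_smul (r := -1) (by rw [h, neg_one_smul]), map_smul] at h1
  rw [neg_smul, ← h1, neg_one_smul, neg_neg]

theorem act_mem_spaceV_neg {S : Module.End ℂ E} (h : S * G = -(G * S)) {x : Ten₂ ℂ E a b}
    (hx : x ∈ spaceV G ε δ a b) : act a b S x ∈ spaceV G (-ε) (-δ) a b := by
  refine (Submodule.span_le (p := (spaceV G (-ε) (-δ) a b).comap (act a b S))).2 ?_ hx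
  rintro _ ⟨u, hu, v, hv, rfl⟩
  exact Submodule.subset_span ⟨_, onAll_mem_chiral_neg h hu, _, onAll_mem_chiral_neg h hv, rfl⟩

theorem map_act_spaceV {S : Module.End ℂ E} (h : S * G = -(G * S)) (hS : S * S = -1) :
    (spaceV G ε δ a b).map (act a b S) = spaceV G (-ε) (-δ) a b := by
  refine le_antisymm ?_ fun x hx => ⟨act a b (-S) x, ?_, ?_⟩
  · rintro _ ⟨x, hx, rfl⟩
    exact act_mem_spaceV_neg h hx
  · have h1 := act_mem_spaceV_neg (S := -S) (by rw [neg_mul, mul_neg, h]) hx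
    rwa [neg_neg, neg_neg] at h1
  · rw [← Module.End.mul_apply, ← map_mul, mul_neg, hS, neg_neg, map_one, Module.End.one_apply]

theorem tprod_mem_chiral {x : E} (hx : G x = ε • x) (k : ℕ) :
    PiTensorProduct.tprod ℂ (fun _ : Fin k => x) ∈ chiral G ε k := by
  refine ⟨isSymmetric_iff.2 fun σ => permTen_tprod σ _, fun i => ?_⟩
  rw [onIndex_tprod, hx, MultilinearMap.map_update_smul, Function.update_eq_self]

variable {ι : Type*} (B : Module.Basis ι ℂ E)

/-- The basis of products of basis vectors. -/
def prodBasis (a b : ℕ) : Module.Basis ((Fin a → ι) × (Fin b → ι)) ℂ (Ten₂ ℂ E a b) :=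
  (Basis.piTensorProduct fun _ => B).tensorProduct (Basis.piTensorProduct fun _ => B)

theorem prodBasis_apply (p : Fin a → ι) (q : Fin b → ι) : prodBasis B a b (p, q) =
    PiTensorProduct.tprod ℂ (fun i => B (p i)) ⊗ₜ PiTensorProduct.tprod ℂ fun j => B (q j) := by
  simp [prodBasis, Module.Basis.tensorProduct_apply]

variable {B}

theorem act_prodBasis {A : Module.End ℂ E} {l : ι → ℂ} (hA : ∀ m, A (B m) = l m • B m)
    (p : Fin a → ι) (q : Fin b → ι) : act a b A (prodBasis B a b (p, q)) =
      ((∏ i, l (p i)) * ∏ j, l (q j)) • prodBasis B a b (p, q) := by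
  rw [prodBasis_apply, act_tmul, onAll_tprod, onAll_tprod]
  simp only [hA, MultilinearMap.map_smul_univ]
  rw [TensorProduct.smul_tmul_smul]

variable [Finite ι]

theorem repr_chiral {l : ι → ℂ} (hG : ∀ m, G (B m) = l m • B m) {u : Ten ℂ E k}
    (hu : u ∈ chiral G ε k) {p : Fin k → ι} {i : Fin k} (h : l (p i) ≠ ε) :
    (Basis.piTensorProduct fun _ => B).repr u p = 0 := by
  have h1 := repr_apply_of_diagonal (Basis.piTensorProduct fun _ : Fin k => B)
    (A := onIndex G i) (l := fun p => l (p i)) (fun p => by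
      rw [Basis.piTensorProduct_apply, onIndex_tprod, hG, MultilinearMap.map_update_smul,
        Function.update_eq_self]) u p
  rw [hu.2 i, map_smul, Finsupp.smul_apply, smul_eq_mul] at h1
  by_contra h0
  exact h (mul_right_cancel₀ h0 h1).symm

/-- The coordinates of elements of `spaceV` vanish unless all indexes have the right chirality. -/
theorem repr_spaceV {l : ι → ℂ} (hG : ∀ m, G (B m) = l m • B m) {w : Ten₂ ℂ E a b}
    (hw : w ∈ spaceV G ε δ a b) {p : Fin a → ι} {q : Fin b → ι}
    (h : (prodBasis B a b).repr w (p, q) ≠ 0) : (∀ i, l (p i) = ε) ∧ ∀ j, l (q j) = δ := by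
  by_contra hcon
  refine h (LinearMap.eqOn_span (f := (prodBasis B a b).coord (p, q)) (g := 0) ?_ hw)
  rintro _ ⟨u, hu, v, hv, rfl⟩
  rw [Module.Basis.coord_apply, prodBasis, Module.Basis.tensorProduct_repr_tmul_apply,
    LinearMap.zero_apply]
  rw [not_and_or] at hcon
  push Not at hcon
  rcases hcon with ⟨i, hi⟩ | ⟨j, hj⟩
  · rw [repr_chiral hG hu hi, smul_zero]
  · rw [repr_chiral hG hv hj, zero_smul]

end Chirality

/-! ### Parity on the spaces `V` -/

namespace MajoranaSystem

variable (D : MajoranaSystem)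

theorem ext_maj (μ : Fin 4) : D.ext (D.maj μ) = Matrix.toLin' (D.g μ) :=
  D.ext_eq _ fun x => by rw [incl_maj, Matrix.toLin'_apply]

theorem ext_neg (S : Module.End ℝ D.Pinor) : D.ext (-S) = -D.ext S :=
  D.ext_eq _ fun x => by rw [LinearMap.neg_apply, ext_incl, LinearMap.neg_apply, map_neg]

theorem ext_mul (S T : Module.End ℝ D.Pinor) : D.ext (S * T) = D.ext S * D.ext T :=
  D.extHom.map_mul S T

theorem ext_one : D.ext 1 = 1 := D.extHom.map_one

theorem map_parity_spaceV (a b : ℕ) :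
    (spaceV D.gamma5 1 (-1) a b).map (act a b (Matrix.toLin' (D.g 0))) =
      spaceV D.gamma5 (-1) 1 a b := by
  rw [← ext_maj]
  have h := map_act_spaceV (G := D.gamma5) (ε := 1) (δ := -1) (a := a) (b := b)
    (S := D.ext (D.maj 0)) ?_ ?_
  · rwa [neg_neg] at h
  · rw [gamma5_eq, mul_smul_comm, smul_mul_assoc, ← ext_mul, ← ext_mul, maj5_anticomm, ext_neg,
      smul_neg]
  · rw [← ext_mul, D.isClifford_maj.sq_zero, ext_neg, ext_one]

/-- Weights of the four basis spinors. -/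
def spinorWeight (m : Fin 2 × Bool) : ℤ × ℤ :=
  if m.2 then ((if m.1 = 0 then 1 else -1), 0) else (0, if m.1 = 0 then 1 else -1)

theorem spinorWeight_injective : Function.Injective spinorWeight := by
  rintro ⟨i, e⟩ ⟨i', e'⟩ h
  revert h
  fin_cases i <;> fin_cases i' <;> cases e <;> cases e' <;> simp [spinorWeight]

/-- The chirality of the four basis spinors. -/
def chirality (m : Fin 2 × Bool) : ℂ := if m.2 then 1 else -1

theorem chirality_eq_one {m : Fin 2 × Bool} : chirality m = 1 ↔ m.2 = true := by
  obtain ⟨i, e⟩ := m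
  cases e <;> norm_num [chirality]

theorem chirality_eq_neg_one {m : Fin 2 × Bool} : chirality m = -1 ↔ m.2 = false := by
  obtain ⟨i, e⟩ := m
  cases e <;> norm_num [chirality]

namespace PauliIso

variable {D} (s : D.PauliIso)

/-- The chiral projections of the Pauli spinors. -/
def chiralSpinor (e : Bool) (x : D.Pinor) : Dirac :=
  D.incl x - (if e then Complex.I else -Complex.I) • D.incl (D.maj5 x)

theorem ext_chiralSpinor {S : Module.End ℝ D.Pinor} (h : S * D.maj5 = D.maj5 * S) (e : Bool)
    (x : D.Pinor) : D.ext S (chiralSpinor e x) = chiralSpinor e (S x) := by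
  rw [chiralSpinor, map_sub, map_smul, ext_incl, ext_incl, chiralSpinor, ← Module.End.mul_apply, h,
    Module.End.mul_apply]

theorem maj5_maj5_apply (x : D.Pinor) : D.maj5 (D.maj5 x) = -x :=
  LinearMap.congr_fun D.maj5_sq x

theorem gamma5_chiralSpinor (e : Bool) (x : D.Pinor) :
    D.gamma5 (chiralSpinor e x) = (if e then (1 : ℂ) else -1) • chiralSpinor e x := by
  rw [gamma5_eq, LinearMap.smul_apply, ext_chiralSpinor rfl, chiralSpinor, maj5_maj5_apply, map_neg,
    chiralSpinor]
  cases e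
  · simp [smul_sub, smul_smul]
    abel
  · simp [smul_sub, smul_smul]
    abel

theorem chiralSpinor_cplx (e : Bool) (z : ℂ) (x : D.Pinor) :
    chiralSpinor e (D.cplx z x) = (if e then z else conj z) • chiralSpinor e x := by
  rw [cplx_apply]
  simp only [chiralSpinor, LinearMap.add_apply, LinearMap.smul_apply, Module.End.one_apply, map_add,
    map_smul, maj5_maj5_apply, map_neg]
  funext i
  cases e
  · simp only [Pi.sub_apply, Pi.add_apply, Pi.smul_apply, Pi.neg_apply, smul_eq_mul,
      Complex.real_smul, Bool.false_eq_true, if_false]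
    rw [show conj z = z.re - z.im * Complex.I by apply Complex.ext <;> simp]
    linear_combination (z.im * D.incl (D.maj5 x) i) * Complex.I_sq
  · simp only [Pi.sub_apply, Pi.add_apply, Pi.smul_apply, Pi.neg_apply, smul_eq_mul,
      Complex.real_smul, if_true]
    conv_rhs => rw [← Complex.re_add_im z]
    linear_combination (z.im * D.incl (D.maj5 x) i) * Complex.I_sq

/-- The Majorana part of this Dirac spinor is `x` itself. -/
theorem chiralSpinor_ne_zero (e : Bool) {x : D.Pinor} (hx : x ≠ 0) : chiralSpinor e x ≠ 0 := by
  intro h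
  refine hx ?_
  have h1 := congrArg D.rePart h
  have h2 : D.rePart ((if e then Complex.I else -Complex.I) • D.incl (D.maj5 x)) = 0 := by
    cases e
    · simp [rePart_I_incl]
    · simp [rePart_I_incl]
  rwa [chiralSpinor, map_sub, h2, rePart_incl, map_zero, sub_zero] at h1

/-- The chiral basis spinors. -/
def basisSpinor (m : Fin 2 × Bool) : Dirac := chiralSpinor m.2 (s.toEquiv (Pi.single m.1 1))

theorem spin_torus_single (t : ℂˣ) (i : Fin 2) :
    s.spin (torus t) (s.toEquiv (Pi.single i 1)) =
      D.cplx (if i = 0 then (t : ℂ) else (t : ℂ)⁻¹) (s.toEquiv (Pi.single i 1)) := by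
  rw [spin_apply, ← toEquiv_smul]
  congr 1
  funext j
  fin_cases i <;> fin_cases j <;> simp [torus_val]

theorem torus_basisSpinor (t : ℂˣ) (m : Fin 2 × Bool) :
    D.ext (s.spin (torus t)) (s.basisSpinor m) = zmon (spinorWeight m) t • s.basisSpinor m := by
  rw [basisSpinor, ext_chiralSpinor (s.spin_comm _), spin_torus_single, chiralSpinor_cplx]
  congr 1
  obtain ⟨i, e⟩ := m
  fin_cases i <;> cases e <;> simp [zmon_apply, spinorWeight]

theorem gamma5_basisSpinor (m : Fin 2 × Bool) :
    D.gamma5 (s.basisSpinor m) = chirality m • s.basisSpinor m :=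
  gamma5_chiralSpinor _ _

/-- The four spinors are eigenvectors of one diagonal matrix, whose eigenvalues differ because the
point is generic. -/
theorem linearIndependent_basisSpinor : LinearIndependent ℂ s.basisSpinor :=
  Module.End.eigenvectors_linearIndependent' (D.ext (s.spin (torus generic)))
    (fun m => zmon (spinorWeight m) generic)
    (zmon_generic_injective.comp spinorWeight_injective) _ fun m =>
      ⟨Module.End.mem_eigenspace_iff.2 (s.torus_basisSpinor generic m),
        chiralSpinor_ne_zero _ (s.toEquiv_single_ne_zero _)⟩

/-- The chiral basis of the Dirac spinors. -/
def chiralBasis : Module.Basis (Fin 2 × Bool) ℂ Dirac :=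
  basisOfLinearIndependentOfCardEqFinrank s.linearIndependent_basisSpinor (by simp)

theorem chiralBasis_apply (m : Fin 2 × Bool) : s.chiralBasis m = s.basisSpinor m := by
  simp [chiralBasis]

/-- The product of `a` spinors of positive and of `b` spinors of negative chirality. -/
def powerSpinor (i : Fin 2) (a b : ℕ) : Ten₂ ℂ Dirac a b :=
  prodBasis s.chiralBasis a b (fun _ => (i, true), fun _ => (i, false))

theorem powerSpinor_mem (i : Fin 2) (a b : ℕ) :
    s.powerSpinor i a b ∈ spaceV D.gamma5 1 (-1) a b := by
  rw [powerSpinor, prodBasis_apply]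
  refine Submodule.subset_span ⟨_, tprod_mem_chiral ?_ a, _, tprod_mem_chiral ?_ b, rfl⟩
  · rw [chiralBasis_apply, gamma5_basisSpinor]; rfl
  · rw [chiralBasis_apply, gamma5_basisSpinor]; rfl

/-- The chirality of a nonzero tensor in either space can be read off any nonempty group of indexes,
and `a ≠ b` ensures that one group is nonempty. -/
theorem spaceV_ne (s : D.PauliIso) {a b : ℕ} (h : a ≠ b) :
    spaceV D.gamma5 (-1) 1 a b ≠ spaceV D.gamma5 1 (-1) a b := by
  intro heq
  have h1 := repr_spaceV (B := s.chiralBasis) (l := chirality)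
    (fun m => by rw [chiralBasis_apply, gamma5_basisSpinor]) (heq ▸ s.powerSpinor_mem 0 a b)
    (p := fun _ => (0, true)) (q := fun _ => (0, false)) (by simp [powerSpinor])
  have hne : (1 : ℂ) ≠ -1 := by norm_num
  rcases Nat.eq_zero_or_pos a with rfl | ha
  · exact hne (h1.2 ⟨0, Nat.pos_of_ne_zero h.symm⟩).symm
  · exact hne (h1.1 ⟨0, ha⟩)

/-- The weight of a product of basis spinors. -/
def tensorWeight {a b : ℕ} (p : Fin a → Fin 2 × Bool) (q : Fin b → Fin 2 × Bool) : ℤ × ℤ :=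
  ∑ i, spinorWeight (p i) + ∑ j, spinorWeight (q j)

theorem act_torus_prodBasis (t : ℂˣ) {a b : ℕ} (p : Fin a → Fin 2 × Bool)
    (q : Fin b → Fin 2 × Bool) :
    act a b (D.ext (s.spin (torus t))) (prodBasis s.chiralBasis a b (p, q)) =
      zmon (tensorWeight p q) t • prodBasis s.chiralBasis a b (p, q) := by
  rw [act_prodBasis (l := fun m => zmon (spinorWeight m) t) fun m => by
    rw [chiralBasis_apply, torus_basisSpinor], tensorWeight, zmon_add, zmon_sum, zmon_sum]

theorem sum_spinorWeight_true {k : ℕ} {p : Fin k → Fin 2 × Bool} (h : ∀ i, (p i).2 = true) :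
    |(∑ i, spinorWeight (p i)).1| ≤ k ∧ (∑ i, spinorWeight (p i)).2 = 0 := by
  rw [Prod.fst_sum, Prod.snd_sum]
  refine ⟨(Finset.abs_sum_le_sum_abs _ _).trans ?_, Finset.sum_eq_zero fun i _ => ?_⟩
  · refine (Finset.sum_le_sum (g := fun _ => 1) fun i _ => ?_).trans (by simp)
    simp only [spinorWeight, h, if_true]
    split_ifs <;> simp
  · simp [spinorWeight, h]

theorem sum_spinorWeight_false {k : ℕ} {p : Fin k → Fin 2 × Bool} (h : ∀ i, (p i).2 = false) :
    (∑ i, spinorWeight (p i)).1 = 0 ∧ |(∑ i, spinorWeight (p i)).2| ≤ k := by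
  rw [Prod.fst_sum, Prod.snd_sum]
  refine ⟨Finset.sum_eq_zero fun i _ => ?_, (Finset.abs_sum_le_sum_abs _ _).trans ?_⟩
  · simp [spinorWeight, h]
  · refine (Finset.sum_le_sum (g := fun _ => 1) fun i _ => ?_).trans (by simp)
    simp only [spinorWeight, h, Bool.false_eq_true, if_false]
    split_ifs <;> simp

/-- The eigenvalues of diagonal matrices on `V_(m,n)`. -/
theorem exists_weight {a b : ℕ} {w : Ten₂ ℂ Dirac a b} (hw : w ∈ spaceV D.gamma5 1 (-1) a b)
    (hw0 : w ≠ 0) {t : ℂˣ} {l c : ℂ} (h : l • w = c • act a b (D.ext (s.spin (torus t))) w) :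
    ∃ x y : ℤ, |x| ≤ a ∧ |y| ≤ b ∧ l = c * zmon (x, y) t := by
  obtain ⟨⟨p, q⟩, hpq⟩ : ∃ m, (prodBasis s.chiralBasis a b).repr w m ≠ 0 := by
    by_contra! hcon
    exact hw0 ((prodBasis s.chiralBasis a b).ext_elem fun m => by rw [hcon, map_zero]; rfl)
  have hchi := repr_spaceV (B := s.chiralBasis) (l := chirality)
    (fun m => by rw [chiralBasis_apply, gamma5_basisSpinor]) hw hpq
  have h1 := sum_spinorWeight_true fun i => chirality_eq_one.1 (hchi.1 i)
  have h2 := sum_spinorWeight_false fun i => chirality_eq_neg_one.1 (hchi.2 i)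
  refine ⟨(tensorWeight p q).1, (tensorWeight p q).2, ?_, ?_, ?_⟩
  · rw [tensorWeight, Prod.fst_add, h2.1, add_zero]; exact h1.1
  · rw [tensorWeight, Prod.snd_add, h1.2, zero_add]; exact h2.2
  · have h3 := congrArg (fun w => (prodBasis s.chiralBasis a b).repr w (p, q)) h
    simp only [map_smul, Finsupp.smul_apply, smul_eq_mul] at h3
    have h4 := repr_apply_of_diagonal (prodBasis s.chiralBasis a b)
      (A := act a b (D.ext (s.spin (torus t))))
      (l := fun m : (Fin a → Fin 2 × Bool) × (Fin b → Fin 2 × Bool) =>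
        zmon (tensorWeight m.1 m.2) t) (fun m => s.act_torus_prodBasis t m.1 m.2) w (p, q)
    rw [h4, ← mul_assoc] at h3
    exact mul_right_cancel₀ hpq h3

/-- `iγ⁰` exchanges the eigenspaces of `γ⁰γ³`, on which `torus t` acts by `t` and `t⁻¹`, and it
conjugates complex scalars. Together this turns `t` into `(conj t)⁻¹`. -/
theorem spin_torus_parity {t t' : ℂˣ} (h : (t' : ℂ) = (conj (t : ℂ))⁻¹) :
    s.spin (torus t') * D.maj 0 = D.maj 0 * s.spin (torus t) := by
  have key : ∀ (u : ℂˣ) (x : D.Pinor), (D.boost x = x → s.spin (torus u) x = D.cplx u x) ∧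
      (D.boost x = -x → s.spin (torus u) x = D.cplx (u : ℂ)⁻¹ x) := by
    intro u x
    obtain ⟨p, rfl⟩ := s.toEquiv.surjective x
    rw [boost_toEquiv, spin_apply, ← toEquiv_smul, ← toEquiv_smul, ← map_neg,
      s.toEquiv.injective.eq_iff, s.toEquiv.injective.eq_iff, s.toEquiv.injective.eq_iff,
      s.toEquiv.injective.eq_iff]
    constructor
    · intro hp
      have h1 : p 1 = 0 := by
        have := congrFun hp 1
        simp [Matrix.mulVec, dotProduct, Fin.sum_univ_two] at this
        exact neg_eq_self.1 this
      funext i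
      fin_cases i <;> simp [torus_val, Matrix.mulVec, dotProduct, Fin.sum_univ_two, h1]
    · intro hp
      have h0 : p 0 = 0 := by
        have := congrFun hp 0
        simp [Matrix.mulVec, dotProduct, Fin.sum_univ_two] at this
        exact self_eq_neg.1 this
      funext i
      fin_cases i <;> simp [torus_val, Matrix.mulVec, dotProduct, Fin.sum_univ_two, h0]
  have hplus : ∀ x, D.boost x = x →
      s.spin (torus t') (D.maj 0 x) = D.maj 0 (s.spin (torus t) x) := by
    intro x hx
    have hx' : D.boost (D.maj 0 x) = -D.maj 0 x := by
      rw [boost_maj_zero_apply (ε := 1) (by rw [hx, one_smul]), one_smul]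
    rw [(key t' _).2 hx', (key t x).1 hx, ← Module.End.mul_apply (D.maj 0), maj_cplx, h, inv_inv]
    rfl
  have hminus : ∀ x, D.boost x = -x →
      s.spin (torus t') (D.maj 0 x) = D.maj 0 (s.spin (torus t) x) := by
    intro x hx
    have hx' : D.boost (D.maj 0 x) = D.maj 0 x := by
      rw [boost_maj_zero_apply (ε := -1) (by rw [hx, neg_one_smul]), neg_one_smul, neg_neg]
    rw [(key t' _).1 hx', (key t x).2 hx, ← Module.End.mul_apply (D.maj 0), maj_cplx, h, map_inv₀ (starRingEnd ℂ)]
    rfl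
  refine LinearMap.ext fun x => ?_
  obtain ⟨p, rfl⟩ := s.toEquiv.surjective x
  have hp : p = Pi.single 0 (p 0) + Pi.single 1 (p 1) := by
    funext i
    fin_cases i <;> simp
  rw [Module.End.mul_apply, Module.End.mul_apply, hp, map_add, map_add, map_add, map_add, map_add,
    hplus _ (s.boost_single_zero _), hminus _ (s.boost_single_one _)]

/-- A single generic diagonal matrix gives the contradiction. Its eigenvectors of weights `(a, b)`
and `(-a, -b)` would be sent to eigenvectors of the parity transformed matrix, up to one scalar `c`.
-/
theorem not_exists_parity {a b : ℕ} (hab : a ≠ b) :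
    ¬ ∃ Q : VSpace D.gamma5 1 (-1) a b ≃ₗ[ℂ] VSpace D.gamma5 1 (-1) a b,
      ∀ T T' : SL(2, ℂ), s.spin T' * D.maj 0 = D.maj 0 * s.spin T →
        ∃ c : ℂ, ∀ v, Q (s.repV a b T v) = c • s.repV a b T' (Q v) := by
  rintro ⟨Q, hQ⟩
  have hgen : conj (generic : ℂ) ≠ 0 := (map_ne_zero _).2 generic.ne_zero
  let t' : ℂˣ := Units.mk0 _ (inv_ne_zero hgen)
  obtain ⟨c, hc⟩ := hQ (torus generic) (torus t') (s.spin_torus_parity rfl)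
  have hzmon : ∀ x y : ℤ, zmon (x, y) t' = zmon (-y, -x) generic := by
    intro x y
    rw [zmon_apply, zmon_apply]
    simp only [t', Units.val_mk0, map_inv₀, Complex.conj_conj, inv_zpow, zpow_neg]
    ring
  have key : ∀ (i : Fin 2) (n : ℤ), n = (if i = 0 then 1 else -1) →
      ∃ x y : ℤ, |x| ≤ a ∧ |y| ≤ b ∧
        zmon (n * a, n * b) generic = c * zmon (-y, -x) generic := by
    intro i n hn
    let v : VSpace D.gamma5 1 (-1) a b := (⟨_, s.powerSpinor_mem i a b⟩ : spaceV _ _ _ _ _)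
    have hv : s.repV a b (torus generic) v = zmon (n * a, n * b) generic • v := by
      refine Subtype.ext ?_
      change act a b (D.ext (s.spin (torus generic))) (s.powerSpinor i a b) =
        _ • s.powerSpinor i a b
      rw [powerSpinor, act_torus_prodBasis]
      congr 2
      simp [tensorWeight, spinorWeight, hn, mul_comm]
    have hv0 : v ≠ 0 := fun h0 =>
      (prodBasis s.chiralBasis a b).ne_zero _ (congrArg (VSpace.incl _ _ _ _ _) h0)
    have hQv : Q v ≠ 0 := (map_ne_zero_iff Q Q.injective).2 hv0
    have h1 := hc v
    rw [hv, map_smul] at h1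
    obtain ⟨x, y, hx, hy, hxy⟩ := s.exists_weight (w := VSpace.incl _ _ _ _ _ (Q v)) (Q v).2
      (fun h0 => hQv (Subtype.ext h0)) (congrArg (VSpace.incl _ _ _ _ _) h1)
    exact ⟨x, y, hx, hy, by rw [hxy, hzmon]⟩
  obtain ⟨x, y, hx, hy, h0⟩ := key 0 1 (by simp)
  obtain ⟨x', y', hx', hy', h1⟩ := key 1 (-1) (by simp)
  have hc0 : c ≠ 0 := by
    rintro rfl
    rw [zero_mul, zmon_apply] at h0
    exact mul_ne_zero (zpow_ne_zero _ generic.ne_zero) (zpow_ne_zero _ hgen) h0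
  -- Multiplying crosswise eliminates `c`. Comparing exponents gives `2 a = y' - y ≤ 2 b` and `2 b =
  -- x' - x ≤ 2 a`, hence `a = b`.
  have h2 : zmon ((1 * (a : ℤ), 1 * (b : ℤ)) + (-y', -x')) generic =
      zmon ((-1 * (a : ℤ), -1 * (b : ℤ)) + (-y, -x)) generic := by
    rw [zmon_add, zmon_add, h0, h1]
    ring
  have h3 := zmon_generic_injective h2
  rw [Prod.ext_iff] at h3
  simp only [Prod.fst_add, Prod.snd_add] at h3
  rw [abs_le] at hx hy hx' hy'
  omega

end PauliIso

end MajoranaSystem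

end MajoranaRep

end

open MajoranaRep in
theorem mainTheorem5 (D : MajoranaSystem) :
    Nonempty D.PauliIso ∧ ∀ s : D.PauliIso,
    -- the `W_(m,n)`, `m ≥ n`, are real finite-dimensional irreducible representations
    (∀ a b : ℕ, b ≤ a → FiniteDimensional ℝ (WSpace D.maj5 a b) ∧
      IsContinuousRep (s.repW a b) ∧ (s.repW a b).IsIrreducible) ∧
    -- they are pairwise inequivalent
    (∀ a b a' b' : ℕ, b ≤ a → b' ≤ a' →
      Nonempty ((s.repW a b).Equiv (s.repW a' b')) → a = a' ∧ b = b') ∧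
    -- every real finite-dimensional irreducible representation is equivalent to one of them
    (∀ (V : Type*) [AddCommGroup V] [Module ℝ V] [FiniteDimensional ℝ V]
      (ρ : Representation ℝ SL(2, ℂ) V), IsContinuousRep ρ → ρ.IsIrreducible →
      ∃ a b : ℕ, b ≤ a ∧ Nonempty (ρ.Equiv (s.repW a b))) ∧
    -- `W_(0,0)` is the trivial representation on `ℝ`
    Nonempty ((s.repW 0 0).Equiv (Representation.trivial ℝ SL(2, ℂ) ℝ)) ∧
    -- `Λ` maps `Pin(3,1)` onto the full Lorentz group
    (∀ S ∈ D.pin, ∃ A ∈ lorentzGroup, D.IsLorentzImage S A) ∧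
    (∀ A ∈ lorentzGroup, ∃ S ∈ D.pin, D.IsLorentzImage S A) ∧
    -- `Spin⁺(3,1)`, the parity `iγ⁰` and the time reversal `γ⁰γ⁵` are in `Pin(3,1)`
    (∀ T : SL(2, ℂ), ∃ S ∈ D.pin, (S : Module.End ℝ D.Pinor) = s.spin T) ∧
    (∃ S ∈ D.pin, (S : Module.End ℝ D.Pinor) = D.maj 0 ∧ D.IsLorentzImage S eta) ∧
    (∃ S ∈ D.pin, (S : Module.End ℝ D.Pinor) = -(D.maj 0 * D.maj5) ∧
      D.IsLorentzImage S (-eta)) ∧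
    -- the `W_(m,n)` are projective representations of the full Lorentz group
    (∀ a b : ℕ, b ≤ a →
      (∀ S ∈ D.pin, (spaceW D.maj5 a b).map (act a b (S : Module.End ℝ D.Pinor)) =
        spaceW D.maj5 a b) ∧
      ∃ P : lorentzGroup → (WSpace D.maj5 a b ≃ₗ[ℝ] WSpace D.maj5 a b),
        (∀ A B : lorentzGroup, (∀ w, P (A * B) w = P A (P B w)) ∨
          (∀ w, P (A * B) w = -P A (P B w))) ∧
        ∀ S ∈ D.pin, ∀ A : lorentzGroup, D.IsLorentzImage S (A : GL (Fin 4) ℝ) →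
          (∀ w, WSpace.incl _ a b (P A w) =
            act a b (S : Module.End ℝ D.Pinor) (WSpace.incl _ a b w)) ∨
          (∀ w, WSpace.incl _ a b (P A w) =
            -act a b (S : Module.End ℝ D.Pinor) (WSpace.incl _ a b w))) ∧
    -- parity maps `V_m⁺ ⊗ V_n⁻` onto `V_m⁻ ⊗ V_n⁺`, and, for `m ≠ n`, it does not preserve the
    -- complex representation `V_(m,n)`: no operator on `V_(m,n)` implements it, even up to a factor
    (∀ a b : ℕ, (spaceV D.gamma5 1 (-1) a b).map (act a b (Matrix.toLin' (D.g 0))) =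
        spaceV D.gamma5 (-1) 1 a b) ∧
    (∀ a b : ℕ, a ≠ b → spaceV D.gamma5 (-1) 1 a b ≠ spaceV D.gamma5 1 (-1) a b ∧
      ¬ ∃ Q : VSpace D.gamma5 1 (-1) a b ≃ₗ[ℂ] VSpace D.gamma5 1 (-1) a b,
        ∀ T T' : SL(2, ℂ), s.spin T' * D.maj 0 = D.maj 0 * s.spin T →
          ∃ c : ℂ, ∀ v, Q (s.repV a b T v) = c • s.repV a b T' (Q v)) := by
  refine ⟨D.nonempty_pauliIso, fun s => ⟨fun a b _ => ?_, fun a b a' b' hab hab' h => ?_,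
    fun V _ _ _ ρ hρ hirr => s.exists_equiv_repW ρ hρ hirr, s.nonempty_equiv_trivial,
    fun S hS => MajoranaSystem.exists_isLorentzImage hS,
    fun A hA => MajoranaSystem.exists_mem_pin hA, s.exists_mem_pin_spin, D.exists_mem_pin_parity,
    D.exists_mem_pin_timeReversal, fun a b _ =>
      ⟨fun S hS => map_act_spaceW S (MajoranaSystem.pin_maj5 hS), D.exists_projective a b⟩,
    D.map_parity_spaceV, fun a b hab => ⟨s.spaceV_ne hab, s.not_exists_parity hab⟩⟩⟩
  · have h := s.isModel_repW a b
    exact ⟨h.finite, h.cont, h.isIrreducible⟩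
  · obtain ⟨e⟩ := h
    exact (s.isModel_repW a b).eq_of_equiv (s.isModel_repW a' b') e hab hab'
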